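/- Let $d\ge 1$, $c,I,J\ge 0$ be integers and $m=(I+1)d+(J+1)c$. Consider the recurrent network $r_{s}=g\big(\sum_{i=0}^{I}F_i r_{s-1-i}+\sum_{j=0}^{J}B_j u_{s-j}+e_{s}\big)$ with activities $r_s\in\mathbb R^d$, controls $u_s\in\mathbb R^c$ and a known bijection $g:\mathbb R^d\to\mathbb R^d$. Put $y_s=g^{-1}(r_s)$, $x_s=[r_{s-1-I};\dots;r_{s-1};u_{s-J};\dots;u_s]\in\mathbb R^m$ and $A=[F_I,\dots,F_0,B_J,\dots,B_0]\in\mathbb R^{d\times m}$, so that $y_s=Ax_s+e_s$. Bayesian model: $V\in\mathbb R^{d\times d}$ (symmetric positive definite) has the inverted Wishart density $$\frac{1}{Z_{n,d}}\,|V|^{-(d+1)/2}\,\Big|\tfrac12V^{-1}Q_0\Big|^{n/2}e^{-\frac12\operatorname{tr}(V^{-1}Q_0)},\qquad Z_{n,d}=\pi^{d(d-1)/4}\prod_{i=1}^d\Gamma\big(\tfrac{n+1-i}{2}\big),$$ where $Q_0\in\mathbb R^{d\times d}$ is positive definite and $n>d-1$ is real; given $V$, $A$ has the matrix normal density $\frac{|K_0|^{d/2}}{|2\pi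 V|^{m/2}}e^{-\frac12\operatorname{tr}((A-M_0)^TV^{-1}(A-M_0)K_0)}$, where $M_0\in\mathbb R^{d\times m}$ and $K_0\in\mathbb R^{m\times m}$ is positive definite; given $(A,V)$, the $e_s$ are independent and $\mathcal N(0,V)$-distributed. Let $t\ge 0$, let the initial data and $x_1,\dots,x_t,y_1,\dots,y_t$ be given, and put $K_t=K_0+\sum_{s=1}^t x_sx_s^T$. For a control $u\in\mathbb R^c$ applied at time $t+1$ let $x_{t+1}=x_{t+1}(u)=[r_{t-I};\dots;r_t;u_{t-J+1};\dots;u_t;u]$. Under the law of $(\theta,e_{t+1})$, $\theta=(A,V)$, conditional on the data up to time $t$, let $I_{\mathrm{noise}}(u)$ be the mutual information between $e_{t+1}$ and $y_{t+1}=Ax_{t+1}(u)+e_{t+1}$, and $I_{\mathrm{par}}(u)$ the mutual information between $\theta$ and $y_{t+1}$ (the Kullback–Leibler divergence of the joint law from the product of the marginals, with values in $[0,\infty]$). Then for every set $\mathcal U\subseteq\mathbb R^c$ of admissible controls: 1. (Noise estimation) $\displaystyle\arg\max_{u\in\mathcal U} I_{\mathrm{noise}}(u)=\arg\min_{u\in\mathcal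 U}x_{t+1}(u)^TK_t^{-1}x_{t+1}(u)$, as sets. 2. (Parameter learning) $\displaystyle\arg\max_{u\in\mathcal U} I_{\mathrm{par}}(u)=\arg\max_{u\in\mathcal U}x_{t+1}(u)^TK_t^{-1}x_{t+1}(u)$, as sets. 3. (Incompatibility) For all controls $u,u'\in\mathbb R^c$: $I_{\mathrm{noise}}(u)<I_{\mathrm{noise}}(u')$ if and only if $I_{\mathrm{par}}(u')<I_{\mathrm{par}}(u)$. In particular, if some $u\in\mathcal U$ maximizes both $I_{\mathrm{noise}}$ and $I_{\mathrm{par}}$ over $\mathcal U$, then $x_{t+1}(\cdot)^TK_t^{-1}x_{t+1}(\cdot)$ is constant on $\mathcal U$. -/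

import Mathlib

open MeasureTheory Matrix

open scoped ENNReal

noncomputable section

namespace NoiseDesign

/-! ### Densities of the Bayesian model -/

/-- Density at `y` of the normal distribution on `ℝ^d` with mean `μ` and covariance matrix `V`. -/
def normalDensity {d : ℕ} (μ : Fin d → ℝ) (V : Matrix (Fin d) (Fin d) ℝ) (y : Fin d → ℝ) : ℝ :=
  ((2 * Real.pi) • V).det ^ (-(1 / 2) : ℝ) *
    Real.exp (-(1 / 2) * ((y - μ) ⬝ᵥ (V⁻¹ *ᵥ (y - μ))))

/-- Density at `A` of the matrix normal distribution with mean `M`, row covariance `V` and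
precision parameter `K`. -/
def matrixNormalDensity {d : ℕ} {ι : Type} [Fintype ι] [DecidableEq ι]
    (M : Matrix (Fin d) ι ℝ) (V : Matrix (Fin d) (Fin d) ℝ) (K : Matrix ι ι ℝ)
    (A : Matrix (Fin d) ι ℝ) : ℝ :=
  K.det ^ ((d : ℝ) / 2) / ((2 * Real.pi) • V).det ^ ((Fintype.card ι : ℝ) / 2) *
    Real.exp (-(1 / 2) * ((A - M)ᵀ * V⁻¹ * (A - M) * K).trace)

/-- The normalizing constant `Z_{n,d} = π^{d(d-1)/4} ∏_{i=1}^d Γ((n+1-i)/2)`. -/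
def wishartConst (n : ℝ) (d : ℕ) : ℝ :=
  Real.pi ^ ((d : ℝ) * ((d : ℝ) - 1) / 4) *
    ∏ i ∈ Finset.Icc 1 d, Real.Gamma ((n + 1 - (i : ℝ)) / 2)

open Classical in
/-- Density at `V` of the inverted Wishart distribution with parameters `Q` and `n`; it is
supported on the positive definite matrices. -/
def invWishartDensity {d : ℕ} (Q : Matrix (Fin d) (Fin d) ℝ) (n : ℝ)
    (V : Matrix (Fin d) (Fin d) ℝ) : ℝ :=
  if V.PosDef then
    1 / wishartConst n d * (1 / V.det ^ (((d : ℝ) + 1) / 2)) *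
      ((1 / 2 : ℝ) • (V⁻¹ * Q)).det ^ (n / 2) * Real.exp (-(1 / 2) * (V⁻¹ * Q).trace)
  else 0

/-! ### Reference measures -/

/-- The Borel σ-algebra on a space of real matrices, i.e. the product σ-algebra of its entries. -/
instance instMeasurableSpaceRealMatrix {α β : Type} : MeasurableSpace (Matrix α β ℝ) :=
  inferInstanceAs (MeasurableSpace (α → β → ℝ))

/-- Lebesgue measure on `ℝ^{α × β}`. -/
def matrixLebesgue (α β : Type) [Fintype α] [Fintype β] : Measure (Matrix α β ℝ) :=
  (volume : Measure (α → β → ℝ)).map (fun a => Matrix.of a)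

/-- The symmetric matrix with prescribed entries on and above the diagonal. -/
def symMatrix {d : ℕ} (v : {p : Fin d × Fin d // p.1 ≤ p.2} → ℝ) : Matrix (Fin d) (Fin d) ℝ :=
  Matrix.of fun i j => if h : i ≤ j then v ⟨(i, j), h⟩ else v ⟨(j, i), (not_le.mp h).le⟩

/-- Lebesgue measure on the symmetric `d × d` matrices (`dV = ∏_{i ≤ j} dV_{ij}`), as a measure
on all matrices. -/
def symLebesgue (d : ℕ) : Measure (Matrix (Fin d) (Fin d) ℝ) :=
  (volume : Measure ({p : Fin d × Fin d // p.1 ≤ p.2} → ℝ)).map symMatrix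

/-! ### The network -/

/-- Coordinates of the regressor: the `d` components of the `I + 1` most recent activities and
the `c` components of the `J + 1` most recent controls. -/
abbrev RegIdx (d c I J : ℕ) : Type := (Fin (I + 1) × Fin d) ⊕ (Fin (J + 1) × Fin c)

/-- The regressor `x_s = [r_{s-1-I}; …; r_{s-1}; u_{s-J}; …; u_s]`. Accordingly, the column block
`(inl i, ·)` of the parameter matrix `A` is `F_i` and the block `(inr j, ·)` is `B_j`. -/
def regressor {d c : ℕ} (I J : ℕ) (r : ℤ → Fin d → ℝ) (u : ℤ → Fin c → ℝ) (s : ℤ) :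
    RegIdx d c I J → ℝ
  | Sum.inl (i, k) => r (s - 1 - (i : ℤ)) k
  | Sum.inr (j, k) => u (s - (j : ℤ)) k

/-- The regressor `x_{t+1}` when the control `v` is applied at time `t + 1`. -/
def nextRegressor {d c : ℕ} (I J : ℕ) (r : ℤ → Fin d → ℝ) (u : ℤ → Fin c → ℝ) (t : ℕ)
    (v : Fin c → ℝ) : RegIdx d c I J → ℝ :=
  regressor I J r (Function.update u ((t : ℤ) + 1) v) ((t : ℤ) + 1)

/-- The precision matrix after `t` observations, `K_t = K_0 + ∑_{s=1}^t x_s x_sᵀ`. -/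
def precision {d c I J : ℕ} (K₀ : Matrix (RegIdx d c I J) (RegIdx d c I J) ℝ)
    (r : ℤ → Fin d → ℝ) (u : ℤ → Fin c → ℝ) (t : ℕ) :
    Matrix (RegIdx d c I J) (RegIdx d c I J) ℝ :=
  K₀ + ∑ s ∈ Finset.Icc (1 : ℤ) t, vecMulVec (regressor I J r u s) (regressor I J r u s)

/-- The cost `x_{t+1}ᵀ K_t⁻¹ x_{t+1}` as a function of the control `v` at time `t + 1`. -/
def cost {d c I J : ℕ} (K₀ : Matrix (RegIdx d c I J) (RegIdx d c I J) ℝ)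
    (r : ℤ → Fin d → ℝ) (u : ℤ → Fin c → ℝ) (t : ℕ) (v : Fin c → ℝ) : ℝ :=
  nextRegressor I J r u t v ⬝ᵥ ((precision K₀ r u t)⁻¹ *ᵥ nextRegressor I J r u t v)

/-! ### Laws of the parameters and of the next noise -/

/-- The unknown parameters `θ = (A, V)`. -/
abbrev Param (d c I J : ℕ) : Type :=
  Matrix (Fin d) (RegIdx d c I J) ℝ × Matrix (Fin d) (Fin d) ℝ

/-- Prior law of `θ = (A, V)`: `V` is inverted Wishart with parameters `Q₀`, `n₀`, and given `V`
the matrix `A` is matrix normal with parameters `M₀`, `V`, `K₀`. -/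
def priorLaw {d c I J : ℕ} (M₀ : Matrix (Fin d) (RegIdx d c I J) ℝ)
    (K₀ : Matrix (RegIdx d c I J) (RegIdx d c I J) ℝ) (Q₀ : Matrix (Fin d) (Fin d) ℝ) (n₀ : ℝ) :
    Measure (Param d c I J) :=
  ((matrixLebesgue (Fin d) (RegIdx d c I J)).prod (symLebesgue d)).withDensity fun θ =>
    ENNReal.ofReal (matrixNormalDensity M₀ θ.2 K₀ θ.1 * invWishartDensity Q₀ n₀ θ.2)

/-- Likelihood of `θ = (A, V)` for the observations at times `1, …, t`, where `y_s = g⁻¹(r_s)`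
is normal with mean `A x_s` and covariance `V`. -/
def likelihood {d c I J : ℕ} (g : (Fin d → ℝ) ≃ (Fin d → ℝ)) (r : ℤ → Fin d → ℝ)
    (u : ℤ → Fin c → ℝ) (t : ℕ) (θ : Param d c I J) : ℝ :=
  ∏ s ∈ Finset.Icc (1 : ℤ) t,
    normalDensity (θ.1 *ᵥ regressor I J r u s) θ.2 (g.symm (r s))

/-- Prior weighted by the likelihood. -/
def unnormalizedPosterior {d c I J : ℕ} (g : (Fin d → ℝ) ≃ (Fin d → ℝ))
    (M₀ : Matrix (Fin d) (RegIdx d c I J) ℝ) (K₀ : Matrix (RegIdx d c I J) (RegIdx d c I J) ℝ)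
    (Q₀ : Matrix (Fin d) (Fin d) ℝ) (n₀ : ℝ) (r : ℤ → Fin d → ℝ) (u : ℤ → Fin c → ℝ) (t : ℕ) :
    Measure (Param d c I J) :=
  (priorLaw M₀ K₀ Q₀ n₀).withDensity fun θ => ENNReal.ofReal (likelihood g r u t θ)

/-- Posterior law of `θ = (A, V)` given the observations at times `1, …, t` (Bayes' rule). -/
def posteriorLaw {d c I J : ℕ} (g : (Fin d → ℝ) ≃ (Fin d → ℝ))
    (M₀ : Matrix (Fin d) (RegIdx d c I J) ℝ) (K₀ : Matrix (RegIdx d c I J) (RegIdx d c I J) ℝ)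
    (Q₀ : Matrix (Fin d) (Fin d) ℝ) (n₀ : ℝ) (r : ℤ → Fin d → ℝ) (u : ℤ → Fin c → ℝ) (t : ℕ) :
    Measure (Param d c I J) :=
  (unnormalizedPosterior g M₀ K₀ Q₀ n₀ r u t Set.univ)⁻¹ •
    unnormalizedPosterior g M₀ K₀ Q₀ n₀ r u t

/-- Joint law of `(θ, e_{t+1})` given the observations at times `1, …, t`: given `θ = (A, V)`, the
noise `e_{t+1}` is normal with mean `0` and covariance `V`. -/
def predictiveLaw {d c I J : ℕ} (g : (Fin d → ℝ) ≃ (Fin d → ℝ))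
    (M₀ : Matrix (Fin d) (RegIdx d c I J) ℝ) (K₀ : Matrix (RegIdx d c I J) (RegIdx d c I J) ℝ)
    (Q₀ : Matrix (Fin d) (Fin d) ℝ) (n₀ : ℝ) (r : ℤ → Fin d → ℝ) (u : ℤ → Fin c → ℝ) (t : ℕ) :
    Measure (Param d c I J × (Fin d → ℝ)) :=
  ((posteriorLaw g M₀ K₀ Q₀ n₀ r u t).prod (volume : Measure (Fin d → ℝ))).withDensity fun ω =>
    ENNReal.ofReal (normalDensity 0 ω.1.2 ω.2)

/-! ### Mutual information -/

/-- Mutual information of the random variables `X` and `Y` on `(Ω, P)`: the Kullback–Leibler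
divergence of their joint law from the product of their marginal laws (possibly `∞`). -/
def mutualInfo {Ω α β : Type} [MeasurableSpace Ω] [MeasurableSpace α] [MeasurableSpace β]
    (P : Measure Ω) (X : Ω → α) (Y : Ω → β) : ℝ≥0∞ :=
  InformationTheory.klDiv (P.map fun ω => (X ω, Y ω)) ((P.map X).prod (P.map Y))

/-- The next output `y_{t+1} = A x_{t+1} + e_{t+1}` when the control `v` is applied. -/
def nextOutput {d c I J : ℕ} (r : ℤ → Fin d → ℝ) (u : ℤ → Fin c → ℝ) (t : ℕ) (v : Fin c → ℝ)
    (ω : Param d c I J × (Fin d → ℝ)) : Fin d → ℝ :=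
  ω.1.1 *ᵥ nextRegressor I J r u t v + ω.2

/-- Mutual information between the noise `e_{t+1}` and the output `y_{t+1}`, given the past, as a
function of the control `v` at time `t + 1`. -/
def noiseInfo {d c I J : ℕ} (g : (Fin d → ℝ) ≃ (Fin d → ℝ))
    (M₀ : Matrix (Fin d) (RegIdx d c I J) ℝ) (K₀ : Matrix (RegIdx d c I J) (RegIdx d c I J) ℝ)
    (Q₀ : Matrix (Fin d) (Fin d) ℝ) (n₀ : ℝ) (r : ℤ → Fin d → ℝ) (u : ℤ → Fin c → ℝ) (t : ℕ)
    (v : Fin c → ℝ) : ℝ≥0∞ :=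
  mutualInfo (predictiveLaw g M₀ K₀ Q₀ n₀ r u t) (fun ω => ω.2) (nextOutput r u t v)

/-- Mutual information between the parameters `θ = (A, V)` and the output `y_{t+1}`, given the
past, as a function of the control `v` at time `t + 1`. -/
def paramInfo {d c I J : ℕ} (g : (Fin d → ℝ) ≃ (Fin d → ℝ))
    (M₀ : Matrix (Fin d) (RegIdx d c I J) ℝ) (K₀ : Matrix (RegIdx d c I J) (RegIdx d c I J) ℝ)
    (Q₀ : Matrix (Fin d) (Fin d) ℝ) (n₀ : ℝ) (r : ℤ → Fin d → ℝ) (u : ℤ → Fin c → ℝ) (t : ℕ)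
    (v : Fin c → ℝ) : ℝ≥0∞ :=
  mutualInfo (predictiveLaw g M₀ K₀ Q₀ n₀ r u t) (fun ω => ω.1) (nextOutput r u t v)

end NoiseDesign

end

namespace NoiseDesign

/-! ### Positive definite matrices -/

section LinearAlgebra

variable {n : Type*} [Fintype n] [DecidableEq n]

/-! Write κ for x_{t+1}ᵀ K_t⁻¹ x_{t+1}. The prior is conjugate: completing the square in A turns
prior times likelihood into an inverted Wishart weight in V times a matrix normal density in A with
some mean M and precision K_t (`prior_mul_likelihood_eq`). Take a square root K_t = L Lᵀ with
x_{t+1} = √κ L e_i (`exists_sqrt_adapted`). Given V, the columns of (A - M) L are independent N(0,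
V) vectors, so A x_{t+1} = M x_{t+1} + √κ f with f one of these columns. The law of (V, f) does not
depend on x_{t+1}; the control enters only through κ and the known shift M x_{t+1}
(`exists_posteriorLaw_structure`).

Mutual information ignores shifts and rescalings of the output, so y_{t+1} may be replaced by Z = (e
+ √κ f) / √(1+κ). Given V, the vectors e and f are independent N(0, V), and rotation invariance
gives Z the law of e, whatever κ is (`map_mixLaw_combination`). Given θ, Z is e scaled by 1/√(1+κ)
and shifted, hence I_par = d log √(1+κ) + α. Given e, Z is a shift of f scaled by √κ/√(1+κ), hence
I_noise = d log(√(1+κ)/√κ) + β when κ > 0. Here α and β are combinations of expected log-densities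
of e, of (e, f) and of e given V, and are free of the control (`mutualInfo_param_eq`,
`mutualInfo_noise_eq`). When κ = 0 the output is e up to a shift, and I_noise = ∞. So I_par is
strictly increasing and I_noise strictly decreasing in κ ≥ 0, which gives every claim
(`exists_info_eq`, `info_lt_iff`).

The analytic work is to show that α and β are genuine real numbers. `integrable_log_density` reduces
integrability of a log-density to a bounded density with a finite logarithmic moment. For the normal
mixtures at hand this follows from integrability of log |V|, tr V⁻¹ and |V|⁻¹, collected in
`IsCovarianceLaw`. These come from finiteness of ∫ |V|^{-a} e^{-l tr V⁻¹} dV for a > d and l > 0, by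
induction on d through Schur complements (`lintegral_detTraceWeight_lt_top`). The normalizing
constant of the posterior is never evaluated: it only has to be nonzero and finite. -/

open scoped MatrixOrder in
theorem exists_isUnit_transpose_mul_self {K : Matrix n n ℝ} (hK : K.PosDef) :
    ∃ B : Matrix n n ℝ, IsUnit B.det ∧ K = Bᵀ * B := by
  obtain ⟨B, hB⟩ := CStarAlgebra.nonneg_iff_eq_star_mul_self.mp hK.posSemidef.nonneg
  have hB' : K = Bᵀ * B := by
    simpa [star_eq_conjTranspose, conjTranspose_eq_transpose_of_trivial] using hB
  refine ⟨B, ?_, hB'⟩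
  have h := hK.det_pos
  rw [hB', det_mul, det_transpose] at h
  exact isUnit_iff_ne_zero.2 fun h0 => by simp [h0] at h

theorem exists_isUnit_inv_eq {V : Matrix n n ℝ} (hV : V.PosDef) :
    ∃ C : Matrix n n ℝ, IsUnit C.det ∧ V⁻¹ = Cᵀ * C ∧ V = C⁻¹ * C⁻¹ᵀ := by
  obtain ⟨C, hC, h⟩ := exists_isUnit_transpose_mul_self hV.inv
  refine ⟨C, hC, h, ?_⟩
  have hV' : IsUnit V.det := isUnit_iff_ne_zero.2 hV.det_pos.ne'
  rw [← nonsing_inv_nonsing_inv V hV', h, Matrix.mul_inv_rev, transpose_nonsing_inv]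

theorem dotProduct_transpose_mul_self_mulVec {m n : Type*} [Fintype m] [Fintype n]
    (C : Matrix m n ℝ) (e : n → ℝ) :
    e ⬝ᵥ ((Cᵀ * C) *ᵥ e) = (C *ᵥ e) ⬝ᵥ (C *ᵥ e) := by
  rw [← mulVec_mulVec, dotProduct_mulVec, vecMul_transpose]

theorem quadForm_inv_nonneg {V : Matrix n n ℝ} (hV : V.PosDef) (e : n → ℝ) :
    0 ≤ e ⬝ᵥ (V⁻¹ *ᵥ e) := by
  simpa using hV.inv.posSemidef.dotProduct_mulVec_nonneg e

/-- Cauchy–Schwarz after whitening: with V⁻¹ = Cᵀ C, e i is the product of row i of C⁻¹ with C e,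
and V i i is the squared length of that row. -/
theorem sq_apply_le_mul_quadForm_inv {V : Matrix n n ℝ} (hV : V.PosDef) (e : n → ℝ) (i : n) :
    e i ^ 2 ≤ V i i * (e ⬝ᵥ (V⁻¹ *ᵥ e)) := by
  obtain ⟨C, hC, h1, h2⟩ := exists_isUnit_inv_eq hV
  rw [h1, dotProduct_transpose_mul_self_mulVec]
  have he : e i = ∑ j, C⁻¹ i j * (C *ᵥ e) j := by
    have : e = C⁻¹ *ᵥ (C *ᵥ e) := by rw [mulVec_mulVec, nonsing_inv_mul _ hC, one_mulVec]
    conv_lhs => rw [this]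
    rfl
  have hVi : V i i = ∑ j, C⁻¹ i j ^ 2 := by
    conv_lhs => rw [h2]
    simp [mul_apply, sq]
  rw [he, hVi]
  have hd : (C *ᵥ e) ⬝ᵥ (C *ᵥ e) = ∑ j, (C *ᵥ e) j ^ 2 := by simp [dotProduct, sq]
  rw [hd]
  exact Finset.sum_mul_sq_le_sq_mul_sq _ _ _

theorem trace_mul_nonneg {P R : Matrix n n ℝ} (hP : P.PosDef) (hR : R.PosSemidef) :
    0 ≤ (P * R).trace := by
  obtain ⟨C, -, h⟩ := exists_isUnit_transpose_mul_self hP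
  have := (hR.mul_mul_conjTranspose_same C).trace_nonneg
  rw [h, trace_mul_cycle, mul_assoc, trace_mul_comm]
  rw [conjTranspose_eq_transpose_of_trivial] at this
  rwa [mul_assoc, ← trace_mul_comm]

/-- A positive definite Q dominates l times the identity, and the trace of a product of a positive
definite and a positive semidefinite matrix is nonnegative. This replaces a general Q by a scalar
matrix in the integrability estimates. -/
theorem exists_pos_mul_trace_inv_le {Q : Matrix n n ℝ} (hQ : Q.PosDef) :
    ∃ l : ℝ, 0 < l ∧ ∀ V : Matrix n n ℝ, V.PosDef → l * (V⁻¹).trace ≤ (V⁻¹ * Q).trace := by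
  obtain ⟨l, hl, h⟩ : ∃ l : ℝ, 0 < l ∧ (Q - l • (1 : Matrix n n ℝ)).PosSemidef := by
    obtain ⟨C, hC, h1, h2⟩ := exists_isUnit_inv_eq hQ
    set s := (Q⁻¹).trace with hs
    have hs0 : 0 ≤ s := hQ.inv.posSemidef.trace_nonneg
    -- Summing the coordinate bounds for Q⁻¹ gives |x|² ≤ tr(Q⁻¹) · xᵀ Q x, so 1 / tr Q⁻¹ would
    -- nearly do; the added 1 keeps the constant defined in dimension zero.
    refine ⟨(s + 1)⁻¹, by positivity, PosSemidef.of_dotProduct_mulVec_nonneg ?_ ?_⟩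
    · exact hQ.1.sub (by simp [IsHermitian])
    · intro x
      have key : ∑ i, x i ^ 2 ≤ s * (x ⬝ᵥ (Q *ᵥ x)) := by
        have := Finset.sum_le_sum fun i (_ : i ∈ Finset.univ) => sq_apply_le_mul_quadForm_inv hQ.inv x i
        rw [← Finset.sum_mul, nonsing_inv_nonsing_inv _ (isUnit_iff_ne_zero.2 hQ.det_pos.ne')] at this
        exact this
      have h0 : 0 ≤ x ⬝ᵥ (Q *ᵥ x) := by simpa using hQ.posSemidef.dotProduct_mulVec_nonneg x
      have hx : x ⬝ᵥ x = ∑ i, x i ^ 2 := by simp [dotProduct, sq]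
      simp only [star_trivial, sub_mulVec, smul_mulVec, one_mulVec, dotProduct_sub, dotProduct_smul,
        smul_eq_mul, hx, sub_nonneg]
      rw [inv_mul_le_iff₀ (by positivity)]
      linarith
  refine ⟨l, hl, fun V hV => ?_⟩
  have := trace_mul_nonneg hV.inv h
  rw [mul_sub, trace_sub, Matrix.mul_smul, mul_one, trace_smul, smul_eq_mul] at this
  linarith

theorem det_one_add_eq_prod_eigenvalues {W : Matrix n n ℝ} (hW : W.IsHermitian) :
    (1 + W).det = ∏ i, (1 + hW.eigenvalues i) := by
  have h := congrArg (Polynomial.eval (-1)) hW.charpoly_eq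
  rw [Matrix.eval_charpoly, Polynomial.eval_prod] at h
  have h1 : (Matrix.scalar n (-1 : ℝ)) - W = -(1 + W) := by
    rw [map_neg, map_one, neg_add, sub_eq_add_neg]
  rw [h1, det_neg] at h
  have h2 : ∀ i, Polynomial.eval (-1 : ℝ) (Polynomial.X - Polynomial.C ((hW.eigenvalues i : ℝ)))
      = -1 * (1 + hW.eigenvalues i) := by intro i; simp; ring
  simp only [RCLike.ofReal_real_eq_id, id_eq, h2, Finset.prod_mul_distrib, Finset.prod_const, Finset.card_univ] at h
  exact mul_left_cancel₀ (pow_ne_zero _ (by norm_num)) h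

theorem one_add_sum_le_prod_one_add {ι : Type*} (s : Finset ι) {f : ι → ℝ} (hf : ∀ i, 0 ≤ f i) :
    1 + ∑ i ∈ s, f i ≤ ∏ i ∈ s, (1 + f i) := by
  classical
  induction s using Finset.induction_on with
  | empty => simp
  | insert a s ha ih =>
    rw [Finset.sum_insert ha, Finset.prod_insert ha]
    nlinarith [hf a, mul_nonneg (hf a) (Finset.sum_nonneg fun i (_ : i ∈ s) => hf i)]

/-- Factor det(1 + V) = det V · det(1 + V⁻¹) and compare eigenvalues on both ends. Its logarithm
bounds log(1 + tr V) by log |V| + tr V⁻¹, which are integrable even when tr V is not. -/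
theorem one_add_trace_le_det_mul_exp {V : Matrix n n ℝ} (hV : V.PosDef) :
    1 + V.trace ≤ V.det * Real.exp (V⁻¹).trace := by
  have hu : IsUnit V.det := isUnit_iff_ne_zero.2 hV.det_pos.ne'
  have h1 : 1 + V.trace ≤ (1 + V).det := by
    rw [det_one_add_eq_prod_eigenvalues hV.1, hV.1.trace_eq_sum_eigenvalues]
    exact one_add_sum_le_prod_one_add _ fun i => hV.posSemidef.eigenvalues_nonneg i
  have h2 : (1 + V⁻¹).det ≤ Real.exp (V⁻¹).trace := by
    have hI := hV.inv
    rw [det_one_add_eq_prod_eigenvalues hI.1, hI.1.trace_eq_sum_eigenvalues, Real.exp_sum]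
    refine Finset.prod_le_prod (fun i _ => ?_) fun i _ => ?_
    · have := hI.eigenvalues_pos i; positivity
    · rw [add_comm]; exact Real.add_one_le_exp _
  have h3 : (1 + V).det = V.det * (1 + V⁻¹).det := by
    rw [← det_mul, mul_add, mul_one, mul_nonsing_inv _ hu, add_comm]
  rw [h3] at h1
  exact h1.trans (by gcongr; exact hV.det_pos.le)

/-- An orthogonal matrix carrying `w` to a nonnegative multiple of a coordinate vector. -/
theorem exists_orthogonal_mulVec_eq_smul_single (w : n → ℝ) (i : n) :
    ∃ O : Matrix n n ℝ, O * Oᵀ = 1 ∧ O *ᵥ w = √(w ⬝ᵥ w) • Pi.single i 1 := by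
  set k := √(w ⬝ᵥ w)
  have hk : k * k = w ⬝ᵥ w := Real.mul_self_sqrt (by simpa using dotProduct_self_star_nonneg w)
  -- Householder reflection in the hyperplane orthogonal to a, which swaps w and k e_i because both
  -- have the same length.
  set a : n → ℝ := w - k • Pi.single i 1 with ha
  by_cases h0 : a = 0
  · exact ⟨1, by simp, by simpa using sub_eq_zero.1 (ha ▸ h0)⟩
  have haa : a ⬝ᵥ a ≠ 0 := fun h => h0 (dotProduct_self_eq_zero.1 h)
  have haw : a ⬝ᵥ a = 2 * (a ⬝ᵥ w) := by
    have hb : (Pi.single i 1 : n → ℝ) ⬝ᵥ Pi.single i 1 = 1 := by simp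
    simp only [ha, sub_dotProduct, dotProduct_sub, smul_dotProduct, dotProduct_smul, smul_eq_mul, hb,
      dotProduct_comm w]
    linear_combination hk
  refine ⟨1 - (2 / (a ⬝ᵥ a)) • vecMulVec a a, ?_, ?_⟩
  · rw [transpose_sub, transpose_smul, transpose_vecMulVec, transpose_one]
    have hsq : vecMulVec a a * vecMulVec a a = (a ⬝ᵥ a) • vecMulVec a a := by
      ext p q
      simp only [mul_apply, vecMulVec_apply, Matrix.smul_apply, smul_eq_mul, dotProduct, Finset.sum_mul]
      exact Finset.sum_congr rfl fun j _ => by ring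
    simp only [mul_sub, sub_mul, mul_one, one_mul, smul_mul_assoc, mul_smul_comm, hsq, smul_smul]
    rw [div_mul_cancel₀ _ haa]
    module
  · have hv : vecMulVec a a *ᵥ w = (a ⬝ᵥ w) • a := by
      ext p
      simp only [mulVec, dotProduct, vecMulVec_apply, Pi.smul_apply, smul_eq_mul, Finset.sum_mul]
      exact Finset.sum_congr rfl fun j _ => by ring
    have hc : 2 / (a ⬝ᵥ a) * (a ⬝ᵥ w) = 1 := by field_simp; linarith
    rw [sub_mulVec, one_mulVec, smul_mulVec, hv, smul_smul, hc, one_smul, ha]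
    abel

end LinearAlgebra

/-! ### Gaussian integrals -/

section Gaussian

variable {n : Type*} [Fintype n] [DecidableEq n]

theorem lintegral_comp_mulVec {B : Matrix n n ℝ} (hB : B.det ≠ 0) (h : (n → ℝ) → ℝ≥0∞)
    (hh : Measurable h) :
    ∫⁻ x, h (B *ᵥ x) = ENNReal.ofReal |B.det|⁻¹ * ∫⁻ x, h x := by
  have := Real.map_matrix_volume_pi_eq_smul_volume_pi hB
  have h2 : ∫⁻ x, h x ∂(Measure.map (toLin' B) volume) = ∫⁻ x, h (B *ᵥ x) := by
    rw [lintegral_map hh]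
    · simp
    · exact (LinearMap.continuous_of_finiteDimensional _).measurable
  rw [← h2, this, lintegral_smul_measure, abs_inv, smul_eq_mul]

theorem lintegral_exp_neg_mul_dotProduct_self {n : Type*} [Fintype n] {l : ℝ} (hl : 0 < l) :
    ∫⁻ x : n → ℝ, ENNReal.ofReal (Real.exp (-l * (x ⬝ᵥ x))) =
      ENNReal.ofReal ((Real.pi / l) ^ ((Fintype.card n : ℝ) / 2)) := by
  have h1 : ∀ x : n → ℝ, Real.exp (-l * (x ⬝ᵥ x)) = ∏ i, Real.exp (-l * x i ^ 2) := by
    intro x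
    rw [← Real.exp_sum, ← Finset.mul_sum]
    simp [dotProduct, sq]
  have hint : Integrable (fun x : n → ℝ => ∏ i, Real.exp (-l * x i ^ 2)) := by
    have := Integrable.fintype_prod (ι := n) (E := ℝ) (𝕜 := ℝ) (f := fun _ x => Real.exp (-l * x ^ 2))
      (μ := fun _ => volume) fun _ => integrable_exp_neg_mul_sq hl
    exact this
  simp_rw [h1]
  rw [← ofReal_integral_eq_lintegral_ofReal hint
    (Filter.Eventually.of_forall fun x => by positivity),
    integral_fintype_prod_volume_eq_pow (fun x : ℝ => Real.exp (-l * x ^ 2)), integral_gaussian,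
    Real.sqrt_eq_rpow, ← Real.rpow_natCast, ← Real.rpow_mul (by positivity)]
  congr 2; ring

theorem lintegral_exp_neg_mul_quadForm_inv {V : Matrix n n ℝ} (hV : V.PosDef) {l : ℝ} (hl : 0 < l) :
    ∫⁻ x : n → ℝ, ENNReal.ofReal (Real.exp (-l * (x ⬝ᵥ (V⁻¹ *ᵥ x)))) =
      ENNReal.ofReal ((Real.pi / l) ^ ((Fintype.card n : ℝ) / 2) * √V.det) := by
  obtain ⟨C, hC, h1, h2⟩ := exists_isUnit_inv_eq hV
  have hd : √V.det = |C.det|⁻¹ := by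
    rw [h2, det_mul, det_transpose, Real.sqrt_mul_self_eq_abs, det_nonsing_inv, Ring.inverse_eq_inv',
      abs_inv]
  simp_rw [h1, dotProduct_transpose_mul_self_mulVec]
  rw [lintegral_comp_mulVec hC.ne_zero (fun x => ENNReal.ofReal (Real.exp (-l * (x ⬝ᵥ x))))
    (by unfold dotProduct; fun_prop), lintegral_exp_neg_mul_dotProduct_self hl, hd,
    ← ENNReal.ofReal_mul (by positivity), mul_comm]

theorem lintegral_normalDensity {d : ℕ} (μ : Fin d → ℝ) {V : Matrix (Fin d) (Fin d) ℝ}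
    (hV : V.PosDef) : ∫⁻ y, ENNReal.ofReal (normalDensity μ V y) = 1 := by
  unfold normalDensity
  have hdet : ((2 * Real.pi) • V).det = (2 * Real.pi) ^ d * V.det := by simp
  have hp := hV.det_pos
  have hpi := Real.pi_pos
  rw [lintegral_sub_right_eq_self (fun y => ENNReal.ofReal
    (((2 * Real.pi) • V).det ^ (-(1 / 2) : ℝ) * Real.exp (-(1 / 2) * (y ⬝ᵥ (V⁻¹ *ᵥ y))))) μ]
  simp_rw [hdet, ENNReal.ofReal_mul (show 0 ≤ ((2 * Real.pi) ^ d * V.det) ^ (-(1 / 2) : ℝ) by positivity)]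
  rw [lintegral_const_mul' _ _ ENNReal.ofReal_ne_top, lintegral_exp_neg_mul_quadForm_inv hV (by norm_num),
    ← ENNReal.ofReal_mul (by positivity), ENNReal.ofReal_eq_one, Real.mul_rpow (by positivity) hp.le,
    Real.sqrt_eq_rpow, ← Real.rpow_natCast, ← Real.rpow_mul (by positivity), Fintype.card_fin]
  have e1 : Real.pi / (1 / 2) = 2 * Real.pi := by ring
  rw [e1]
  have e2 : (2 * Real.pi) ^ ((d : ℝ) * (-(1 / 2))) * (2 * Real.pi) ^ ((d : ℝ) / 2) = 1 := by
    rw [← Real.rpow_add (by positivity)]; ring_nf; simp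
  have e3 : V.det ^ (-(1 / 2) : ℝ) * V.det ^ (1 / 2 : ℝ) = 1 := by
    rw [← Real.rpow_add hp]; norm_num
  calc _ = ((2 * Real.pi) ^ ((d : ℝ) * (-(1 / 2))) * (2 * Real.pi) ^ ((d : ℝ) / 2)) *
      (V.det ^ (-(1 / 2) : ℝ) * V.det ^ (1 / 2 : ℝ)) := by ring
    _ = 1 := by rw [e2, e3, one_mul]

end Gaussian

/-! ### Measurability -/

section Measurability

instance instBorelSpaceRealMatrix {α β : Type} [Countable α] [Countable β] :
    BorelSpace (Matrix α β ℝ) :=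
  inferInstanceAs (BorelSpace (α → β → ℝ))

variable {n : Type} [Fintype n] [DecidableEq n]

theorem measurable_matrix_apply {α β : Type} (i : α) (j : β) :
    Measurable fun A : Matrix α β ℝ => A i j :=
  (measurable_pi_apply j).comp (measurable_pi_apply i)

theorem measurable_matrix_of_apply {α β γ : Type} [MeasurableSpace γ] {f : γ → Matrix α β ℝ}
    (h : ∀ i j, Measurable fun x => f x i j) : Measurable f :=
  measurable_pi_iff.2 fun i => measurable_pi_iff.2 fun j => h i j

theorem measurable_matrix_det : Measurable fun V : Matrix n n ℝ => V.det :=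
  (Continuous.matrix_det continuous_id).measurable

theorem measurable_matrix_inv : Measurable fun V : Matrix n n ℝ => V⁻¹ := by
  refine measurable_matrix_of_apply fun i j => ?_
  simp only [inv_def, Ring.inverse_eq_inv', Matrix.smul_apply, smul_eq_mul]
  exact measurable_matrix_det.inv.mul
    ((measurable_matrix_apply i j).comp (Continuous.matrix_adjugate continuous_id).measurable)

theorem measurable_trace_inv_mul (Q : Matrix n n ℝ) :
    Measurable fun V : Matrix n n ℝ => (V⁻¹ * Q).trace :=
  (Continuous.matrix_trace (Continuous.matrix_mul continuous_id continuous_const)).measurable.comp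
    measurable_matrix_inv

theorem measurable_trace_inv : Measurable fun V : Matrix n n ℝ => (V⁻¹).trace :=
  (Continuous.matrix_trace continuous_id).measurable.comp measurable_matrix_inv

theorem measurable_mulVec {α β : Type} [Fintype β] :
    Measurable fun p : Matrix α β ℝ × (β → ℝ) => p.1 *ᵥ p.2 := by
  refine measurable_pi_iff.2 fun i => ?_
  simp only [mulVec, dotProduct]
  exact Finset.measurable_sum _ fun j _ =>
    ((measurable_matrix_apply i j).comp measurable_fst).mul
      ((measurable_pi_apply j).comp measurable_snd)

theorem measurable_quadForm_inv :
    Measurable fun p : Matrix n n ℝ × (n → ℝ) => p.2 ⬝ᵥ (p.1⁻¹ *ᵥ p.2) := by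
  have h : Measurable fun p : Matrix n n ℝ × (n → ℝ) => p.1⁻¹ *ᵥ p.2 :=
    measurable_mulVec.comp ((measurable_matrix_inv.comp measurable_fst).prodMk measurable_snd)
  simp only [dotProduct]
  exact Finset.measurable_sum _ fun j _ =>
    ((measurable_pi_apply j).comp measurable_snd).mul ((measurable_pi_apply j).comp h)

/-- Positive semidefiniteness is a closed condition, and within it positive definiteness is
nonvanishing of the determinant. -/
theorem measurableSet_posDef : MeasurableSet {V : Matrix n n ℝ | V.PosDef} := by
  have h : {V : Matrix n n ℝ | V.PosDef} =
      ({V | V.IsHermitian} ∩ ⋂ x : n → ℝ, {V | 0 ≤ x ⬝ᵥ (V *ᵥ x)}) ∩ {V | V.det ≠ 0} := by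
    ext V
    simp only [Set.mem_ofPred_eq, Set.mem_inter_iff, Set.mem_iInter]
    constructor
    · intro hV
      exact ⟨⟨hV.1, fun x => by simpa using hV.posSemidef.dotProduct_mulVec_nonneg x⟩, hV.det_pos.ne'⟩
    · rintro ⟨⟨h1, h2⟩, h3⟩
      exact (PosSemidef.of_dotProduct_mulVec_nonneg h1 (by simpa using h2)).posDef_iff_det_ne_zero.2 h3
  rw [h]
  refine (IsClosed.inter ?_ (isClosed_iInter fun x => ?_)).measurableSet.inter ?_
  · exact isClosed_eq (Continuous.matrix_conjTranspose continuous_id) continuous_id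
  · exact isClosed_le continuous_const
      (Continuous.dotProduct continuous_const (Continuous.matrix_mulVec continuous_id continuous_const))
  · exact measurable_matrix_det (measurableSet_singleton (0 : ℝ)).compl

theorem measurable_symMatrix {d : ℕ} : Measurable (symMatrix (d := d)) := by
  refine measurable_matrix_of_apply fun i j => ?_
  by_cases h : i ≤ j <;> simp only [symMatrix, of_apply, h, dite_true, dite_false] <;> fun_prop

end Measurability

/-! ### Finiteness of the inverted Wishart integral -/

section InvWishart

theorem exists_rpow_mul_exp_neg_le {a l : ℝ} (hl : 0 < l) :
    ∃ C : ℝ, 0 ≤ C ∧ ∀ x : ℝ, 1 ≤ x → x ^ a * Real.exp (-l * x) ≤ C := by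
  obtain ⟨N, hN⟩ := exists_nat_ge a
  refine ⟨N.factorial / l ^ N, by positivity, fun x hx => ?_⟩
  have h0 : 0 ≤ x := by linarith
  have h1 : x ^ a ≤ x ^ N := by
    rw [← Real.rpow_natCast]; exact Real.rpow_le_rpow_of_exponent_le hx hN
  have h2 := Real.pow_div_factorial_le_exp (l * x) (by positivity) N
  rw [neg_mul, Real.exp_neg, ← div_eq_mul_inv, div_le_div_iff₀ (Real.exp_pos _) (by positivity)]
  rw [mul_pow, div_le_iff₀ (by positivity)] at h2
  nlinarith [mul_le_mul_of_nonneg_right h1 (pow_nonneg hl.le N)]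

/-- Near zero the exponential beats every power of 1/s; near infinity s^{-a} is integrable because a
> 1. -/
theorem lintegral_rpow_neg_mul_exp_neg_div_lt_top {a l : ℝ} (ha : 1 < a) (hl : 0 < l) :
    ∫⁻ s in Set.Ioi (0 : ℝ), ENNReal.ofReal (s ^ (-a) * Real.exp (-l / s)) < ∞ := by
  rw [← Set.Ioc_union_Ioi_eq_Ioi zero_le_one]
  refine (lintegral_union_le _ _ _).trans_lt (ENNReal.add_lt_top.2 ⟨?_, ?_⟩)
  · obtain ⟨C, hC, h⟩ := exists_rpow_mul_exp_neg_le (a := a) hl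
    calc _ ≤ ∫⁻ s in Set.Ioc (0 : ℝ) 1, ENNReal.ofReal C := by
          refine setLIntegral_mono measurable_const fun s hs => ENNReal.ofReal_le_ofReal ?_
          have := h s⁻¹ ((one_le_inv₀ hs.1).2 hs.2)
          rwa [Real.inv_rpow hs.1.le, ← Real.rpow_neg hs.1.le, ← div_eq_mul_inv] at this
      _ < ∞ := by simp
  · have hi := (integrableOn_Ioi_rpow_of_lt (show -a < -1 by linarith) zero_lt_one)
    calc _ ≤ ∫⁻ s in Set.Ioi (1 : ℝ), ENNReal.ofReal (s ^ (-a)) := by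
          refine setLIntegral_mono (by fun_prop) fun s hs => ENNReal.ofReal_le_ofReal ?_
          have hs' : 0 < s := zero_lt_one.trans hs
          refine mul_le_of_le_one_right (by positivity) (Real.exp_le_one_iff.2 ?_)
          rw [neg_div]; exact neg_nonpos.2 (by positivity)
      _ < ∞ := by
          rw [← hasFiniteIntegral_iff_ofReal]
          · exact hi.2
          · filter_upwards [self_mem_ae_restrict measurableSet_Ioi] with s hs
            have hs' : 0 < s := zero_lt_one.trans hs
            positivity

/-- Determinant and trace of the inverse of a positive definite matrix with a distinguished
coordinate, through the Schur complement of that coordinate. -/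
theorem posDef_fromBlocks_schur {n : Type} [Fintype n] [DecidableEq n] {V : Matrix n n ℝ}
    {b : n → ℝ} {w : ℝ}
    (h : (fromBlocks (w • (1 : Matrix Unit Unit ℝ)) (replicateCol Unit b)ᵀ (replicateCol Unit b) V).PosDef) :
    V.PosDef ∧ 0 < w - b ⬝ᵥ (V⁻¹ *ᵥ b) ∧
      (fromBlocks (w • (1 : Matrix Unit Unit ℝ)) (replicateCol Unit b)ᵀ (replicateCol Unit b) V).det =
        V.det * (w - b ⬝ᵥ (V⁻¹ *ᵥ b)) ∧
      ((fromBlocks (w • (1 : Matrix Unit Unit ℝ)) (replicateCol Unit b)ᵀ (replicateCol Unit b) V)⁻¹).trace =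
        (V⁻¹).trace + (1 + (V⁻¹ *ᵥ b) ⬝ᵥ (V⁻¹ *ᵥ b)) / (w - b ⬝ᵥ (V⁻¹ *ᵥ b)) := by
  have hV : V.PosDef := by
    have := h.submatrix (e := Sum.inr) Sum.inr_injective
    exact this
  have hu : IsUnit V.det := isUnit_iff_ne_zero.2 hV.det_pos.ne'
  set X := replicateCol Unit b with hX
  set W := fromBlocks (w • (1 : Matrix Unit Unit ℝ)) Xᵀ X V with hW
  set c := V⁻¹ *ᵥ b with hc
  set s := w - b ⬝ᵥ c with hs
  set Y := replicateCol Unit c with hY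
  have hYX : V⁻¹ * X = Y := by rw [hX, hY, hc, replicateCol_mulVec]
  have hVY : V * Y = X := by rw [← hYX, ← Matrix.mul_assoc, mul_nonsing_inv _ hu, Matrix.one_mul]
  have hXt : Xᵀ * V⁻¹ = Yᵀ := by
    rw [← hYX, transpose_mul, ← conjTranspose_eq_transpose_of_trivial V⁻¹, hV.inv.1.eq]
  have hXY : Xᵀ * Y = (b ⬝ᵥ c) • (1 : Matrix Unit Unit ℝ) := by
    ext i j; simp [hX, hY, mul_apply, dotProduct]
  have hdet : W.det = V.det * s := by
    have := V.invertibleOfIsUnitDet hu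
    rw [hW, det_fromBlocks₂₂, invOf_eq_nonsing_inv, hXt, hs]
    congr 1
    have : Yᵀ * X = (b ⬝ᵥ c) • (1 : Matrix Unit Unit ℝ) := by
      rw [← hXt, Matrix.mul_assoc, hYX, hXY]
    rw [this, ← sub_smul]; simp
  have hs0 : 0 < s := by
    have := h.det_pos
    rw [hdet] at this
    exact (mul_pos_iff_of_pos_left hV.det_pos).1 this
  refine ⟨hV, hs0, hdet, ?_⟩
  have hw : w = s + b ⬝ᵥ c := by rw [hs]; ring
  -- Block inverse through the Schur complement s. Its corner contributes 1/s to the trace, and its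
  -- lower block contributes tr V⁻¹ + |c|²/s.
  have hinv : W⁻¹ = fromBlocks (s⁻¹ • (1 : Matrix Unit Unit ℝ)) (-s⁻¹ • Yᵀ) (-s⁻¹ • Y)
      (V⁻¹ + s⁻¹ • (Y * Yᵀ)) := by
    refine inv_eq_right_inv ?_
    rw [hW, fromBlocks_multiply, ← fromBlocks_one]
    congr 1
    · rw [Matrix.mul_smul, Matrix.mul_smul, hXY, Matrix.mul_one, smul_smul, smul_smul, ← add_smul, hw]
      convert one_smul ℝ (1 : Matrix Unit Unit ℝ) using 2
      field_simp; ring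
    · rw [Matrix.mul_add, hXt, Matrix.mul_smul, Matrix.mul_smul, ← Matrix.mul_assoc, hXY,
        Matrix.smul_mul, Matrix.one_mul, hw, Matrix.smul_mul, Matrix.one_mul, smul_smul, smul_smul]
      have : (-s⁻¹ * (s + b ⬝ᵥ c)) = -1 - s⁻¹ * (b ⬝ᵥ c) := by field_simp; ring
      rw [this]; module
    · rw [Matrix.mul_smul, Matrix.mul_smul, hVY, Matrix.mul_one, ← add_smul]; simp
    · rw [Matrix.mul_add, mul_nonsing_inv _ hu, Matrix.mul_smul, Matrix.mul_smul, ← Matrix.mul_assoc, hVY]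
      module
  have htr : ∀ (A : Matrix Unit Unit ℝ) B C (D : Matrix n n ℝ),
      (fromBlocks A B C D).trace = A.trace + D.trace := by
    intro A B C D; simp [trace]
  rw [hinv, htr, trace_add, trace_smul, trace_smul, trace_one]
  have : (Y * Yᵀ).trace = c ⬝ᵥ c := by
    simp [hY, trace, mul_apply, dotProduct]
  rw [this]; simp; field_simp; ring

/-- The upper triangular index pairs of a matrix with one more row and column. -/
def upperIdx (d : ℕ) : {p : Fin d × Fin d // p.1 ≤ p.2} ⊕ (Fin d ⊕ Unit) →
    {p : Fin (d + 1) × Fin (d + 1) // p.1 ≤ p.2}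
  | Sum.inl p => ⟨(p.1.1.succ, p.1.2.succ), Fin.succ_le_succ_iff.2 p.2⟩
  | Sum.inr (Sum.inl k) => ⟨(0, k.succ), Fin.zero_le _⟩
  | Sum.inr (Sum.inr _) => ⟨(0, 0), le_rfl⟩

theorem upperIdx_bijective (d : ℕ) : Function.Bijective (upperIdx d) := by
  constructor
  · rintro (⟨⟨i, j⟩, h⟩ | k | u) (⟨⟨i', j'⟩, h'⟩ | k' | u') <;>
      simp [upperIdx, Fin.succ_ne_zero, (Fin.succ_ne_zero _).symm]
  · rintro ⟨⟨i, j⟩, h⟩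
    induction i using Fin.cases with
    | zero =>
      induction j using Fin.cases with
      | zero => exact ⟨Sum.inr (Sum.inr ()), rfl⟩
      | succ k => exact ⟨Sum.inr (Sum.inl k), rfl⟩
    | succ i =>
      induction j using Fin.cases with
      | zero => exact absurd h (by simp)
      | succ j => exact ⟨Sum.inl ⟨(i, j), Fin.succ_le_succ_iff.1 h⟩, rfl⟩

/-- `upperIdx` as an equivalence. -/
noncomputable def upperEquiv (d : ℕ) : {p : Fin d × Fin d // p.1 ≤ p.2} ⊕ (Fin d ⊕ Unit) ≃
    {p : Fin (d + 1) × Fin (d + 1) // p.1 ≤ p.2} :=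
  Equiv.ofBijective _ (upperIdx_bijective d)

/-- Coordinates of a symmetric matrix from those of its lower right block, its first column and
its upper left entry. -/
noncomputable def borderCoords {d : ℕ} (v : {p : Fin d × Fin d // p.1 ≤ p.2} → ℝ) (b : Fin d → ℝ)
    (w : ℝ) : {p : Fin (d + 1) × Fin (d + 1) // p.1 ≤ p.2} → ℝ :=
  fun p => Sum.elim v (Sum.elim b fun _ => w) ((upperEquiv d).symm p)

theorem borderCoords_upperIdx {d : ℕ} (v : {p : Fin d × Fin d // p.1 ≤ p.2} → ℝ) (b : Fin d → ℝ)
    (w : ℝ) (a) : borderCoords v b w (upperIdx d a) = Sum.elim v (Sum.elim b fun _ => w) a := by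
  unfold borderCoords
  congr 1
  exact (upperEquiv d).symm_apply_apply a

theorem lintegral_borderCoords {d : ℕ}
    (F : ({p : Fin (d + 1) × Fin (d + 1) // p.1 ≤ p.2} → ℝ) → ℝ≥0∞) (hF : Measurable F) :
    ∫⁻ v, F v = ∫⁻ v : {p : Fin d × Fin d // p.1 ≤ p.2} → ℝ, ∫⁻ b : Fin d → ℝ, ∫⁻ w : ℝ,
      F (borderCoords v b w) := by
  have h1 := volume_measurePreserving_piCongrLeft (fun _ => ℝ) (upperEquiv d)
  have h2 := volume_measurePreserving_sumPiEquivProdPi_symm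
    (fun _ : {p : Fin d × Fin d // p.1 ≤ p.2} ⊕ (Fin d ⊕ Unit) => ℝ)
  have h3 := volume_measurePreserving_sumPiEquivProdPi_symm (fun _ : Fin d ⊕ Unit => ℝ)
  have h4 := (volume_preserving_funUnique Unit ℝ).symm
  rw [← h1.lintegral_comp hF]
  rw [← h2.lintegral_comp_emb (MeasurableEquiv.measurableEmbedding _)]
  rw [Measure.volume_eq_prod, lintegral_prod _ (by fun_prop)]
  refine lintegral_congr fun v => ?_
  rw [← h3.lintegral_comp_emb (MeasurableEquiv.measurableEmbedding _)]
  rw [Measure.volume_eq_prod, lintegral_prod _ (by fun_prop)]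
  refine lintegral_congr fun b => ?_
  rw [← h4.lintegral_comp_emb (MeasurableEquiv.measurableEmbedding _)]
  refine lintegral_congr fun w => ?_
  congr 1
  ext p
  obtain ⟨a, rfl⟩ := (upperEquiv d).surjective p
  have : upperEquiv d a = upperIdx d a := rfl
  rw [MeasurableEquiv.coe_piCongrLeft, Equiv.piCongrLeft_apply_apply, this, borderCoords_upperIdx]
  rcases a with a | a | a <;> rfl

/-- The reindexing sends the extra index to 0 and the others to successors. Positive definiteness,
determinant and trace of the inverse are unaffected by it, so the Schur formulas apply to the
bordered matrix. -/
theorem symMatrix_borderCoords {d : ℕ} (v : {p : Fin d × Fin d // p.1 ≤ p.2} → ℝ) (b : Fin d → ℝ)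
    (w : ℝ) :
    ∃ e : Unit ⊕ Fin d ≃ Fin (d + 1), (symMatrix (borderCoords v b w)).submatrix e e =
      fromBlocks (w • (1 : Matrix Unit Unit ℝ)) (replicateCol Unit b)ᵀ (replicateCol Unit b)
        (symMatrix v) := by
  have hb : Function.Bijective (Sum.elim (fun _ : Unit => (0 : Fin (d + 1))) Fin.succ) := by
    constructor
    · rintro (i | i) (j | j) <;> simp [Fin.succ_ne_zero, (Fin.succ_ne_zero _).symm]
    · intro i
      induction i using Fin.cases with
      | zero => exact ⟨Sum.inl (), rfl⟩
      | succ i => exact ⟨Sum.inr i, rfl⟩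
  refine ⟨Equiv.ofBijective _ hb, ?_⟩
  have e00 := borderCoords_upperIdx v b w (Sum.inr (Sum.inr ()))
  have e01 := fun k => borderCoords_upperIdx v b w (Sum.inr (Sum.inl k))
  have e11 := fun p => borderCoords_upperIdx v b w (Sum.inl p)
  simp only [upperIdx, Sum.elim_inl, Sum.elim_inr] at e00 e01 e11
  ext (i | i) (j | j)
  · simp [symMatrix, e00]
  · simp [symMatrix, e01]
  · simp [symMatrix, e01]
  · simp only [submatrix_apply, Equiv.ofBijective_apply, Sum.elim_inr, fromBlocks_apply₂₂, symMatrix,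
      of_apply, Fin.succ_le_succ_iff]
    split_ifs with h
    · exact e11 ⟨(i, j), h⟩
    · exact e11 ⟨(j, i), _⟩

/-- Integrating over c first is a Gaussian integral of variance proportional to s and contributes
s^{d/2}. What remains is an integral of s^{-(a - d/2)} e^{-l/s}, and a - d/2 > 1. -/
theorem lintegral_lintegral_schur_lt_top {d : ℕ} {a l : ℝ} (ha : (d : ℝ) + 1 < a) (hl : 0 < l) :
    ∫⁻ c : Fin d → ℝ, ∫⁻ s in Set.Ioi (0 : ℝ),
      ENNReal.ofReal (s ^ (-a) * Real.exp (-l * ((1 + c ⬝ᵥ c) / s))) < ∞ := by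
  rw [lintegral_lintegral_swap (by unfold dotProduct; fun_prop)]
  have h1 : ∀ s ∈ Set.Ioi (0 : ℝ), ∫⁻ c : Fin d → ℝ,
      ENNReal.ofReal (s ^ (-a) * Real.exp (-l * ((1 + c ⬝ᵥ c) / s))) =
      ENNReal.ofReal ((Real.pi / l) ^ ((d : ℝ) / 2)) *
        ENNReal.ofReal (s ^ (-(a - d / 2)) * Real.exp (-l / s)) := by
    intro s hs
    have hs : 0 < s := hs
    have h2 : ∀ c : Fin d → ℝ, s ^ (-a) * Real.exp (-l * ((1 + c ⬝ᵥ c) / s)) =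
        (s ^ (-a) * Real.exp (-l / s)) * Real.exp (-(l / s) * (c ⬝ᵥ c)) := by
      intro c
      rw [mul_assoc, ← Real.exp_add]
      congr 2; ring
    simp_rw [h2, ENNReal.ofReal_mul (show 0 ≤ s ^ (-a) * Real.exp (-l / s) by positivity)]
    rw [lintegral_const_mul' _ _ ENNReal.ofReal_ne_top,
      lintegral_exp_neg_mul_dotProduct_self (div_pos hl hs), ← ENNReal.ofReal_mul (by positivity),
      ← ENNReal.ofReal_mul (by have := Real.pi_pos; positivity), Fintype.card_fin]
    congr 1
    have h3 : Real.pi / (l / s) = Real.pi / l * s := by field_simp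
    rw [h3, Real.mul_rpow (by have := Real.pi_pos; positivity) hs.le,
      show -(a - (d : ℝ) / 2) = -a + d / 2 by ring, Real.rpow_add hs]
    ring
  rw [setLIntegral_congr_fun measurableSet_Ioi h1, lintegral_const_mul' _ _ ENNReal.ofReal_ne_top]
  refine ENNReal.mul_lt_top ENNReal.ofReal_lt_top
    (lintegral_rpow_neg_mul_exp_neg_div_lt_top ?_ hl)
  have : (0 : ℝ) ≤ d := Nat.cast_nonneg d
  linarith

/-- The integrand `|V|^{-a} e^{-l tr V⁻¹}` on the positive definite matrices. -/
noncomputable def detTraceWeight {n : Type} [Fintype n] [DecidableEq n] (a l : ℝ) :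
    Matrix n n ℝ → ℝ≥0∞ :=
  {V | V.PosDef}.indicator fun V => ENNReal.ofReal (V.det ^ (-a) * Real.exp (-l * (V⁻¹).trace))

theorem measurable_detTraceWeight {n : Type} [Fintype n] [DecidableEq n] (a l : ℝ) :
    Measurable (detTraceWeight (n := n) a l) := by
  refine Measurable.indicator ?_ measurableSet_posDef
  exact ((measurable_matrix_det.pow_const _).mul
    (measurable_trace_inv.const_mul _).exp).ennreal_ofReal

/-- The weight factors into the weight of the lower block and a function of the Schur complement s
and c = V⁻¹ b. An inequality is enough for finiteness and spares the converse, that a positive Schur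
complement makes the bordered matrix positive definite. -/
theorem detTraceWeight_borderCoords_le {d : ℕ} (a l : ℝ)
    (v : {p : Fin d × Fin d // p.1 ≤ p.2} → ℝ) (b : Fin d → ℝ) (w : ℝ) :
    detTraceWeight a l (symMatrix (borderCoords v b w)) ≤
      detTraceWeight a l (symMatrix v) *
        (Set.Ioi 0).indicator (fun s => ENNReal.ofReal (s ^ (-a) * Real.exp (-l *
          ((1 + ((symMatrix v)⁻¹ *ᵥ b) ⬝ᵥ ((symMatrix v)⁻¹ *ᵥ b)) / s))))
          (w - b ⬝ᵥ ((symMatrix v)⁻¹ *ᵥ b)) := by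
  by_cases hW : (symMatrix (borderCoords v b w)).PosDef
  · obtain ⟨e, he⟩ := symMatrix_borderCoords v b w
    have hW' := hW.submatrix e.injective
    rw [he] at hW'
    obtain ⟨hV, hs, hdet, htr⟩ := posDef_fromBlocks_schur hW'
    rw [← he, det_submatrix_equiv_self] at hdet
    rw [← he, inv_submatrix_equiv] at htr
    have htr' : ∀ M : Matrix (Fin (d + 1)) (Fin (d + 1)) ℝ, (M.submatrix e e).trace = M.trace :=
      fun M => by simp only [trace, diag_apply, submatrix_apply]; exact e.sum_comp fun i => M i i
    rw [htr'] at htr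
    rw [detTraceWeight, detTraceWeight, Set.indicator_of_mem (by exact hW),
      Set.indicator_of_mem (by exact hV), Set.indicator_of_mem (by exact hs), hdet, htr,
      ← ENNReal.ofReal_mul (by have := hV.det_pos; positivity)]
    refine le_of_eq (congrArg _ ?_)
    rw [Real.mul_rpow hV.det_pos.le hs.le, mul_add, Real.exp_add]
    ring
  · rw [detTraceWeight, Set.indicator_of_notMem (by exact hW)]
    exact zero_le

/-- Finiteness of the inverted Wishart normalizing integral. -/
theorem lintegral_detTraceWeight_lt_top (d : ℕ) : ∀ {a l : ℝ}, (d : ℝ) < a → 0 < l →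
    ∫⁻ v : {p : Fin d × Fin d // p.1 ≤ p.2} → ℝ, detTraceWeight a l (symMatrix v) < ∞ := by
  induction d with
  | zero =>
    intro a l _ _
    -- In dimension zero the domain is a single point of mass one.
    have : IsEmpty {p : Fin 0 × Fin 0 // p.1 ≤ p.2} := ⟨fun p => p.1.1.elim0⟩
    rw [volume_pi, Measure.pi_of_empty, lintegral_dirac]
    unfold detTraceWeight Set.indicator
    split_ifs <;> simp
  | succ d ih =>
    intro a l ha hl
    push_cast at ha
    rw [lintegral_borderCoords (fun v => detTraceWeight a l (symMatrix v))
      ((measurable_detTraceWeight a l).comp measurable_symMatrix)]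
    set H : (Fin d → ℝ) → ℝ → ℝ≥0∞ := fun c => (Set.Ioi 0).indicator fun s =>
      ENNReal.ofReal (s ^ (-a) * Real.exp (-l * ((1 + c ⬝ᵥ c) / s))) with hH
    have hHm : Measurable (Function.uncurry H) := by
      have : Function.uncurry H = (Prod.snd ⁻¹' Set.Ioi (0 : ℝ)).indicator
          fun p : (Fin d → ℝ) × ℝ => ENNReal.ofReal (p.2 ^ (-a) *
            Real.exp (-l * ((1 + p.1 ⬝ᵥ p.1) / p.2))) := by
        ext p
        simp [hH, Function.uncurry, Set.indicator]
      rw [this]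
      refine Measurable.indicator ?_ (measurable_snd measurableSet_Ioi)
      unfold dotProduct
      fun_prop
    set T := ∫⁻ c, ∫⁻ s, H c s with hT
    have hTtop : T < ∞ := by
      rw [hT]
      simp only [hH, lintegral_indicator measurableSet_Ioi]
      exact lintegral_lintegral_schur_lt_top ha hl
    calc _ ≤ ∫⁻ v : {p : Fin d × Fin d // p.1 ≤ p.2} → ℝ,
          detTraceWeight (a - 1) l (symMatrix v) * T := by
          refine lintegral_mono fun v => ?_
          by_cases hV : (symMatrix v).PosDef
          · have hdet := hV.det_pos
            calc _ ≤ ∫⁻ b : Fin d → ℝ, ∫⁻ w : ℝ, detTraceWeight a l (symMatrix v) *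
                  H ((symMatrix v)⁻¹ *ᵥ b) (w - b ⬝ᵥ ((symMatrix v)⁻¹ *ᵥ b)) :=
                  lintegral_mono fun b => lintegral_mono fun w =>
                    detTraceWeight_borderCoords_le a l v b w
              _ = ∫⁻ b : Fin d → ℝ, detTraceWeight a l (symMatrix v) *
                  ∫⁻ s : ℝ, H ((symMatrix v)⁻¹ *ᵥ b) s := by
                  refine lintegral_congr fun b => ?_
                  rw [lintegral_const_mul, lintegral_sub_right_eq_self]
                  exact (hHm.comp measurable_prodMk_left).comp (measurable_id.sub_const _)
              -- The substitution c = V⁻¹ b has Jacobian |V|. This lowers the exponent from a to a -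
              -- 1, matching the drop of the dimension by one in the induction.
              _ = detTraceWeight a l (symMatrix v) * (ENNReal.ofReal (symMatrix v).det * T) := by
                  have hm : Measurable fun c => ∫⁻ s, H c s := hHm.lintegral_prod_right
                  rw [lintegral_const_mul, lintegral_comp_mulVec _ _ hm]
                  · rw [det_nonsing_inv, Ring.inverse_eq_inv', abs_inv, inv_inv, abs_of_pos hdet]
                  · exact (isUnit_nonsing_inv_det _ (isUnit_iff_ne_zero.2 hdet.ne')).ne_zero
                  · exact hm.comp (Continuous.matrix_mulVec continuous_const
                      continuous_id).measurable
              _ = detTraceWeight (a - 1) l (symMatrix v) * T := by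
                  rw [← mul_assoc]
                  congr 1
                  rw [detTraceWeight, detTraceWeight, Set.indicator_of_mem (by exact hV),
                    Set.indicator_of_mem (by exact hV), ← ENNReal.ofReal_mul (by positivity)]
                  congr 1
                  rw [show -(a - 1) = -a + 1 by ring, Real.rpow_add hdet, Real.rpow_one]
                  ring
              _ ≤ _ := le_rfl
          · calc _ ≤ ∫⁻ b : Fin d → ℝ, ∫⁻ w : ℝ, (0 : ℝ≥0∞) := by
                  refine lintegral_mono fun b => lintegral_mono fun w =>
                    (detTraceWeight_borderCoords_le a l v b w).trans ?_
                  rw [detTraceWeight, Set.indicator_of_notMem (by exact hV), zero_mul]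
              _ ≤ _ := by simp
      _ < ∞ := by
          rw [lintegral_mul_const' _ _ hTtop.ne]
          exact ENNReal.mul_lt_top (ih (by linarith) hl) hTtop

/-- An entrywise perturbation of the identity by at most ε changes the quadratic form by at most ε d
|x|², which is at most |x|²/2 for this ε. Hence the positive definite cone contains an open set and
has positive Lebesgue measure, so the inverted Wishart weight cannot integrate to zero. -/
theorem posDef_symMatrix_of_near_one {d : ℕ} {v : {p : Fin d × Fin d // p.1 ≤ p.2} → ℝ}
    (h : ∀ p, |v p - if p.1.1 = p.1.2 then 1 else 0| < 1 / (2 * (d + 1))) :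
    (symMatrix v).PosDef := by
  have hsym : (symMatrix v).IsHermitian := by
    ext i j
    simp only [conjTranspose_apply, star_trivial, symMatrix, of_apply]
    rcases lt_trichotomy i j with hij | rfl | hij
    · simp [hij.le, not_le.2 hij]
    · rfl
    · simp [hij.le, not_le.2 hij]
  have hent : ∀ i j, |symMatrix v i j - (1 : Matrix (Fin d) (Fin d) ℝ) i j| ≤ 1 / (2 * (d + 1)) := by
    intro i j
    simp only [symMatrix, of_apply, one_apply]
    split_ifs with h1 h2 h2
    · simpa [h2] using (h ⟨(i, j), h1⟩).le
    · simpa [h2] using (h ⟨(i, j), h1⟩).le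
    · exact absurd h2.le h1
    · simpa [h2, Ne.symm h2] using (h ⟨(j, i), (not_le.1 h1).le⟩).le
  refine PosDef.of_dotProduct_mulVec_pos hsym fun x hx => ?_
  set ε : ℝ := 1 / (2 * (d + 1)) with hε
  have hε0 : 0 ≤ ε := by positivity
  have hxx : 0 < ∑ i, x i ^ 2 := by
    obtain ⟨i, hi⟩ := Function.ne_iff.1 hx
    exact Finset.sum_pos' (fun i _ => sq_nonneg _) ⟨i, Finset.mem_univ _, by
      have : x i ≠ 0 := hi
      positivity⟩
  have hq : x ⬝ᵥ (symMatrix v *ᵥ x) = ∑ i, x i ^ 2 +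
      ∑ i, ∑ j, (symMatrix v i j - (1 : Matrix (Fin d) (Fin d) ℝ) i j) * (x i * x j) := by
    have h1 : ∑ i, x i ^ 2 = ∑ i, ∑ j, (1 : Matrix (Fin d) (Fin d) ℝ) i j * (x i * x j) := by
      refine Finset.sum_congr rfl fun i _ => ?_
      simp [one_apply, sq]
    rw [h1, ← Finset.sum_add_distrib]
    simp only [dotProduct, mulVec, Finset.mul_sum]
    refine Finset.sum_congr rfl fun i _ => ?_
    rw [← Finset.sum_add_distrib]
    exact Finset.sum_congr rfl fun j _ => by ring
  have hlow : -(ε * d * ∑ i, x i ^ 2) ≤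
      ∑ i, ∑ j, (symMatrix v i j - (1 : Matrix (Fin d) (Fin d) ℝ) i j) * (x i * x j) := by
    have h2 : ∀ i j, -(ε * ((x i ^ 2 + x j ^ 2) / 2)) ≤
        (symMatrix v i j - (1 : Matrix (Fin d) (Fin d) ℝ) i j) * (x i * x j) := by
      intro i j
      refine (abs_le.1 ?_).1
      rw [abs_mul]
      refine mul_le_mul (hent i j) ?_ (abs_nonneg _) hε0
      rw [abs_le]
      constructor <;> nlinarith [sq_nonneg (x i - x j), sq_nonneg (x i + x j)]
    refine le_trans (le_of_eq ?_) (Finset.sum_le_sum fun i _ => Finset.sum_le_sum fun j _ => h2 i j)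
    simp only [Finset.sum_neg_distrib, ← Finset.mul_sum, ← Finset.sum_div, Finset.sum_add_distrib,
      Finset.sum_const, Finset.card_univ, Fintype.card_fin, nsmul_eq_mul]
    ring
  rw [star_trivial, hq]
  have : ε * d ≤ 1 / 2 := by
    rw [hε, div_mul_eq_mul_div, div_le_div_iff₀ (by positivity) (by norm_num)]
    linarith
  nlinarith

theorem symLebesgue_posDef_ne_zero (d : ℕ) : symLebesgue d {V | V.PosDef} ≠ 0 := by
  rw [symLebesgue, Measure.map_apply measurable_symMatrix measurableSet_posDef]
  set c : {p : Fin d × Fin d // p.1 ≤ p.2} → ℝ := fun p => if p.1.1 = p.1.2 then 1 else 0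
  have hsub : Set.pi Set.univ (fun p => Metric.ball (c p) (1 / (2 * ((d : ℝ) + 1)))) ⊆
      symMatrix ⁻¹' {V | V.PosDef} := by
    intro v hv
    refine posDef_symMatrix_of_near_one fun p => ?_
    have := hv p (Set.mem_univ p)
    rwa [Metric.mem_ball, Real.dist_eq] at this
  have hpos := (isOpen_set_pi Set.finite_univ fun p _ => Metric.isOpen_ball
    (x := c p) (ε := 1 / (2 * ((d : ℝ) + 1)))).measure_pos volume
    ⟨c, fun p _ => Metric.mem_ball_self (by positivity)⟩
  exact (hpos.trans_le (measure_mono hsub)).ne'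

end InvWishart

/-! ### The inverted Wishart law -/

section CovarianceLaw

instance instSFiniteSymLebesgue (d : ℕ) : SFinite (symLebesgue d) := by
  unfold symLebesgue; infer_instance

/-- The properties of the law of the noise covariance on which the information computations rely. -/
structure IsCovarianceLaw {d : ℕ} (π : Measure (Matrix (Fin d) (Fin d) ℝ)) : Prop where
  prob : IsProbabilityMeasure π
  posDef : ∀ᵐ V ∂π, V.PosDef
  log_det : Integrable (fun V => Real.log V.det) π
  trace_inv : Integrable (fun V => (V⁻¹).trace) π
  det_inv : Integrable (fun V => V.det⁻¹) π

/-- The unnormalized inverted Wishart density `|V|^{-a} e^{-tr(V⁻¹ Q)/2}`. -/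
noncomputable def invWishartWeight {d : ℕ} (a : ℝ) (Q : Matrix (Fin d) (Fin d) ℝ) :
    Matrix (Fin d) (Fin d) ℝ → ℝ≥0∞ :=
  {V | V.PosDef}.indicator fun V =>
    ENNReal.ofReal (V.det ^ (-a) * Real.exp (-(1 / 2) * (V⁻¹ * Q).trace))

theorem measurable_invWishartWeight {d : ℕ} (a : ℝ) (Q : Matrix (Fin d) (Fin d) ℝ) :
    Measurable (invWishartWeight a Q) := by
  refine Measurable.indicator ?_ measurableSet_posDef
  exact ((measurable_matrix_det.pow_const _).mul
    ((measurable_trace_inv_mul Q).const_mul _).exp).ennreal_ofReal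

theorem invWishartWeight_of_posDef {d : ℕ} (a : ℝ) (Q : Matrix (Fin d) (Fin d) ℝ)
    {V : Matrix (Fin d) (Fin d) ℝ} (hV : V.PosDef) : invWishartWeight a Q V =
      ENNReal.ofReal (V.det ^ (-a) * Real.exp (-(1 / 2) * (V⁻¹ * Q).trace)) :=
  Set.indicator_of_mem (s := {V : Matrix (Fin d) (Fin d) ℝ | V.PosDef}) hV _

theorem invWishartWeight_of_not_posDef {d : ℕ} (a : ℝ) (Q : Matrix (Fin d) (Fin d) ℝ)
    {V : Matrix (Fin d) (Fin d) ℝ} (hV : ¬ V.PosDef) : invWishartWeight a Q V = 0 :=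
  Set.indicator_of_notMem (s := {V : Matrix (Fin d) (Fin d) ℝ | V.PosDef}) hV _

theorem detTraceWeight_of_posDef {d : ℕ} (a l : ℝ) {V : Matrix (Fin d) (Fin d) ℝ} (hV : V.PosDef) :
    detTraceWeight a l V = ENNReal.ofReal (V.det ^ (-a) * Real.exp (-l * (V⁻¹).trace)) :=
  Set.indicator_of_mem (s := {V : Matrix (Fin d) (Fin d) ℝ | V.PosDef}) hV _

theorem lintegral_detTraceWeight_symLebesgue_lt_top {d : ℕ} {a l : ℝ} (ha : (d : ℝ) < a)
    (hl : 0 < l) : ∫⁻ V, detTraceWeight a l V ∂(symLebesgue d) < ∞ := by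
  rw [symLebesgue, lintegral_map (measurable_detTraceWeight a l) measurable_symMatrix]
  exact lintegral_detTraceWeight_lt_top d ha hl

theorem lintegral_invWishartWeight_ne_zero {d : ℕ} (a : ℝ) (Q : Matrix (Fin d) (Fin d) ℝ) :
    ∫⁻ V, invWishartWeight a Q V ∂(symLebesgue d) ≠ 0 := by
  intro h
  rw [lintegral_eq_zero_iff (measurable_invWishartWeight a Q)] at h
  refine symLebesgue_posDef_ne_zero d (measure_mono_null ?_ h)
  intro V hV
  have hV : V.PosDef := hV
  change ¬ invWishartWeight a Q V = 0
  rw [invWishartWeight_of_posDef a Q hV, ENNReal.ofReal_eq_zero, not_le]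
  have := hV.det_pos
  positivity

theorem exists_integrable_of_detTraceWeight_bound {d : ℕ} {a : ℝ} (ha : (d : ℝ) < a)
    {Q : Matrix (Fin d) (Fin d) ℝ} (hQ : Q.PosDef) :
    ∃ l : ℝ, 0 < l ∧ (∀ V, invWishartWeight a Q V ≤ detTraceWeight a l V) ∧
      ∫⁻ V, invWishartWeight a Q V ∂(symLebesgue d) < ∞ := by
  obtain ⟨l, hl, h⟩ := exists_pos_mul_trace_inv_le hQ
  have hle : ∀ V, invWishartWeight a Q V ≤ detTraceWeight a (l / 2) V := by
    intro V
    by_cases hV : V.PosDef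
    · rw [invWishartWeight_of_posDef a Q hV, detTraceWeight_of_posDef a _ hV]
      have := hV.det_pos
      have := h V hV
      refine ENNReal.ofReal_le_ofReal (mul_le_mul_of_nonneg_left (Real.exp_le_exp.2 ?_) (by positivity))
      linarith
    · rw [invWishartWeight_of_not_posDef a Q hV]; exact zero_le
  exact ⟨l / 2, by positivity, hle, (lintegral_mono hle).trans_lt
    (lintegral_detTraceWeight_symLebesgue_lt_top ha (by positivity))⟩

/-- The normalized inverted Wishart law. -/
noncomputable def invWishartLaw {d : ℕ} (a : ℝ) (Q : Matrix (Fin d) (Fin d) ℝ) :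
    Measure (Matrix (Fin d) (Fin d) ℝ) :=
  (∫⁻ V, invWishartWeight a Q V ∂(symLebesgue d))⁻¹ •
    (symLebesgue d).withDensity (invWishartWeight a Q)

/-- The hypothesis d < a is open and the exponential has room to spare, so each test function can be
absorbed by moving the exponent slightly or by giving up half of l. -/
theorem isCovarianceLaw_invWishartLaw {d : ℕ} {a : ℝ} (ha : (d : ℝ) < a)
    {Q : Matrix (Fin d) (Fin d) ℝ} (hQ : Q.PosDef) : IsCovarianceLaw (invWishartLaw a Q) := by
  obtain ⟨l, hl, hle, hfin⟩ := exists_integrable_of_detTraceWeight_bound ha hQ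
  have hne := lintegral_invWishartWeight_ne_zero a Q
  have hwm := measurable_invWishartWeight a Q
  have hdetm := measurable_matrix_det (n := Fin d)
  -- Integrability criterion: the weight times |f| is dominated by two finite weights with exponents
  -- above d and the halved rate l/2.
  have key : ∀ {f : Matrix (Fin d) (Fin d) ℝ → ℝ} {C a₁ a₂ : ℝ}, Measurable f → 0 ≤ C →
      (d : ℝ) < a₁ → (d : ℝ) < a₂ →
      (∀ V, V.PosDef → V.det ^ (-a) * Real.exp (-l * (V⁻¹).trace) * |f V| ≤
        C * (V.det ^ (-a₁) * Real.exp (-(l / 2) * (V⁻¹).trace) +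
          V.det ^ (-a₂) * Real.exp (-(l / 2) * (V⁻¹).trace))) →
      Integrable f (invWishartLaw a Q) := by
    intro f C a₁ a₂ hf hC h₁ h₂ hb
    refine Integrable.smul_measure ?_ (ENNReal.inv_ne_top.2 hne)
    refine ⟨hf.aestronglyMeasurable, ?_⟩
    rw [hasFiniteIntegral_iff_norm, lintegral_withDensity_eq_lintegral_mul _ hwm (by fun_prop)]
    calc _ ≤ ∫⁻ V, ENNReal.ofReal C * (detTraceWeight a₁ (l / 2) V + detTraceWeight a₂ (l / 2) V)
          ∂(symLebesgue d) := by
          refine lintegral_mono fun V => ?_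
          by_cases hV : V.PosDef
          · have hd := hV.det_pos
            refine (mul_le_mul_left (hle V) _).trans ?_
            rw [detTraceWeight_of_posDef _ _ hV, detTraceWeight_of_posDef _ _ hV,
              detTraceWeight_of_posDef _ _ hV, ← ENNReal.ofReal_mul (by positivity),
              ← ENNReal.ofReal_add (by positivity) (by positivity), ← ENNReal.ofReal_mul hC]
            exact ENNReal.ofReal_le_ofReal (hb V hV)
          · simp [invWishartWeight_of_not_posDef a Q hV]
      _ < ∞ := by
          rw [lintegral_const_mul' _ _ ENNReal.ofReal_ne_top,
            lintegral_add_left (measurable_detTraceWeight _ _)]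
          exact ENNReal.mul_lt_top ENNReal.ofReal_lt_top (ENNReal.add_lt_top.2
            ⟨lintegral_detTraceWeight_symLebesgue_lt_top h₁ (by positivity),
              lintegral_detTraceWeight_symLebesgue_lt_top h₂ (by positivity)⟩)
  have hexp : ∀ V : Matrix (Fin d) (Fin d) ℝ, V.PosDef →
      Real.exp (-l * (V⁻¹).trace) ≤ Real.exp (-(l / 2) * (V⁻¹).trace) := by
    intro V hV
    have := hV.inv.posSemidef.trace_nonneg
    exact Real.exp_le_exp.2 (by nlinarith)
  refine ⟨⟨?_⟩, ?_, ?_, ?_, ?_⟩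
  · rw [invWishartLaw, Measure.smul_apply, withDensity_apply _ MeasurableSet.univ,
      Measure.restrict_univ, smul_eq_mul, ENNReal.inv_mul_cancel hne hfin.ne]
  · refine Measure.ae_smul_measure ?_ _
    rw [ae_withDensity_iff hwm]
    refine Filter.Eventually.of_forall fun V hV => ?_
    by_contra h
    exact hV (invWishartWeight_of_not_posDef a Q h)
  -- Half the gap, so that a - ε still exceeds d; |log x| is bounded by (x^ε + x^{-ε})/ε.
  · set ε := (a - d) / 2 with hε
    have hε0 : 0 < ε := by rw [hε]; linarith
    refine key (C := 1 / ε) (a₁ := a - ε) (a₂ := a + ε) hdetm.log (by positivity)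
      (by rw [hε]; linarith) (by linarith) fun V hV => ?_
    have hd := hV.det_pos
    have h1 : |Real.log V.det| ≤ 1 / ε * (V.det ^ ε + V.det ^ (-ε)) := by
      have e1 := Real.log_le_rpow_div hd.le hε0
      have e2 := Real.log_le_rpow_div (inv_pos.2 hd).le hε0
      rw [Real.log_inv, Real.inv_rpow hd.le, ← Real.rpow_neg hd.le] at e2
      have p1 : 0 < V.det ^ ε / ε := by positivity
      have p2 : 0 < V.det ^ (-ε) / ε := by positivity
      rw [abs_le, one_div, ← div_eq_inv_mul, add_div]
      constructor <;> linarith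
    calc _ ≤ V.det ^ (-a) * Real.exp (-(l / 2) * (V⁻¹).trace) *
          (1 / ε * (V.det ^ ε + V.det ^ (-ε))) := by
          have := hexp V hV
          gcongr
      _ = _ := by
          rw [show -(a - ε) = -a + ε by ring, show -(a + ε) = -a + -ε by ring,
            Real.rpow_add hd, Real.rpow_add hd]
          ring
  · refine key (C := 2 / l) (a₁ := a) (a₂ := a) measurable_trace_inv (by positivity) ha ha
      fun V hV => ?_
    have hd := hV.det_pos
    have ht : 0 ≤ (V⁻¹).trace := hV.inv.posSemidef.trace_nonneg
    have h1 : Real.exp (-l * (V⁻¹).trace) * (V⁻¹).trace ≤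
        2 / l * Real.exp (-(l / 2) * (V⁻¹).trace) := by
      have e1 := Real.add_one_le_exp (l / 2 * (V⁻¹).trace)
      have e2 : Real.exp (-(l / 2) * (V⁻¹).trace) =
          Real.exp (-l * (V⁻¹).trace) * Real.exp (l / 2 * (V⁻¹).trace) := by
        rw [← Real.exp_add]; congr 1; ring
      rw [e2]
      have : (V⁻¹).trace ≤ 2 / l * Real.exp (l / 2 * (V⁻¹).trace) := by
        rw [div_mul_eq_mul_div, le_div_iff₀ hl]; linarith
      calc _ ≤ Real.exp (-l * (V⁻¹).trace) * (2 / l * Real.exp (l / 2 * (V⁻¹).trace)) := by gcongr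
        _ = _ := by ring
    rw [abs_of_nonneg ht, mul_assoc]
    have p : 0 < V.det ^ (-a) := by positivity
    have q : 0 ≤ 2 / l * (V.det ^ (-a) * Real.exp (-(l / 2) * (V⁻¹).trace)) := by positivity
    nlinarith [mul_le_mul_of_nonneg_left h1 p.le]
  · refine key (C := 1) (a₁ := a + 1) (a₂ := a + 1) hdetm.inv zero_le_one (by linarith)
      (by linarith) fun V hV => ?_
    have hd := hV.det_pos
    have h1 : V.det ^ (-(a + 1)) = V.det ^ (-a) * V.det⁻¹ := by
      rw [neg_add, Real.rpow_add hd, Real.rpow_neg_one]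
    rw [abs_of_pos (inv_pos.2 hd), h1]
    have p : 0 < V.det ^ (-a) * V.det⁻¹ := by positivity
    have q : 0 ≤ V.det ^ (-a) * V.det⁻¹ * Real.exp (-(l / 2) * (V⁻¹).trace) := by positivity
    nlinarith [mul_le_mul_of_nonneg_left (hexp V hV) p.le]

end CovarianceLaw

/-! ### Mutual information through densities -/

section Information

/-- Integrability of the log-density excludes the value ∞. Nonnegativity of the integral is recorded
because `ENNReal.ofReal` preserves strict order only on nonnegative reals, and strict comparisons
are needed at the end. -/
theorem klDiv_withDensity {α : Type*} [MeasurableSpace α] {μ ν : Measure α}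
    [IsProbabilityMeasure μ] [IsProbabilityMeasure ν] {f : α → ℝ≥0∞} (hf : Measurable f)
    (h : μ = ν.withDensity f) (hint : Integrable (fun x => Real.log (f x).toReal) μ) :
    InformationTheory.klDiv μ ν = ENNReal.ofReal (∫ x, Real.log (f x).toReal ∂μ) ∧
      0 ≤ ∫ x, Real.log (f x).toReal ∂μ := by
  have hac : μ ≪ ν := h ▸ withDensity_absolutelyContinuous ν f
  have hllr : llr μ ν =ᵐ[μ] fun x => Real.log (f x).toReal := by
    have h1 : μ.rnDeriv ν =ᵐ[μ] f := by
      conv in (μ.rnDeriv ν) => rw [h]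
      exact hac.ae_le (Measure.rnDeriv_withDensity ν hf)
    filter_upwards [h1] with x hx
    rw [llr, hx]
  have hint' : Integrable (llr μ ν) μ := hint.congr hllr.symm
  have hnn := InformationTheory.integral_llr_add_sub_measure_univ_nonneg hac hint'
  rw [InformationTheory.klDiv_of_ac_of_integrable hac hint', integral_congr_ae hllr]
  rw [integral_congr_ae hllr] at hnn
  simp only [probReal_univ, add_sub_cancel_right] at hnn ⊢
  exact ⟨trivial, hnn⟩

/-- Data processing, applied to the equivalence and to its inverse. -/
theorem mutualInfo_comp_measurableEquiv {Ω α β γ : Type} [MeasurableSpace Ω] [MeasurableSpace α]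
    [MeasurableSpace β] [MeasurableSpace γ] (P : Measure Ω) [IsProbabilityMeasure P] {X : Ω → α}
    {Y : Ω → β} (hX : Measurable X) (hY : Measurable Y) (φ : β ≃ᵐ γ) :
    mutualInfo P X (fun ω => φ (Y ω)) = mutualInfo P X Y := by
  have key : ∀ {β γ : Type} [MeasurableSpace β] [MeasurableSpace γ] {Y : Ω → β} {φ : β → γ},
      Measurable Y → Measurable φ → mutualInfo P X (fun ω => φ (Y ω)) ≤ mutualInfo P X Y := by
    intro β γ _ _ Y φ hY hφ
    unfold mutualInfo
    have := Measure.isProbabilityMeasure_map (μ := P) hX.aemeasurable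
    have := Measure.isProbabilityMeasure_map (μ := P) hY.aemeasurable
    have := Measure.isProbabilityMeasure_map (μ := P) (hX.prodMk hY).aemeasurable
    have h1 : (P.map fun ω => (X ω, φ (Y ω))) = (P.map fun ω => (X ω, Y ω)).map (Prod.map id φ) := by
      rw [Measure.map_map (measurable_id.prodMap hφ) (hX.prodMk hY)]; rfl
    have h2 : (P.map X).prod (P.map fun ω => φ (Y ω)) =
        ((P.map X).prod (P.map Y)).map (Prod.map id φ) := by
      rw [← Measure.map_prod_map _ _ measurable_id hφ, Measure.map_id, Measure.map_map hφ hY]; rfl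
    rw [h1, h2]
    exact InformationTheory.klDiv_map_le _ _ (measurable_id.prodMap hφ)
  refine le_antisymm (key hY φ.measurable) ?_
  have := key (Y := fun ω => φ (Y ω)) (φ := φ.symm) (φ.measurable.comp hY) φ.symm.measurable
  simpa using this

/-- The joint law sits on the diagonal, which is null for the product of atomless marginals;
absolute continuity fails. -/
theorem mutualInfo_self_eq_top {Ω : Type} [MeasurableSpace Ω] {d : ℕ} (P : Measure Ω)
    [IsProbabilityMeasure P] {X : Ω → Fin d → ℝ} (hX : Measurable X)
    (h0 : ∀ x, P.map X {x} = 0) : mutualInfo P X X = ∞ := by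
  refine InformationTheory.klDiv_of_not_ac fun hac => ?_
  have := Measure.isProbabilityMeasure_map (μ := P) hX.aemeasurable
  have hD : MeasurableSet (Set.diagonal (Fin d → ℝ)) := isClosed_diagonal.measurableSet
  have h1 : ((P.map X).prod (P.map X)) (Set.diagonal (Fin d → ℝ)) = 0 := by
    rw [Measure.prod_apply hD]
    refine (lintegral_congr fun x => ?_).trans lintegral_zero
    have : Prod.mk x ⁻¹' Set.diagonal (Fin d → ℝ) = {x} := by
      ext y; simp [eq_comm]
    rw [this, h0]
  have h2 := hac h1
  rw [Measure.map_apply (hX.prodMk hX) hD] at h2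
  have : (fun ω => (X ω, X ω)) ⁻¹' Set.diagonal (Fin d → ℝ) = Set.univ := by ext; simp
  rw [this, measure_univ] at h2
  exact one_ne_zero h2

/-- Conditional affine changes of variable. -/
theorem map_withDensity_prod_smul_add {α : Type*} [MeasurableSpace α] {d : ℕ} (τ : Measure α)
    [SFinite τ] {k : α × (Fin d → ℝ) → ℝ≥0∞} (hk : Measurable k) {c : ℝ} (hc : 0 < c)
    {a : α → Fin d → ℝ} (ha : Measurable a) :
    ((τ.prod volume).withDensity k).map (fun p => (p.1, c • p.2 + a p.1)) =
      (τ.prod volume).withDensity fun p =>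
        ENNReal.ofReal (c⁻¹ ^ d) * k (p.1, c⁻¹ • (p.2 - a p.1)) := by
  have hT : Measurable fun p : α × (Fin d → ℝ) => (p.1, c • p.2 + a p.1) := by fun_prop
  have hk' : Measurable fun p : α × (Fin d → ℝ) =>
      ENNReal.ofReal (c⁻¹ ^ d) * k (p.1, c⁻¹ • (p.2 - a p.1)) := by fun_prop
  refine Measure.ext_of_lintegral _ fun h hh => ?_
  rw [lintegral_map hh hT, lintegral_withDensity_eq_lintegral_mul _ hk (g := fun p => h (p.1, c • p.2 + a p.1)) (hh.comp hT),
    lintegral_withDensity_eq_lintegral_mul _ hk' hh]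
  simp only [Pi.mul_apply]
  rw [lintegral_prod _ (by fun_prop), lintegral_prod _ (by fun_prop)]
  refine lintegral_congr fun x => ?_
  set F : (Fin d → ℝ) → ℝ≥0∞ := fun y => k (x, c⁻¹ • (y - a x)) * h (x, y) with hF
  have hFm : Measurable F := by fun_prop
  have h1 : ∀ w, k (x, w) * h (x, c • w + a x) = F (c • w + a x) := by
    intro w; simp [hF, smul_smul, inv_mul_cancel₀ hc.ne']
  have h2 := lintegral_comp_mulVec (B := c • (1 : Matrix (Fin d) (Fin d) ℝ))
    (by simp [hc.ne']) (fun w => F (w + a x)) (by fun_prop)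
  simp only [smul_mulVec, one_mulVec, det_smul, det_one, mul_one, Fintype.card_fin] at h2
  simp only [h1]
  rw [h2, lintegral_add_right_eq_self F, ← lintegral_const_mul _ hFm, abs_of_pos (by positivity),
    inv_pow]
  simp only [hF, mul_assoc]

/-- The upper bound is log C. For the lower one, compare p with an integrable power r of 1 + |x|:
log(r/p) ≤ r/p gives -log p ≤ r/p - log r, where r/p has p-integral ∫ r and -log r is a multiple of
the logarithmic moment. -/
theorem integrable_log_density {X : Type*} [NormedAddCommGroup X] [NormedSpace ℝ X]
    [FiniteDimensional ℝ X] [MeasureSpace X] [BorelSpace X] [(volume : Measure X).IsAddHaarMeasure]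
    {p : X → ℝ≥0∞} (hp : Measurable p) (hp0 : ∀ x, p x ≠ 0) {C : ℝ≥0∞} (hC : C ≠ ∞)
    (hpC : ∀ x, p x ≤ C) (hfin : ∫⁻ x, p x ≠ ∞)
    (hlog : Integrable (fun x => Real.log (1 + ‖x‖)) ((volume : Measure X).withDensity p)) :
    Integrable (fun x => Real.log (p x).toReal) ((volume : Measure X).withDensity p) := by
  have hpt : ∀ x, p x ≠ ∞ := fun x => ne_top_of_le_ne_top hC (hpC x)
  have hpos : ∀ x, 0 < (p x).toReal := fun x => ENNReal.toReal_pos (hp0 x) (hpt x)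
  have : IsFiniteMeasure ((volume : Measure X).withDensity p) :=
    isFiniteMeasure_withDensity hfin
  -- Any exponent above the dimension makes (1 + |x|)^{-N} integrable.
  set N : ℝ := Module.finrank ℝ X + 1 with hN
  set r : X → ℝ := fun x => (1 + ‖x‖) ^ (-N) with hr
  have hrm : Measurable r := by fun_prop
  have hr0 : ∀ x, 0 < r x := fun x => by positivity
  have hrint : Integrable r := integrable_one_add_norm (by rw [hN]; linarith)
  have hquot : Integrable (fun x => r x / (p x).toReal) ((volume : Measure X).withDensity p) := by
    refine ⟨(hrm.div hp.ennreal_toReal).aestronglyMeasurable, ?_⟩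
    rw [hasFiniteIntegral_iff_norm, lintegral_withDensity_eq_lintegral_mul _ hp (by fun_prop)]
    refine lt_of_eq_of_lt (lintegral_congr fun x => ?_) hrint.2
    rw [Pi.mul_apply, Real.norm_of_nonneg (div_pos (hr0 x) (hpos x)).le,
      ENNReal.ofReal_div_of_pos (hpos x), ENNReal.ofReal_toReal (hpt x),
      ENNReal.mul_div_cancel (hp0 x) (hpt x), ← ofReal_norm, Real.norm_of_nonneg (hr0 x).le]
  refine Integrable.mono' (((integrable_const |Real.log C.toReal|).add (hlog.const_mul N)).add hquot)
    hp.ennreal_toReal.log.aestronglyMeasurable (Filter.Eventually.of_forall fun x => ?_)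
  have h1 : Real.log (1 + ‖x‖) ≥ 0 := Real.log_nonneg (by linarith [norm_nonneg x])
  have hN0 : 0 ≤ N := by positivity
  have hq0 : 0 ≤ r x / (p x).toReal := (div_pos (hr0 x) (hpos x)).le
  simp only [Pi.add_apply, Real.norm_eq_abs]
  rw [abs_le]
  constructor
  · have e1 : Real.log (r x / (p x).toReal) ≤ r x / (p x).toReal :=
      (Real.log_le_sub_one_of_pos (div_pos (hr0 x) (hpos x))).trans (by linarith)
    rw [Real.log_div (hr0 x).ne' (hpos x).ne', hr, Real.log_rpow (by positivity)] at e1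
    have := abs_nonneg (Real.log C.toReal)
    have e2 : (1 + ‖x‖) ^ (-N) / (p x).toReal = r x / (p x).toReal := rfl
    simp only [e2] at e1
    linarith
  · have e1 : Real.log (p x).toReal ≤ Real.log C.toReal :=
      Real.log_le_log (hpos x) (ENNReal.toReal_mono hC (hpC x))
    have := le_abs_self (Real.log C.toReal)
    have := mul_nonneg hN0 h1
    linarith

end Information

/-! ### Scale mixtures of normal laws -/

section Mixture

variable {d : ℕ}

/-- The centred normal density as an extended nonnegative function. -/
noncomputable def gauss (V : Matrix (Fin d) (Fin d) ℝ) (e : Fin d → ℝ) : ℝ≥0∞ :=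
  ENNReal.ofReal (normalDensity 0 V e)

theorem measurable_normalDensity :
    Measurable fun p : Matrix (Fin d) (Fin d) ℝ × (Fin d → ℝ) => normalDensity 0 p.1 p.2 := by
  unfold normalDensity
  simp only [sub_zero]
  refine Measurable.mul ?_ ((measurable_quadForm_inv.const_mul _).exp)
  simp only [det_smul]
  exact ((measurable_matrix_det.comp measurable_fst).const_mul _).pow_const _

theorem measurable_gauss :
    Measurable fun p : Matrix (Fin d) (Fin d) ℝ × (Fin d → ℝ) => gauss p.1 p.2 :=
  measurable_normalDensity.ennreal_ofReal

theorem measurable_gauss_comp {α : Type*} [MeasurableSpace α] {f : α → Matrix (Fin d) (Fin d) ℝ}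
    {h : α → Fin d → ℝ} (hf : Measurable f) (hh : Measurable h) :
    Measurable fun x => gauss (f x) (h x) := by
  have h₁ := hf.prodMk hh
  have h₂ := measurable_gauss.comp h₁
  exact h₂

theorem measurable_gauss_left (V : Matrix (Fin d) (Fin d) ℝ) : Measurable (gauss V) :=
  measurable_gauss_comp measurable_const measurable_id

theorem measurable_gauss_right (e : Fin d → ℝ) :
    Measurable fun V : Matrix (Fin d) (Fin d) ℝ => gauss V e :=
  measurable_gauss_comp measurable_id measurable_const

theorem det_two_pi_smul (V : Matrix (Fin d) (Fin d) ℝ) :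
    ((2 * Real.pi) • V).det = (2 * Real.pi) ^ d * V.det := by simp

theorem det_two_pi_smul_pos {V : Matrix (Fin d) (Fin d) ℝ} (hV : V.PosDef) :
    0 < ((2 * Real.pi) • V).det := by
  rw [det_two_pi_smul]
  have := hV.det_pos
  have := Real.pi_pos
  positivity

theorem normalDensity_pos {V : Matrix (Fin d) (Fin d) ℝ} (hV : V.PosDef) {μ : Fin d → ℝ}
    (e : Fin d → ℝ) : 0 < normalDensity μ V e := by
  have := det_two_pi_smul_pos hV
  unfold normalDensity
  positivity

theorem log_normalDensity {V : Matrix (Fin d) (Fin d) ℝ} (hV : V.PosDef) (e : Fin d → ℝ) :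
    Real.log (normalDensity 0 V e) =
      -(1 / 2) * (d * Real.log (2 * Real.pi)) - 1 / 2 * Real.log V.det
        - 1 / 2 * (e ⬝ᵥ (V⁻¹ *ᵥ e)) := by
  have h1 := det_two_pi_smul_pos hV
  have h2 := hV.det_pos
  have h3 := Real.pi_pos
  unfold normalDensity
  rw [Real.log_mul (by positivity) (Real.exp_pos _).ne', Real.log_exp, Real.log_rpow h1,
    det_two_pi_smul, Real.log_mul (by positivity) h2.ne', Real.log_pow, sub_zero]
  ring

theorem lintegral_gauss {V : Matrix (Fin d) (Fin d) ℝ} (hV : V.PosDef) : ∫⁻ e, gauss V e = 1 :=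
  lintegral_normalDensity 0 hV

theorem normalDensity_le {V : Matrix (Fin d) (Fin d) ℝ} (hV : V.PosDef) (e : Fin d → ℝ) :
    normalDensity 0 V e ≤ V.det ^ (-(1 / 2) : ℝ) := by
  have h1 := det_two_pi_smul_pos hV
  have h2 := hV.det_pos
  unfold normalDensity
  refine (mul_le_of_le_one_right (by positivity) (Real.exp_le_one_iff.2 ?_)).trans ?_
  · have := quadForm_inv_nonneg hV (e - 0)
    linarith
  · refine Real.rpow_le_rpow_of_nonpos h2 ?_ (by norm_num)
    rw [det_two_pi_smul]
    refine le_mul_of_one_le_left h2.le (one_le_pow₀ ?_)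
    linarith [Real.pi_gt_three]

/-- Each factor is at most |V|^{-1/2}. The bound 1 + |V|⁻¹ is chosen so that it also covers a single
factor, and one integrability assumption then bounds both mixture densities. -/
theorem gauss_mul_gauss_le {V : Matrix (Fin d) (Fin d) ℝ} (hV : V.PosDef) (e f : Fin d → ℝ) :
    gauss V e * gauss V f ≤ ENNReal.ofReal (1 + V.det⁻¹) := by
  have h2 := hV.det_pos
  unfold gauss
  rw [← ENNReal.ofReal_mul (normalDensity_pos hV e).le]
  refine ENNReal.ofReal_le_ofReal ?_
  refine (mul_le_mul (normalDensity_le hV e) (normalDensity_le hV f) (normalDensity_pos hV f).le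
    (by positivity)).trans ?_
  rw [← Real.rpow_add h2]
  norm_num [Real.rpow_neg_one]

theorem gauss_le {V : Matrix (Fin d) (Fin d) ℝ} (hV : V.PosDef) (e : Fin d → ℝ) :
    gauss V e ≤ ENNReal.ofReal (1 + V.det⁻¹) := by
  have h2 := hV.det_pos
  refine ENNReal.ofReal_le_ofReal ((normalDensity_le hV e).trans ?_)
  have h3 : V.det ^ (-(1 / 2) : ℝ) * V.det ^ (-(1 / 2) : ℝ) = V.det⁻¹ := by
    rw [← Real.rpow_add h2]; norm_num [Real.rpow_neg_one]
  rw [← h3]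
  nlinarith [sq_nonneg (V.det ^ (-(1 / 2) : ℝ) - 1), sq_nonneg (V.det ^ (-(1 / 2) : ℝ) )]

/-- From q e^{-q/2} ≤ 4 e^{-q/4}, where the right side is a multiple of the normal density with
covariance 2V. The exact value is irrelevant; the bound must be uniform in V. -/
theorem lintegral_gauss_mul_quadForm_le {V : Matrix (Fin d) (Fin d) ℝ} (hV : V.PosDef) :
    ∫⁻ e, gauss V e * ENNReal.ofReal (e ⬝ᵥ (V⁻¹ *ᵥ e)) ≤
      ENNReal.ofReal (4 * (2 ^ d : ℝ) ^ (1 / 2 : ℝ)) := by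
  have h2V : ((2 : ℝ) • V).PosDef := hV.smul (by norm_num)
  have hD := det_two_pi_smul_pos hV
  calc _ ≤ ∫⁻ e, ENNReal.ofReal (4 * (2 ^ d : ℝ) ^ (1 / 2 : ℝ)) * gauss ((2 : ℝ) • V) e := by
        refine lintegral_mono fun e => ?_
        unfold gauss
        rw [← ENNReal.ofReal_mul (normalDensity_pos hV e).le, ← ENNReal.ofReal_mul (by positivity)]
        refine ENNReal.ofReal_le_ofReal ?_
        have hinv : ((2 : ℝ) • V)⁻¹ = (2 : ℝ)⁻¹ • V⁻¹ := by
          refine inv_eq_right_inv ?_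
          rw [smul_mul_smul_comm, mul_nonsing_inv _ (isUnit_iff_ne_zero.2 hV.det_pos.ne')]
          norm_num
        have hdet : ((2 * Real.pi) • (2 : ℝ) • V).det = 2 ^ d * ((2 * Real.pi) • V).det := by
          rw [smul_comm, det_smul, Fintype.card_fin]
        unfold normalDensity
        rw [hinv, hdet, Real.mul_rpow (by positivity) hD.le, sub_zero, smul_mulVec, dotProduct_smul,
          smul_eq_mul]
        set q := e ⬝ᵥ (V⁻¹ *ᵥ e)
        set D := ((2 * Real.pi) • V).det ^ (-(1 / 2) : ℝ) with hDdef
        have hD0 : 0 < D := by positivity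
        have e1 : ((2 : ℝ) ^ d) ^ (1 / 2 : ℝ) * ((2 : ℝ) ^ d) ^ (-(1 / 2) : ℝ) = 1 := by
          rw [← Real.rpow_add (by positivity)]; norm_num
        have e2 : Real.exp (-(1 / 2) * q) * q ≤ 4 * Real.exp (-(1 / 2) * (2⁻¹ * q)) := by
          have h3 := Real.add_one_le_exp (q / 4)
          have h4 : Real.exp (-(1 / 2) * (2⁻¹ * q)) = Real.exp (-(1 / 2) * q) * Real.exp (q / 4) := by
            rw [← Real.exp_add]; congr 1; ring
          rw [h4]
          nlinarith [Real.exp_pos (-(1 / 2) * q)]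
        calc D * Real.exp (-(1 / 2) * q) * q = D * (Real.exp (-(1 / 2) * q) * q) := by ring
          _ ≤ D * (4 * Real.exp (-(1 / 2) * (2⁻¹ * q))) := by gcongr
          _ = 4 * (((2 : ℝ) ^ d) ^ (1 / 2 : ℝ) * ((2 : ℝ) ^ d) ^ (-(1 / 2) : ℝ)) * D *
              Real.exp (-(1 / 2) * (2⁻¹ * q)) := by rw [e1]; ring
          _ = _ := by ring
    _ = _ := by rw [lintegral_const_mul' _ _ ENNReal.ofReal_ne_top, lintegral_gauss h2V, mul_one]

/-- Since |e|² ≤ tr V · q, one has 1 + |e| ≤ 2 (1 + tr V)(1 + q). Passing to logarithms leaves only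
terms integrable under a covariance law, although V itself may have no mean. -/
theorem log_one_add_norm_le {V : Matrix (Fin d) (Fin d) ℝ} (hV : V.PosDef) (e : Fin d → ℝ) :
    Real.log (1 + ‖e‖) ≤ Real.log 2 + (Real.log V.det + (V⁻¹).trace) + e ⬝ᵥ (V⁻¹ *ᵥ e) := by
  set q := e ⬝ᵥ (V⁻¹ *ᵥ e) with hq
  have hq0 : 0 ≤ q := quadForm_inv_nonneg hV e
  have htr0 : 0 ≤ V.trace := hV.posSemidef.trace_nonneg
  have hsq : ‖e‖ ^ 2 ≤ V.trace * q := by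
    have h0 : 0 ≤ V.trace * q := mul_nonneg htr0 hq0
    have h1 : ‖e‖ ≤ √(V.trace * q) := by
      refine (pi_norm_le_iff_of_nonneg (Real.sqrt_nonneg _)).2 fun i => Real.abs_le_sqrt ?_
      refine (sq_apply_le_mul_quadForm_inv hV e i).trans (mul_le_mul_of_nonneg_right ?_ hq0)
      exact Finset.single_le_sum (f := fun i => V i i) (fun j _ => hV.posSemidef.diag_nonneg)
        (Finset.mem_univ i)
    calc ‖e‖ ^ 2 ≤ √(V.trace * q) ^ 2 := by gcongr
      _ = _ := Real.sq_sqrt h0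
  have hdet := hV.det_pos
  have h1 : Real.log (1 + V.trace) ≤ Real.log V.det + (V⁻¹).trace := by
    rw [← Real.log_exp (V⁻¹).trace, ← Real.log_mul hdet.ne' (Real.exp_pos _).ne']
    exact Real.log_le_log (by positivity) (one_add_trace_le_det_mul_exp hV)
  have h2 : Real.log (1 + q) ≤ q := (Real.log_le_sub_one_of_pos (by positivity)).trans (by linarith)
  have h3 : Real.log (1 + ‖e‖) ≤ Real.log (2 * ((1 + V.trace) * (1 + q))) := by
    refine Real.log_le_log (by positivity) ?_
    nlinarith [sq_nonneg (‖e‖ - 1), norm_nonneg e, mul_nonneg htr0 hq0]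
  rw [Real.log_mul (by norm_num) (by positivity), Real.log_mul (by positivity) (by positivity)] at h3
  linarith

/-- The joint law of `(V, (e, f))`, where `e` and `f` are independent and centred normal with
covariance `V` given `V`. -/
noncomputable def mixLaw (π : Measure (Matrix (Fin d) (Fin d) ℝ)) :
    Measure (Matrix (Fin d) (Fin d) ℝ × ((Fin d → ℝ) × (Fin d → ℝ))) :=
  (π.prod volume).withDensity fun p => gauss p.1 p.2.1 * gauss p.1 p.2.2

/-- The marginal density of `e`. -/
noncomputable def mixDensity (π : Measure (Matrix (Fin d) (Fin d) ℝ)) (e : Fin d → ℝ) : ℝ≥0∞ :=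
  ∫⁻ V, gauss V e ∂π

/-- The joint density of `(e, f)`. -/
noncomputable def mixDensityPair (π : Measure (Matrix (Fin d) (Fin d) ℝ))
    (x : (Fin d → ℝ) × (Fin d → ℝ)) : ℝ≥0∞ :=
  ∫⁻ V, gauss V x.1 * gauss V x.2 ∂π

variable {π : Measure (Matrix (Fin d) (Fin d) ℝ)}

theorem measurable_mixDensity [SFinite π] : Measurable (mixDensity π) :=
  Measurable.lintegral_prod_left' (f := fun p : Matrix (Fin d) (Fin d) ℝ × (Fin d → ℝ) =>
    gauss p.1 p.2) measurable_gauss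

theorem measurable_gauss_mul_gauss : Measurable
    fun p : Matrix (Fin d) (Fin d) ℝ × ((Fin d → ℝ) × (Fin d → ℝ)) =>
      gauss p.1 p.2.1 * gauss p.1 p.2.2 :=
  (measurable_gauss_comp measurable_fst measurable_snd.fst).mul
    (measurable_gauss_comp measurable_fst measurable_snd.snd)

theorem measurable_mixDensityPair [SFinite π] : Measurable (mixDensityPair π) :=
  Measurable.lintegral_prod_left'
    (f := fun p : Matrix (Fin d) (Fin d) ℝ × ((Fin d → ℝ) × (Fin d → ℝ)) =>
      gauss p.1 p.2.1 * gauss p.1 p.2.2) measurable_gauss_mul_gauss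

theorem lintegral_mixLaw [SFinite π]
    {h : Matrix (Fin d) (Fin d) ℝ × ((Fin d → ℝ) × (Fin d → ℝ)) → ℝ≥0∞} (hh : Measurable h) :
    ∫⁻ p, h p ∂(mixLaw π) =
      ∫⁻ V, (∫⁻ x : (Fin d → ℝ) × (Fin d → ℝ), gauss V x.1 * gauss V x.2 * h (V, x)) ∂π := by
  rw [mixLaw, lintegral_withDensity_eq_lintegral_mul _ measurable_gauss_mul_gauss hh,
    lintegral_prod _ (measurable_gauss_mul_gauss.mul hh).aemeasurable]
  rfl

theorem lintegral_mixLaw_fst_snd (hπ : IsCovarianceLaw π)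
    {h : Matrix (Fin d) (Fin d) ℝ × (Fin d → ℝ) → ℝ≥0∞} (hh : Measurable h) :
    ∫⁻ p, h (p.1, p.2.1) ∂(mixLaw π) = ∫⁻ V, (∫⁻ e, gauss V e * h (V, e)) ∂π := by
  have := hπ.prob
  rw [lintegral_mixLaw (h := fun p => h (p.1, p.2.1)) (by fun_prop)]
  refine lintegral_congr_ae ?_
  filter_upwards [hπ.posDef] with V hV
  have hg := measurable_gauss_left V
  rw [Measure.volume_eq_prod, lintegral_prod _ (by fun_prop)]
  refine lintegral_congr fun e => ?_
  simp only [mul_right_comm _ (gauss V _) (h _)]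
  rw [lintegral_const_mul _ hg, lintegral_gauss hV, mul_one]

theorem map_mixLaw_fst (hπ : IsCovarianceLaw π) : (mixLaw π).map Prod.fst = π := by
  refine Measure.ext_of_lintegral _ fun h hh => ?_
  rw [lintegral_map hh measurable_fst,
    lintegral_mixLaw_fst_snd hπ (h := fun p => h p.1) (by fun_prop)]
  refine lintegral_congr_ae ?_
  filter_upwards [hπ.posDef] with V hV
  rw [lintegral_mul_const _ (measurable_gauss_left V), lintegral_gauss hV,
    one_mul]

theorem isProbabilityMeasure_mixLaw (hπ : IsCovarianceLaw π) : IsProbabilityMeasure (mixLaw π) := by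
  have := hπ.prob
  constructor
  have h := congrArg (fun μ => μ Set.univ) (map_mixLaw_fst hπ)
  simpa [Measure.map_apply measurable_fst] using h

theorem map_mixLaw_noise (hπ : IsCovarianceLaw π) :
    (mixLaw π).map (fun p => p.2.1) = volume.withDensity (mixDensity π) := by
  have := hπ.prob
  refine Measure.ext_of_lintegral _ fun h hh => ?_
  rw [lintegral_map hh (by fun_prop),
    lintegral_mixLaw_fst_snd hπ (h := fun p => h p.2) (by fun_prop),
    lintegral_withDensity_eq_lintegral_mul _ measurable_mixDensity hh,
    lintegral_lintegral_swap (measurable_gauss.mul (hh.comp measurable_snd)).aemeasurable]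
  refine lintegral_congr fun e => ?_
  exact lintegral_mul_const (h e) (measurable_gauss_right e)

theorem map_mixLaw_snd [SFinite π] :
    (mixLaw π).map Prod.snd = volume.withDensity (mixDensityPair π) := by
  refine Measure.ext_of_lintegral _ fun h hh => ?_
  rw [lintegral_map hh (by fun_prop), lintegral_mixLaw (h := fun p => h p.2) (by fun_prop),
    lintegral_withDensity_eq_lintegral_mul _ measurable_mixDensityPair hh,
    lintegral_lintegral_swap (measurable_gauss_mul_gauss.mul (hh.comp measurable_snd)).aemeasurable]
  refine lintegral_congr fun e => ?_
  have hg : Measurable fun V => gauss V e.1 * gauss V e.2 :=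
    (measurable_gauss_right e.1).mul (measurable_gauss_right e.2)
  exact lintegral_mul_const (h e) hg

theorem isAddHaarMeasure_volume_pair (d : ℕ) :
    (volume : Measure ((Fin d → ℝ) × (Fin d → ℝ))).IsAddHaarMeasure :=
  Measure.prod.instIsAddHaarMeasure _ _

/-- The reflection `(e, f) ↦ (a e + b f, b e - a f)`. -/
def reflectPair (a b : ℝ) :
    ((Fin d → ℝ) × (Fin d → ℝ)) →ₗ[ℝ] ((Fin d → ℝ) × (Fin d → ℝ)) where
  toFun x := (a • x.1 + b • x.2, b • x.1 - a • x.2)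
  map_add' x y := by ext <;> simp <;> ring
  map_smul' c x := by ext <;> simp <;> ring

theorem reflectPair_involutive {a b : ℝ} (hab : a ^ 2 + b ^ 2 = 1) :
    Function.Involutive (reflectPair (d := d) a b) := by
  intro x
  ext i
  · simp only [reflectPair, LinearMap.coe_mk, AddHom.coe_mk, Pi.add_apply, Pi.smul_apply,
      Pi.sub_apply, smul_eq_mul]
    linear_combination x.1 i * hab
  · simp only [reflectPair, LinearMap.coe_mk, AddHom.coe_mk, Pi.add_apply, Pi.smul_apply,
      Pi.sub_apply, smul_eq_mul]
    linear_combination x.2 i * hab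

theorem measurable_reflectPair (a b : ℝ) : Measurable (reflectPair (d := d) a b) :=
  (LinearMap.continuous_of_finiteDimensional _).measurable

/-- By uniqueness of Haar measure the image of Lebesgue measure is c times Lebesgue measure; the map
is an involution, so c² = 1. -/
theorem measurePreserving_reflectPair {a b : ℝ} (hab : a ^ 2 + b ^ 2 = 1) :
    MeasurePreserving (reflectPair (d := d) a b) := by
  have hm := measurable_reflectPair (d := d) a b
  refine ⟨hm, ?_⟩
  let L := (LinearEquiv.ofInvolutive (reflectPair (d := d) a b)
    (reflectPair_involutive hab)).toContinuousLinearEquiv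
  have hL : ⇑L = reflectPair (d := d) a b := rfl
  have := isAddHaarMeasure_volume_pair d
  have hHaar : (volume.map L : Measure ((Fin d → ℝ) × (Fin d → ℝ))).IsAddHaarMeasure :=
    L.isAddHaarMeasure_map volume
  obtain ⟨c, hc⟩ : ∃ c : NNReal,
      (volume.map L : Measure ((Fin d → ℝ) × (Fin d → ℝ))) = c • volume :=
    ⟨_, Measure.isAddLeftInvariant_eq_smul _ volume⟩
  rw [hL] at hc
  have h2 : (volume : Measure ((Fin d → ℝ) × (Fin d → ℝ))) = (c * c) • volume := by
    conv_lhs => rw [← Measure.map_id (μ := (volume : Measure ((Fin d → ℝ) × (Fin d → ℝ)))),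
      ← (reflectPair_involutive hab).comp_self, ← Measure.map_map hm hm, hc, Measure.map_smul, hc,
      smul_smul]
  have h3 : (c * c : NNReal) = 1 := by
    have h4 := congrArg (fun μ => μ (Metric.ball 0 1)) h2
    simp only [Measure.smul_apply] at h4
    have hp : (volume : Measure ((Fin d → ℝ) × (Fin d → ℝ))) (Metric.ball 0 1) ≠ 0 :=
      (Metric.measure_ball_pos _ _ one_pos).ne'
    have ht : (volume : Measure ((Fin d → ℝ) × (Fin d → ℝ))) (Metric.ball 0 1) ≠ ∞ :=
      measure_ball_lt_top.ne
    rw [ENNReal.smul_def, smul_eq_mul] at h4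
    have h5 := (ENNReal.mul_eq_right hp ht).1 h4.symm
    exact_mod_cast h5
  have hc1 : c = 1 := by
    have : c ^ 2 = 1 := by rw [sq, h3]
    exact (pow_eq_one_iff_of_nonneg zero_le two_ne_zero).1 this
  rw [hc, hc1, one_smul]

theorem gauss_mul_gauss_reflectPair {a b : ℝ} (hab : a ^ 2 + b ^ 2 = 1)
    {V : Matrix (Fin d) (Fin d) ℝ} (hV : V.PosDef) (x : (Fin d → ℝ) × (Fin d → ℝ)) :
    gauss V (reflectPair a b x).1 * gauss V (reflectPair a b x).2 = gauss V x.1 * gauss V x.2 := by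
  have hD := det_two_pi_smul_pos hV
  unfold gauss
  rw [← ENNReal.ofReal_mul (normalDensity_pos hV _).le, ← ENNReal.ofReal_mul (normalDensity_pos hV _).le]
  congr 1
  unfold normalDensity
  rw [mul_mul_mul_comm, mul_mul_mul_comm _ _ _ (Real.exp (-(1 / 2) * ((x.2 - 0) ⬝ᵥ _))),
    ← Real.exp_add, ← Real.exp_add]
  congr 2
  simp only [sub_zero, reflectPair, LinearMap.coe_mk, AddHom.coe_mk, mulVec_add, mulVec_sub,
    mulVec_smul, add_dotProduct, sub_dotProduct, dotProduct_add, dotProduct_sub, smul_dotProduct,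
    dotProduct_smul, smul_eq_mul]
  linear_combination (-(1 / 2) * (x.1 ⬝ᵥ (V⁻¹ *ᵥ x.1) + x.2 ⬝ᵥ (V⁻¹ *ᵥ x.2))) * hab

theorem map_mixLaw_reflectPair (hπ : IsCovarianceLaw π) {a b : ℝ} (hab : a ^ 2 + b ^ 2 = 1) :
    (mixLaw π).map (fun p => (p.1, reflectPair a b p.2)) = mixLaw π := by
  have := hπ.prob
  have hm := measurable_reflectPair (d := d) a b
  refine Measure.ext_of_lintegral _ fun h hh => ?_
  rw [lintegral_map hh (by fun_prop), lintegral_mixLaw hh,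
    lintegral_mixLaw (h := fun p => h (p.1, reflectPair a b p.2)) (by fun_prop)]
  refine lintegral_congr_ae ?_
  filter_upwards [hπ.posDef] with V hV
  have hg := measurable_gauss_left V
  rw [← (measurePreserving_reflectPair hab).lintegral_comp
    (f := fun x => gauss V x.1 * gauss V x.2 * h (V, x)) (by fun_prop)]
  refine lintegral_congr fun x => ?_
  rw [gauss_mul_gauss_reflectPair hab hV]

/-- Given V, the law of (e, f) is invariant under the reflection, whose first component is this
combination. Mixing over V preserves the identity. -/
theorem map_mixLaw_combination (hπ : IsCovarianceLaw π) {a b : ℝ} (hab : a ^ 2 + b ^ 2 = 1) :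
    (mixLaw π).map (fun p => a • p.2.1 + b • p.2.2) = volume.withDensity (mixDensity π) := by
  have hm := measurable_reflectPair (d := d) a b
  rw [← map_mixLaw_noise hπ]
  conv_rhs => rw [← map_mixLaw_reflectPair hπ hab]
  rw [Measure.map_map]
  · rfl
  · fun_prop
  · fun_prop

end Mixture

/-! ### Integrability and bounds for the mixture log-densities -/

section Mixture

variable {d : ℕ} {π : Measure (Matrix (Fin d) (Fin d) ℝ)}

theorem ae_posDef_mixLaw (hπ : IsCovarianceLaw π) : ∀ᵐ p ∂(mixLaw π), p.1.PosDef := by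
  have h := hπ.posDef
  rw [← map_mixLaw_fst hπ] at h
  exact ae_of_ae_map measurable_fst.aemeasurable h

theorem integrable_comp_fst_mixLaw (hπ : IsCovarianceLaw π) {g : Matrix (Fin d) (Fin d) ℝ → ℝ}
    (hg : Integrable g π) : Integrable (fun p => g p.1) (mixLaw π) := by
  rw [← map_mixLaw_fst hπ] at hg
  exact hg.comp_measurable measurable_fst

theorem integrable_quadForm_mixLaw (hπ : IsCovarianceLaw π) :
    Integrable (fun p => p.2.1 ⬝ᵥ (p.1⁻¹ *ᵥ p.2.1)) (mixLaw π) := by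
  have := hπ.prob
  have hm : Measurable fun p : Matrix (Fin d) (Fin d) ℝ × ((Fin d → ℝ) × (Fin d → ℝ)) =>
      p.2.1 ⬝ᵥ (p.1⁻¹ *ᵥ p.2.1) :=
    measurable_quadForm_inv.comp (measurable_fst.prodMk measurable_snd.fst)
  refine ⟨hm.aestronglyMeasurable, ?_⟩
  rw [hasFiniteIntegral_iff_ofReal]
  · rw [lintegral_mixLaw_fst_snd hπ (h := fun p => ENNReal.ofReal (p.2 ⬝ᵥ (p.1⁻¹ *ᵥ p.2)))
      measurable_quadForm_inv.ennreal_ofReal]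
    calc _ ≤ ∫⁻ _, ENNReal.ofReal (4 * (2 ^ d : ℝ) ^ (1 / 2 : ℝ)) ∂π := by
          refine lintegral_mono_ae ?_
          filter_upwards [hπ.posDef] with V hV
          exact lintegral_gauss_mul_quadForm_le hV
      _ < ∞ := by rw [lintegral_const, measure_univ, mul_one]; exact ENNReal.ofReal_lt_top
  · filter_upwards [ae_posDef_mixLaw hπ] with p hp
    exact quadForm_inv_nonneg hp _

theorem integrable_log_normalDensity_mixLaw (hπ : IsCovarianceLaw π) :
    Integrable (fun p => Real.log (normalDensity 0 p.1 p.2.1)) (mixLaw π) := by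
  have := isProbabilityMeasure_mixLaw hπ
  have h := ((integrable_const (-(1 / 2) * (d * Real.log (2 * Real.pi)))).sub
    ((integrable_comp_fst_mixLaw hπ hπ.log_det).const_mul (1 / 2))).sub
    ((integrable_quadForm_mixLaw hπ).const_mul (1 / 2))
  refine h.congr ?_
  filter_upwards [ae_posDef_mixLaw hπ] with p hp
  rw [log_normalDensity hp]
  rfl

theorem integrable_log_one_add_norm_fst_mixLaw (hπ : IsCovarianceLaw π) :
    Integrable (fun p => Real.log (1 + ‖p.2.1‖)) (mixLaw π) := by
  have := isProbabilityMeasure_mixLaw hπ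
  have h := ((integrable_const (Real.log 2)).add
    ((integrable_comp_fst_mixLaw hπ hπ.log_det).add
      (integrable_comp_fst_mixLaw hπ hπ.trace_inv))).add (integrable_quadForm_mixLaw hπ)
  refine h.mono' (Measurable.aestronglyMeasurable (by fun_prop)) ?_
  filter_upwards [ae_posDef_mixLaw hπ] with p hp
  rw [Real.norm_of_nonneg (Real.log_nonneg (by linarith [norm_nonneg p.2.1]))]
  exact log_one_add_norm_le hp p.2.1

theorem integrable_log_one_add_norm_snd_mixLaw (hπ : IsCovarianceLaw π) :
    Integrable (fun p => Real.log (1 + ‖p.2.2‖)) (mixLaw π) := by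
  have h := integrable_log_one_add_norm_fst_mixLaw hπ
  have hm := measurable_reflectPair (d := d) 0 1
  -- With a = 0 and b = 1 the reflection exchanges e and f.
  rw [← map_mixLaw_reflectPair hπ (show (0 : ℝ) ^ 2 + 1 ^ 2 = 1 by norm_num)] at h
  have h' := h.comp_measurable (f := fun p : Matrix (Fin d) (Fin d) ℝ × _ =>
    (p.1, reflectPair 0 1 p.2)) (by fun_prop)
  refine h'.congr (Filter.Eventually.of_forall fun p => ?_)
  simp [reflectPair]

theorem lintegral_one_add_det_inv_ne_top (hπ : IsCovarianceLaw π) :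
    ∫⁻ V, ENNReal.ofReal (1 + V.det⁻¹) ∂π ≠ ∞ := by
  have := hπ.prob
  have h := (integrable_const (1 : ℝ)).add hπ.det_inv
  exact h.lintegral_lt_top.ne

theorem lintegral_ne_zero_of_posDef (hπ : IsCovarianceLaw π)
    {g : Matrix (Fin d) (Fin d) ℝ → ℝ≥0∞} (hg : Measurable g) (h : ∀ V, V.PosDef → g V ≠ 0) :
    ∫⁻ V, g V ∂π ≠ 0 := by
  have := hπ.prob
  rw [ne_eq, lintegral_eq_zero_iff hg]
  intro h0
  obtain ⟨V, hV, hV'⟩ := (hπ.posDef.and h0).exists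
  exact h V hV hV'

theorem gauss_ne_zero {V : Matrix (Fin d) (Fin d) ℝ} (hV : V.PosDef) (e : Fin d → ℝ) :
    gauss V e ≠ 0 := by
  rw [gauss, ne_eq, ENNReal.ofReal_eq_zero, not_le]
  exact normalDensity_pos hV e

theorem mixDensity_ne_zero (hπ : IsCovarianceLaw π) (e : Fin d → ℝ) : mixDensity π e ≠ 0 :=
  lintegral_ne_zero_of_posDef hπ (measurable_gauss_right e) fun _ hV => gauss_ne_zero hV e

theorem mixDensityPair_ne_zero (hπ : IsCovarianceLaw π) (x : (Fin d → ℝ) × (Fin d → ℝ)) :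
    mixDensityPair π x ≠ 0 :=
  lintegral_ne_zero_of_posDef hπ ((measurable_gauss_right x.1).mul (measurable_gauss_right x.2))
    fun _ hV => mul_ne_zero (gauss_ne_zero hV _) (gauss_ne_zero hV _)

theorem mixDensity_le (hπ : IsCovarianceLaw π) (e : Fin d → ℝ) :
    mixDensity π e ≤ ∫⁻ V, ENNReal.ofReal (1 + V.det⁻¹) ∂π := by
  refine lintegral_mono_ae ?_
  filter_upwards [hπ.posDef] with V hV using gauss_le hV e

theorem mixDensityPair_le (hπ : IsCovarianceLaw π) (x : (Fin d → ℝ) × (Fin d → ℝ)) :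
    mixDensityPair π x ≤ ∫⁻ V, ENNReal.ofReal (1 + V.det⁻¹) ∂π := by
  refine lintegral_mono_ae ?_
  filter_upwards [hπ.posDef] with V hV using gauss_mul_gauss_le hV _ _

theorem mixDensity_ne_top (hπ : IsCovarianceLaw π) (e : Fin d → ℝ) : mixDensity π e ≠ ∞ :=
  ne_top_of_le_ne_top (lintegral_one_add_det_inv_ne_top hπ) (mixDensity_le hπ e)

theorem mixDensityPair_ne_top (hπ : IsCovarianceLaw π) (x : (Fin d → ℝ) × (Fin d → ℝ)) :
    mixDensityPair π x ≠ ∞ :=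
  ne_top_of_le_ne_top (lintegral_one_add_det_inv_ne_top hπ) (mixDensityPair_le hπ x)

theorem isProbabilityMeasure_mixDensity (hπ : IsCovarianceLaw π) :
    IsProbabilityMeasure ((volume : Measure (Fin d → ℝ)).withDensity (mixDensity π)) := by
  have := isProbabilityMeasure_mixLaw hπ
  rw [← map_mixLaw_noise hπ]
  exact Measure.isProbabilityMeasure_map (by fun_prop)

theorem integrable_log_mixDensity (hπ : IsCovarianceLaw π) :
    Integrable (fun e => Real.log (mixDensity π e).toReal)
      ((volume : Measure (Fin d → ℝ)).withDensity (mixDensity π)) := by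
  have := hπ.prob
  have hP := isProbabilityMeasure_mixDensity hπ
  refine integrable_log_density measurable_mixDensity (mixDensity_ne_zero hπ)
    (lintegral_one_add_det_inv_ne_top hπ) (mixDensity_le hπ) ?_ ?_
  · have := measure_ne_top ((volume : Measure (Fin d → ℝ)).withDensity (mixDensity π)) Set.univ
    rwa [withDensity_apply _ MeasurableSet.univ, Measure.restrict_univ] at this
  · rw [← map_mixLaw_noise hπ, integrable_map_measure
      (Measurable.aestronglyMeasurable (by fun_prop)) (by fun_prop)]
    exact integrable_log_one_add_norm_fst_mixLaw hπ

theorem integrable_log_mixDensityPair (hπ : IsCovarianceLaw π) :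
    Integrable (fun x => Real.log (mixDensityPair π x).toReal)
      ((volume : Measure ((Fin d → ℝ) × (Fin d → ℝ))).withDensity (mixDensityPair π)) := by
  have := hπ.prob
  have := isProbabilityMeasure_mixLaw hπ
  have := isAddHaarMeasure_volume_pair d
  have hP : IsProbabilityMeasure
      ((volume : Measure ((Fin d → ℝ) × (Fin d → ℝ))).withDensity (mixDensityPair π)) := by
    rw [← map_mixLaw_snd]
    exact Measure.isProbabilityMeasure_map (by fun_prop)
  refine integrable_log_density measurable_mixDensityPair (mixDensityPair_ne_zero hπ)
    (lintegral_one_add_det_inv_ne_top hπ) (mixDensityPair_le hπ) ?_ ?_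
  · have := measure_ne_top
      ((volume : Measure ((Fin d → ℝ) × (Fin d → ℝ))).withDensity (mixDensityPair π)) Set.univ
    rwa [withDensity_apply _ MeasurableSet.univ, Measure.restrict_univ] at this
  · rw [← map_mixLaw_snd, integrable_map_measure
      (Measurable.aestronglyMeasurable (by fun_prop)) (by fun_prop)]
    refine ((integrable_log_one_add_norm_fst_mixLaw hπ).add
      (integrable_log_one_add_norm_snd_mixLaw hπ)).mono'
      (Measurable.aestronglyMeasurable (by fun_prop)) (Filter.Eventually.of_forall fun p => ?_)
    have h1 := norm_nonneg p.2.1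
    have h2 := norm_nonneg p.2.2
    have h3 := Real.log_nonneg (show 1 ≤ 1 + ‖p.2.1‖ by linarith)
    have h4 := Real.log_nonneg (show 1 ≤ 1 + ‖p.2.2‖ by linarith)
    simp only [Function.comp, Pi.add_apply]
    rw [Real.norm_of_nonneg (Real.log_nonneg (by linarith [norm_nonneg p.2])), Prod.norm_def]
    rcases max_choice ‖p.2.1‖ ‖p.2.2‖ with h | h <;> rw [h] <;> linarith

end Mixture

/-! ### Information carried by the output of a normal channel -/

section Channel

variable {d : ℕ} {π : Measure (Matrix (Fin d) (Fin d) ℝ)} {Θ : Type} [MeasurableSpace Θ]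
  {ρ : Measure Θ} {Vf : Θ → Matrix (Fin d) (Fin d) ℝ} {f : Θ → Fin d → ℝ}

/-- The joint law of a parameter and a centred normal noise whose covariance is a function of the
parameter. -/
noncomputable def noisyLaw (ρ : Measure Θ) (Vf : Θ → Matrix (Fin d) (Fin d) ℝ) :
    Measure (Θ × (Fin d → ℝ)) :=
  (ρ.prod volume).withDensity fun ω => gauss (Vf ω.1) ω.2

/-- Expected conditional log-density of the noise. -/
noncomputable def meanLogNormal (π : Measure (Matrix (Fin d) (Fin d) ℝ)) : ℝ :=
  ∫ p, Real.log (normalDensity 0 p.1 p.2.1) ∂(mixLaw π)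

/-- Expected log-density of the noise. -/
noncomputable def meanLogMix (π : Measure (Matrix (Fin d) (Fin d) ℝ)) : ℝ :=
  ∫ e, Real.log (mixDensity π e).toReal ∂(volume.withDensity (mixDensity π))

/-- Expected joint log-density of two conditionally independent noises. -/
noncomputable def meanLogMixPair (π : Measure (Matrix (Fin d) (Fin d) ℝ)) : ℝ :=
  ∫ x, Real.log (mixDensityPair π x).toReal ∂(volume.withDensity (mixDensityPair π))

theorem measurable_gauss_channel (hV : Measurable Vf) :
    Measurable fun ω : Θ × (Fin d → ℝ) => gauss (Vf ω.1) ω.2 :=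
  measurable_gauss_comp (hV.comp measurable_fst) measurable_snd

/-- The assumption on f says that V has law π and f is N(0, V) given V. The noise e depends on θ
only through V, so e and f are conditionally independent given V, and all later integrals can be
computed under one κ-free law. -/
theorem map_noisyLaw [SFinite ρ] (hπ : IsCovarianceLaw π) (hV : Measurable Vf) (hf : Measurable f)
    (hlaw : ρ.map (fun θ => (Vf θ, f θ)) = (π.prod volume).withDensity fun p => gauss p.1 p.2) :
    (noisyLaw ρ Vf).map (fun ω => (Vf ω.1, (ω.2, f ω.1))) = mixLaw π := by
  have := hπ.prob
  refine Measure.ext_of_lintegral _ fun h hh => ?_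
  have hT : Measurable fun ω : Θ × (Fin d → ℝ) => (Vf ω.1, (ω.2, f ω.1)) := by fun_prop
  set H : Matrix (Fin d) (Fin d) ℝ × (Fin d → ℝ) → ℝ≥0∞ :=
    fun p => ∫⁻ e, gauss p.1 e * h (p.1, (e, p.2)) with hH
  have hHm' : Measurable fun q : (Matrix (Fin d) (Fin d) ℝ × (Fin d → ℝ)) × (Fin d → ℝ) =>
      gauss q.1.1 q.2 * h (q.1.1, (q.2, q.1.2)) :=
    (measurable_gauss_comp measurable_fst.fst measurable_snd).mul (by fun_prop)
  have hHm : Measurable H := hHm'.lintegral_prod_right'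
  have hhT : Measurable fun ω : Θ × (Fin d → ℝ) => h (Vf ω.1, (ω.2, f ω.1)) := hh.comp hT
  rw [lintegral_map hh hT, noisyLaw,
    lintegral_withDensity_eq_lintegral_mul _ (measurable_gauss_channel hV) hhT,
    lintegral_prod _ ((measurable_gauss_channel hV).mul hhT).aemeasurable]
  have h1 : ∫⁻ θ, H (Vf θ, f θ) ∂ρ = ∫⁻ p, H p ∂(ρ.map fun θ => (Vf θ, f θ)) := by
    rw [lintegral_map hHm (by fun_prop)]
  refine h1.trans ?_
  rw [hlaw, lintegral_withDensity_eq_lintegral_mul _ measurable_gauss hHm, lintegral_mixLaw hh,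
    lintegral_prod _ (measurable_gauss.mul hHm).aemeasurable]
  refine lintegral_congr fun V => ?_
  have hg := measurable_gauss_left V
  rw [Measure.volume_eq_prod, lintegral_prod_symm _ (by fun_prop)]
  refine lintegral_congr fun x => ?_
  simp only [Pi.mul_apply, hH]
  rw [← lintegral_const_mul _ (by fun_prop)]
  refine lintegral_congr fun e => ?_
  ring

theorem ae_posDef_of_law (hπ : IsCovarianceLaw π) (hV : Measurable Vf) (hf : Measurable f)
    (hlaw : ρ.map (fun θ => (Vf θ, f θ)) = (π.prod volume).withDensity fun p => gauss p.1 p.2) :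
    ∀ᵐ θ ∂ρ, (Vf θ).PosDef := by
  have := hπ.prob
  have h1 : ∀ᵐ p ∂((π.prod (volume : Measure (Fin d → ℝ))).withDensity fun p => gauss p.1 p.2),
      p.1.PosDef :=
    (withDensity_absolutelyContinuous _ _).ae_le
      (Measure.quasiMeasurePreserving_fst.ae hπ.posDef)
  rw [← hlaw] at h1
  exact ae_of_ae_map (hV.prodMk hf).aemeasurable h1

theorem map_noisyLaw_fst [SFinite ρ] (hV : Measurable Vf) (hpd : ∀ᵐ θ ∂ρ, (Vf θ).PosDef) :
    (noisyLaw ρ Vf).map Prod.fst = ρ := by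
  refine Measure.ext_of_lintegral _ fun h hh => ?_
  rw [lintegral_map hh measurable_fst, noisyLaw, lintegral_withDensity_eq_lintegral_mul _
    (measurable_gauss_channel hV) (g := fun ω => h ω.1) (by fun_prop),
    lintegral_prod _ ((measurable_gauss_channel hV).mul (by fun_prop)).aemeasurable]
  refine lintegral_congr_ae ?_
  filter_upwards [hpd] with θ hθ
  simp only [Pi.mul_apply]
  rw [lintegral_mul_const _ (measurable_gauss_left _), lintegral_gauss hθ, one_mul]

theorem isProbabilityMeasure_noisyLaw [IsProbabilityMeasure ρ] (hV : Measurable Vf)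
    (hpd : ∀ᵐ θ ∂ρ, (Vf θ).PosDef) : IsProbabilityMeasure (noisyLaw ρ Vf) := by
  constructor
  have h := congrArg (fun μ => μ Set.univ) (map_noisyLaw_fst hV hpd)
  simpa [Measure.map_apply measurable_fst] using h

end Channel

/-! ### Closed forms of the two mutual informations -/

section Channel

variable {d : ℕ} {π : Measure (Matrix (Fin d) (Fin d) ℝ)} {Θ : Type} [MeasurableSpace Θ]
  {ρ : Measure Θ} {Vf : Θ → Matrix (Fin d) (Fin d) ℝ} {f : Θ → Fin d → ℝ}

/-- Mutual information in terms of the density `k` of the joint law and the densities of the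
marginals with respect to `τ` and Lebesgue measure. -/
theorem mutualInfo_eq_of_density {Ω α : Type} [MeasurableSpace Ω] [MeasurableSpace α]
    {P : Measure Ω} [IsProbabilityMeasure P] {X : Ω → α} {Z : Ω → Fin d → ℝ} (hX : Measurable X)
    (hZ : Measurable Z) {τ : Measure α} [SFinite τ] {k : α × (Fin d → ℝ) → ℝ≥0∞}
    {mX : α → ℝ≥0∞} {mZ : (Fin d → ℝ) → ℝ≥0∞} (hk : Measurable k) (hmX : Measurable mX)
    (hmZ : Measurable mZ) (hmX0 : ∀ x, mX x ≠ 0) (hmXt : ∀ x, mX x ≠ ∞) (hmZ0 : ∀ z, mZ z ≠ 0)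
    (hmZt : ∀ z, mZ z ≠ ∞)
    (hlX : P.map X = τ.withDensity mX) (hlZ : P.map Z = volume.withDensity mZ)
    (hl : P.map (fun ω => (X ω, Z ω)) = (τ.prod volume).withDensity k) {L : Ω → ℝ}
    (hL : ∀ᵐ ω ∂P, Real.log (k (X ω, Z ω) / (mX (X ω) * mZ (Z ω))).toReal = L ω)
    (hLint : Integrable L P) :
    mutualInfo P X Z = ENNReal.ofReal (∫ ω, L ω ∂P) ∧ 0 ≤ ∫ ω, L ω ∂P := by
  have := Measure.isProbabilityMeasure_map (μ := P) hX.aemeasurable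
  have := Measure.isProbabilityMeasure_map (μ := P) hZ.aemeasurable
  have := Measure.isProbabilityMeasure_map (μ := P) (hX.prodMk hZ).aemeasurable
  have hm : Measurable fun p : α × (Fin d → ℝ) => mX p.1 * mZ p.2 := by fun_prop
  have hF : Measurable fun p : α × (Fin d → ℝ) => k p / (mX p.1 * mZ p.2) := hk.div hm
  -- The joint law has density k / (mX mZ) with respect to the product of the marginals, the
  -- quotient being legitimate because both marginal densities are everywhere positive and finite.
  have hdens : P.map (fun ω => (X ω, Z ω)) = ((P.map X).prod (P.map Z)).withDensity
      fun p => k p / (mX p.1 * mZ p.2) := by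
    rw [hl, hlX, hlZ, prod_withDensity hmX hmZ, ← withDensity_mul _ hm hF]
    congr 1
    ext p
    exact (ENNReal.mul_div_cancel (mul_ne_zero (hmX0 _) (hmZ0 _))
      (ENNReal.mul_ne_top (hmXt _) (hmZt _))).symm
  have hlogm : Measurable fun p => Real.log (k p / (mX p.1 * mZ p.2)).toReal :=
    hF.ennreal_toReal.log
  have hint : Integrable (fun p => Real.log (k p / (mX p.1 * mZ p.2)).toReal)
      (P.map fun ω => (X ω, Z ω)) := by
    rw [integrable_map_measure hlogm.aestronglyMeasurable (hX.prodMk hZ).aemeasurable]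
    refine hLint.congr ?_
    filter_upwards [hL] with ω hω using hω.symm
  have hval : ∫ p, Real.log (k p / (mX p.1 * mZ p.2)).toReal ∂(P.map fun ω => (X ω, Z ω)) =
      ∫ ω, L ω ∂P := by
    rw [integral_map (hX.prodMk hZ).aemeasurable hlogm.aestronglyMeasurable]
    exact integral_congr_ae hL
  have h := klDiv_withDensity hF hdens hint
  rw [hval] at h
  exact h

variable {κ : ℝ}

/-- The coefficients 1/√(1+κ) and √κ/√(1+κ) have squares summing to one, so normalization removes κ
from the law of the output. -/
theorem map_noisyLaw_output [SFinite ρ] (hπ : IsCovarianceLaw π) (hV : Measurable Vf)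
    (hf : Measurable f)
    (hlaw : ρ.map (fun θ => (Vf θ, f θ)) = (π.prod volume).withDensity fun p => gauss p.1 p.2)
    (hκ : 0 ≤ κ) :
    (noisyLaw ρ Vf).map (fun ω => (√(1 + κ))⁻¹ • ω.2 + ((√(1 + κ))⁻¹ * √κ) • f ω.1) =
      volume.withDensity (mixDensity π) := by
  have hs : √(1 + κ) ^ 2 = 1 + κ := Real.sq_sqrt (by positivity)
  have hk : √κ ^ 2 = κ := Real.sq_sqrt hκ
  have hab : (√(1 + κ))⁻¹ ^ 2 + ((√(1 + κ))⁻¹ * √κ) ^ 2 = 1 := by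
    rw [mul_pow, inv_pow, hs, hk]; field_simp
  rw [← map_mixLaw_combination hπ hab, ← map_noisyLaw hπ hV hf hlaw,
    Measure.map_map (by fun_prop) (by fun_prop)]
  rfl

theorem integrable_comp_noisyLaw [SFinite ρ] (hπ : IsCovarianceLaw π) (hV : Measurable Vf)
    (hf : Measurable f)
    (hlaw : ρ.map (fun θ => (Vf θ, f θ)) = (π.prod volume).withDensity fun p => gauss p.1 p.2) :
    (Integrable (fun ω => Real.log (normalDensity 0 (Vf ω.1) ω.2)) (noisyLaw ρ Vf) ∧
      ∫ ω, Real.log (normalDensity 0 (Vf ω.1) ω.2) ∂(noisyLaw ρ Vf) = meanLogNormal π) ∧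
    (Integrable (fun ω => Real.log (mixDensityPair π (ω.2, f ω.1)).toReal) (noisyLaw ρ Vf) ∧
      ∫ ω, Real.log (mixDensityPair π (ω.2, f ω.1)).toReal ∂(noisyLaw ρ Vf) =
        meanLogMixPair π) := by
  have := hπ.prob
  have hT : Measurable fun ω : Θ × (Fin d → ℝ) => (Vf ω.1, (ω.2, f ω.1)) := by fun_prop
  have hmap := map_noisyLaw hπ hV hf hlaw
  have h1 := integrable_log_normalDensity_mixLaw hπ
  have h2 := integrable_log_mixDensityPair hπ
  have hm1 : Measurable fun p : Matrix (Fin d) (Fin d) ℝ × ((Fin d → ℝ) × (Fin d → ℝ)) =>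
      Real.log (normalDensity 0 p.1 p.2.1) :=
    (measurable_normalDensity.comp (measurable_fst.prodMk measurable_snd.fst)).log
  have hm2 : Measurable fun x : (Fin d → ℝ) × (Fin d → ℝ) =>
      Real.log (mixDensityPair π x).toReal := measurable_mixDensityPair.ennreal_toReal.log
  have hmap2 : (noisyLaw ρ Vf).map (fun ω => (ω.2, f ω.1)) =
      volume.withDensity (mixDensityPair π) := by
    rw [← map_mixLaw_snd, ← hmap, Measure.map_map (by fun_prop) hT]; rfl
  refine ⟨⟨?_, ?_⟩, ?_, ?_⟩
  · rw [← hmap] at h1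
    exact h1.comp_measurable hT
  · rw [meanLogNormal, ← hmap, integral_map hT.aemeasurable hm1.aestronglyMeasurable]
  · rw [← hmap2] at h2
    exact h2.comp_measurable (by fun_prop)
  · rw [meanLogMixPair, ← hmap2, integral_map (by fun_prop) hm2.aestronglyMeasurable]

theorem integrable_log_mixDensity_comp {Ω : Type} [MeasurableSpace Ω] {P : Measure Ω}
    (hπ : IsCovarianceLaw π) {Z : Ω → Fin d → ℝ} (hZ : Measurable Z)
    (hlZ : P.map Z = volume.withDensity (mixDensity π)) :
    Integrable (fun ω => Real.log (mixDensity π (Z ω)).toReal) P ∧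
      ∫ ω, Real.log (mixDensity π (Z ω)).toReal ∂P = meanLogMix π := by
  have := hπ.prob
  have hm : Measurable fun x => Real.log (mixDensity π x).toReal :=
    measurable_mixDensity.ennreal_toReal.log
  have h := integrable_log_mixDensity hπ
  constructor
  · rw [← hlZ] at h
    exact h.comp_measurable hZ
  · rw [meanLogMix, ← hlZ, integral_map hZ.aemeasurable hm.aestronglyMeasurable]

/-- Given θ the normalized output is a shifted copy of e scaled by 1/s, where s = √(1+κ). The
Jacobian s^d is the only place where κ survives, the output marginal being free of it. -/
theorem mutualInfo_param_eq [IsProbabilityMeasure ρ] (hπ : IsCovarianceLaw π) (hV : Measurable Vf)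
    (hf : Measurable f)
    (hlaw : ρ.map (fun θ => (Vf θ, f θ)) = (π.prod volume).withDensity fun p => gauss p.1 p.2)
    (hκ : 0 ≤ κ) :
    mutualInfo (noisyLaw ρ Vf) (fun ω => ω.1)
        (fun ω => (√(1 + κ))⁻¹ • ω.2 + ((√(1 + κ))⁻¹ * √κ) • f ω.1) =
      ENNReal.ofReal (d * Real.log √(1 + κ) + (meanLogNormal π - meanLogMix π)) ∧
    0 ≤ d * Real.log √(1 + κ) + (meanLogNormal π - meanLogMix π) := by
  have := hπ.prob
  have hpd := ae_posDef_of_law hπ hV hf hlaw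
  have := isProbabilityMeasure_noisyLaw hV hpd
  set s := √(1 + κ) with hs
  have hs0 : 0 < s := Real.sqrt_pos.2 (by positivity)
  have hZ : Measurable fun ω : Θ × (Fin d → ℝ) => s⁻¹ • ω.2 + (s⁻¹ * √κ) • f ω.1 := by fun_prop
  have hlZ := map_noisyLaw_output hπ hV hf hlaw hκ
  have hl := map_withDensity_prod_smul_add ρ (measurable_gauss_channel hV) (inv_pos.2 hs0)
    (a := fun θ => (s⁻¹ * √κ) • f θ) (by fun_prop)
  have hk : Measurable fun p : Θ × (Fin d → ℝ) => ENNReal.ofReal (s⁻¹⁻¹ ^ d) *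
      gauss (Vf p.1) (s⁻¹⁻¹ • (p.2 - (s⁻¹ * √κ) • f p.1)) :=
    (measurable_gauss_comp (hV.comp measurable_fst) (by fun_prop)).const_mul _
  obtain ⟨⟨hi1, hv1⟩, -⟩ := integrable_comp_noisyLaw hπ hV hf hlaw
  obtain ⟨hi2, hv2⟩ := integrable_log_mixDensity_comp hπ hZ hlZ
  have hpdω : ∀ᵐ ω ∂(noisyLaw ρ Vf), (Vf ω.1).PosDef := by
    rw [← map_noisyLaw_fst hV hpd] at hpd
    exact ae_of_ae_map measurable_fst.aemeasurable hpd
  have hi0 : Integrable (fun ω => d * Real.log s + Real.log (normalDensity 0 (Vf ω.1) ω.2))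
      (noisyLaw ρ Vf) := (integrable_const _).add hi1
  have h := mutualInfo_eq_of_density (P := noisyLaw ρ Vf) (X := fun ω => ω.1) measurable_fst hZ hk
    (mX := fun _ => 1) measurable_const measurable_mixDensity (by simp) (by simp)
    (mixDensity_ne_zero hπ) (mixDensity_ne_top hπ)
    (by rw [withDensity_const, one_smul]; exact map_noisyLaw_fst hV hpd) hlZ hl
    (L := fun ω => d * Real.log s + Real.log (normalDensity 0 (Vf ω.1) ω.2) -
      Real.log (mixDensity π (s⁻¹ • ω.2 + (s⁻¹ * √κ) • f ω.1)).toReal) ?_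
    (hi0.sub hi2)
  · rw [integral_sub hi0 hi2, integral_add (integrable_const _) hi1, hv1,
      hv2, integral_const, probReal_univ, one_smul, add_sub_assoc] at h
    exact h
  · filter_upwards [hpdω] with ω hω
    have hN := normalDensity_pos (μ := 0) hω ω.2
    have hM : 0 < (mixDensity π (s⁻¹ • ω.2 + (s⁻¹ * √κ) • f ω.1)).toReal :=
      ENNReal.toReal_pos (mixDensity_ne_zero hπ _) (mixDensity_ne_top hπ _)
    rw [one_mul, add_sub_cancel_right, inv_inv, smul_smul, mul_inv_cancel₀ hs0.ne', one_smul, gauss,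
      ENNReal.toReal_div, ENNReal.toReal_mul, ENNReal.toReal_ofReal (by positivity),
      ENNReal.toReal_ofReal hN.le, Real.log_div (by positivity) hM.ne',
      Real.log_mul (by positivity) hN.ne', Real.log_pow]

/-- The pair (e, Z) is an affine image of (e, f) in which only f is rescaled, by √κ/s with s =
√(1+κ). Its Jacobian gives the logarithmic term, and both marginals are the same mixture law.
Positivity of κ makes the map invertible. -/
theorem mutualInfo_noise_eq [IsProbabilityMeasure ρ] (hπ : IsCovarianceLaw π) (hV : Measurable Vf)
    (hf : Measurable f)
    (hlaw : ρ.map (fun θ => (Vf θ, f θ)) = (π.prod volume).withDensity fun p => gauss p.1 p.2)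
    (hκ : 0 < κ) :
    mutualInfo (noisyLaw ρ Vf) (fun ω => ω.2)
        (fun ω => (√(1 + κ))⁻¹ • ω.2 + ((√(1 + κ))⁻¹ * √κ) • f ω.1) =
      ENNReal.ofReal (d * Real.log (√(1 + κ) / √κ) + (meanLogMixPair π - 2 * meanLogMix π)) ∧
    0 ≤ d * Real.log (√(1 + κ) / √κ) + (meanLogMixPair π - 2 * meanLogMix π) := by
  have := hπ.prob
  have hpd := ae_posDef_of_law hπ hV hf hlaw
  have := isProbabilityMeasure_noisyLaw hV hpd
  have hlZ := map_noisyLaw_output hπ hV hf hlaw hκ.le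
  set s := √(1 + κ) with hs
  have hs0 : 0 < s := Real.sqrt_pos.2 (by positivity)
  have hk0 : 0 < √κ := Real.sqrt_pos.2 hκ
  have hc0 : 0 < s⁻¹ * √κ := by positivity
  have hZ : Measurable fun ω : Θ × (Fin d → ℝ) => s⁻¹ • ω.2 + (s⁻¹ * √κ) • f ω.1 := by fun_prop
  have hT : Measurable fun ω : Θ × (Fin d → ℝ) => (Vf ω.1, (ω.2, f ω.1)) := by fun_prop
  have hmap := map_noisyLaw hπ hV hf hlaw
  have hlX : (noisyLaw ρ Vf).map (fun ω => ω.2) = volume.withDensity (mixDensity π) := by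
    rw [← map_mixLaw_noise hπ, ← hmap, Measure.map_map (by fun_prop) hT]; rfl
  have hmap2 : (noisyLaw ρ Vf).map (fun ω => (ω.2, f ω.1)) =
      ((volume : Measure (Fin d → ℝ)).prod volume).withDensity (mixDensityPair π) := by
    rw [← Measure.volume_eq_prod, ← map_mixLaw_snd, ← hmap, Measure.map_map (by fun_prop) hT]; rfl
  have hl := map_withDensity_prod_smul_add (volume : Measure (Fin d → ℝ))
    (measurable_mixDensityPair (π := π)) hc0 (a := fun e => s⁻¹ • e) (by fun_prop)
  rw [← hmap2, Measure.map_map (by fun_prop) (by fun_prop)] at hl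
  have hl' : (noisyLaw ρ Vf).map (fun ω => (ω.2, s⁻¹ • ω.2 + (s⁻¹ * √κ) • f ω.1)) =
      ((volume : Measure (Fin d → ℝ)).prod volume).withDensity fun p =>
        ENNReal.ofReal ((s⁻¹ * √κ)⁻¹ ^ d) *
          mixDensityPair π (p.1, (s⁻¹ * √κ)⁻¹ • (p.2 - s⁻¹ • p.1)) := by
    rw [← hl]
    congr 1
    ext1 ω
    simp only [Function.comp, add_comm]
  have hk : Measurable fun p : (Fin d → ℝ) × (Fin d → ℝ) => ENNReal.ofReal ((s⁻¹ * √κ)⁻¹ ^ d) *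
          mixDensityPair π (p.1, (s⁻¹ * √κ)⁻¹ • (p.2 - s⁻¹ • p.1)) :=
    (measurable_mixDensityPair.comp (by fun_prop)).const_mul _
  obtain ⟨-, hi1, hv1⟩ := integrable_comp_noisyLaw hπ hV hf hlaw
  obtain ⟨hi2, hv2⟩ := integrable_log_mixDensity_comp hπ hZ hlZ
  obtain ⟨hi3, hv3⟩ := integrable_log_mixDensity_comp hπ measurable_snd hlX
  have hi0 : Integrable (fun ω => d * Real.log (s / √κ) +
      Real.log (mixDensityPair π (ω.2, f ω.1)).toReal) (noisyLaw ρ Vf) :=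
    (integrable_const _).add hi1
  have hi4 : Integrable (fun ω => Real.log (mixDensity π ω.2).toReal +
      Real.log (mixDensity π (s⁻¹ • ω.2 + (s⁻¹ * √κ) • f ω.1)).toReal) (noisyLaw ρ Vf) :=
    hi3.add hi2
  have h := mutualInfo_eq_of_density (P := noisyLaw ρ Vf) (X := fun ω => ω.2) measurable_snd hZ hk
    measurable_mixDensity measurable_mixDensity (mixDensity_ne_zero hπ) (mixDensity_ne_top hπ)
    (mixDensity_ne_zero hπ) (mixDensity_ne_top hπ) hlX hlZ hl'
    (L := fun ω => d * Real.log (s / √κ) + Real.log (mixDensityPair π (ω.2, f ω.1)).toReal -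
      (Real.log (mixDensity π ω.2).toReal +
      Real.log (mixDensity π (s⁻¹ • ω.2 + (s⁻¹ * √κ) • f ω.1)).toReal))
    (Filter.Eventually.of_forall fun ω => ?_)
    (hi0.sub hi4)
  · rw [integral_sub hi0 hi4,
      integral_add (integrable_const _) hi1, integral_add hi3 hi2, hv1,
      hv2, hv3, integral_const, probReal_univ, one_smul, add_sub_assoc, ← two_mul] at h
    exact h
  · have hp : 0 < (mixDensityPair π (ω.2, f ω.1)).toReal :=
      ENNReal.toReal_pos (mixDensityPair_ne_zero hπ _) (mixDensityPair_ne_top hπ _)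
    have hM : ∀ z, 0 < (mixDensity π z).toReal := fun z =>
      ENNReal.toReal_pos (mixDensity_ne_zero hπ _) (mixDensity_ne_top hπ _)
    have hc1 : (s⁻¹ * √κ)⁻¹ = s / √κ := by field_simp
    rw [add_sub_cancel_left, smul_smul, inv_mul_cancel₀ hc0.ne', one_smul, hc1,
      ENNReal.toReal_div, ENNReal.toReal_mul, ENNReal.toReal_mul,
      ENNReal.toReal_ofReal (by positivity), Real.log_div (by positivity)
        (mul_pos (hM _) (hM _)).ne', Real.log_mul (by positivity) hp.ne',
      Real.log_mul (hM _).ne' (hM _).ne', Real.log_pow]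

theorem mutualInfo_noise_self_eq_top [IsProbabilityMeasure ρ] (hd : 0 < d) (hπ : IsCovarianceLaw π)
    (hV : Measurable Vf) (hf : Measurable f)
    (hlaw : ρ.map (fun θ => (Vf θ, f θ)) = (π.prod volume).withDensity fun p => gauss p.1 p.2) :
    mutualInfo (noisyLaw ρ Vf) (fun ω => ω.2) (fun ω => ω.2) = ∞ := by
  have hpd := ae_posDef_of_law hπ hV hf hlaw
  have := isProbabilityMeasure_noisyLaw hV hpd
  have hlX : (noisyLaw ρ Vf).map (fun ω => ω.2) = volume.withDensity (mixDensity π) := by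
    rw [← map_mixLaw_noise hπ, ← map_noisyLaw hπ hV hf hlaw,
      Measure.map_map (by fun_prop) (by fun_prop)]; rfl
  have : Nonempty (Fin d) := ⟨⟨0, hd⟩⟩
  refine mutualInfo_self_eq_top _ measurable_snd fun x => ?_
  rw [hlX]
  exact withDensity_absolutelyContinuous _ _ (measure_singleton x)

end Channel

/-! ### Conjugacy -/

section Conjugacy

variable {m ι : Type} [Fintype m] [Fintype ι]

theorem posSemidef_vecMulVec_self {n : Type} [Finite n] (x : n → ℝ) : (vecMulVec x x).PosSemidef := by
  simpa using posSemidef_vecMulVec_self_star x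

/-- Completing the square for one observation. -/
theorem exists_complete_square [DecidableEq ι] {M : Matrix m ι ℝ} {K : Matrix ι ι ℝ} (hK : K.PosDef)
    (x : ι → ℝ) (y : m → ℝ) :
    ∃ (M' : Matrix m ι ℝ) (R : Matrix m m ℝ), R.PosSemidef ∧ ∀ A : Matrix m ι ℝ,
      (A - M) * K * (A - M)ᵀ + vecMulVec (y - A *ᵥ x) (y - A *ᵥ x) =
        (A - M') * (K + vecMulVec x x) * (A - M')ᵀ + R := by
  have hK' : (K + vecMulVec x x).PosDef := hK.add_posSemidef (posSemidef_vecMulVec_self x)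
  have hu : IsUnit (K + vecMulVec x x).det := isUnit_iff_ne_zero.2 hK'.det_pos.ne'
  have hKt : Kᵀ = K := by
    rw [← conjTranspose_eq_transpose_of_trivial]; exact hK.1.eq
  -- The posterior mean: M' is determined by M' (K + x xᵀ) = M K + y xᵀ.
  set M' := (M * K + vecMulVec y x) * (K + vecMulVec x x)⁻¹ with hM'
  have h1 : M' * (K + vecMulVec x x) = M * K + vecMulVec y x := by
    rw [hM', Matrix.mul_assoc, nonsing_inv_mul _ hu, Matrix.mul_one]
  set v := y - M' *ᵥ x with hv
  refine ⟨M', (M' - M) * K * (M' - M)ᵀ + vecMulVec v v, ?_, fun A => ?_⟩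
  · refine PosSemidef.add ?_ (posSemidef_vecMulVec_self v)
    simpa [conjTranspose_eq_transpose_of_trivial] using
      hK.posSemidef.mul_mul_conjTranspose_same (M' - M)
  · set D := A - M' with hD
    set E := M' - M with hE
    have e1 : A - M = D + E := by rw [hD, hE]; abel
    have e2 : y - A *ᵥ x = v - D *ᵥ x := by rw [hD, hv, sub_mulVec]; abel
    -- The normal equation for M' in residual form; it makes the terms linear in D cancel.
    have h2 : E * K = vecMulVec v x := by
      rw [Matrix.mul_add, mul_vecMulVec] at h1
      rw [hE, hv, Matrix.sub_mul, sub_vecMulVec]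
      rw [sub_eq_sub_iff_add_eq_add, h1]; abel
    have h3 : K * Eᵀ = vecMulVec x v := by
      have := congrArg transpose h2
      rwa [transpose_mul, hKt, transpose_vecMulVec] at this
    have e3 : vecMulVec v (D *ᵥ x) = vecMulVec v x * Dᵀ := by
      rw [vecMulVec_mul, vecMul_transpose]
    have e4 : vecMulVec (D *ᵥ x) v = D * vecMulVec x v := by rw [mul_vecMulVec]
    have e5 : vecMulVec (D *ᵥ x) (D *ᵥ x) = D * vecMulVec x x * Dᵀ := by
      rw [mul_vecMulVec, vecMulVec_mul, vecMul_transpose]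
    rw [e1, e2, sub_vecMulVec, vecMulVec_sub v v, vecMulVec_sub (D *ᵥ x) v, e3, e4, e5,
      transpose_add, ← h2, ← h3]
    simp only [Matrix.add_mul, Matrix.mul_add, Matrix.mul_assoc]
    abel

theorem posDef_add_sum_vecMulVec {σ : Type*} {K : Matrix ι ι ℝ} (hK : K.PosDef) (S : Finset σ)
    (x : σ → ι → ℝ) : (K + ∑ s ∈ S, vecMulVec (x s) (x s)).PosDef :=
  hK.add_posSemidef (posSemidef_sum S fun s _ => posSemidef_vecMulVec_self (x s))

/-- Completing the square for finitely many observations. -/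
theorem exists_complete_square_sum [DecidableEq ι] {σ : Type*} {M₀ : Matrix m ι ℝ} {K₀ : Matrix ι ι ℝ}
    (hK : K₀.PosDef) {Q₀ : Matrix m m ℝ} (hQ : Q₀.PosDef) (S : Finset σ) (x : σ → ι → ℝ)
    (y : σ → m → ℝ) :
    ∃ (M : Matrix m ι ℝ) (Q : Matrix m m ℝ), Q.PosDef ∧ ∀ A : Matrix m ι ℝ,
      (A - M₀) * K₀ * (A - M₀)ᵀ + Q₀ + ∑ s ∈ S, vecMulVec (y s - A *ᵥ x s) (y s - A *ᵥ x s) =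
        (A - M) * (K₀ + ∑ s ∈ S, vecMulVec (x s) (x s)) * (A - M)ᵀ + Q := by
  classical
  induction S using Finset.induction_on with
  | empty => exact ⟨M₀, Q₀, hQ, fun A => by simp⟩
  | insert a S ha ih =>
    obtain ⟨M, Q, hQ', h⟩ := ih
    obtain ⟨M', R, hR, h'⟩ := exists_complete_square (M := M)
      (posDef_add_sum_vecMulVec hK S x) (x a) (y a)
    refine ⟨M', Q + R, hQ'.add_posSemidef hR, fun A => ?_⟩
    rw [Finset.sum_insert ha, Finset.sum_insert ha, add_comm (vecMulVec (y a - _) _), ← add_assoc, h,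
      add_right_comm, h', add_comm (vecMulVec (x a) _), add_assoc K₀, add_assoc _ R,
      add_comm R]

/-- A square root of `K` adapted to a vector `x`. -/
theorem exists_sqrt_adapted [DecidableEq ι] {K : Matrix ι ι ℝ} (hK : K.PosDef) (x : ι → ℝ) (i : ι) :
    ∃ L : Matrix ι ι ℝ, IsUnit L.det ∧ K = L * Lᵀ ∧
      x = √(x ⬝ᵥ (K⁻¹ *ᵥ x)) • (L *ᵥ Pi.single i 1) := by
  obtain ⟨C, hC, h1, h2⟩ := exists_isUnit_inv_eq hK
  obtain ⟨O, hO, hw⟩ := exists_orthogonal_mulVec_eq_smul_single (C *ᵥ x) i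
  have hO' : Oᵀ * O = 1 := mul_eq_one_comm.1 hO
  rw [h1, dotProduct_transpose_mul_self_mulVec]
  -- With K⁻¹ = Cᵀ C, C⁻¹ is a square root of K, and an orthogonal factor may be inserted freely. O
  -- turns C x, of length √(xᵀ K⁻¹ x), into the direction of the i-th axis.
  refine ⟨C⁻¹ * Oᵀ, ?_, ?_, ?_⟩
  · rw [det_mul]
    refine (isUnit_nonsing_inv_det _ hC).mul (isUnit_iff_ne_zero.2 fun h => ?_)
    have := congrArg det hO'
    simp [h] at this
  · rw [transpose_mul, transpose_transpose, Matrix.mul_assoc, ← Matrix.mul_assoc Oᵀ, hO',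
      Matrix.one_mul]
    exact h2
  · rw [← mulVec_smul, ← hw, ← mulVec_mulVec, mulVec_mulVec _ Oᵀ, hO', one_mulVec, mulVec_mulVec,
      nonsing_inv_mul _ hC, one_mulVec]

theorem trace_transpose_mul_mul_mul (A : Matrix m ι ℝ) (W : Matrix m m ℝ) (K : Matrix ι ι ℝ) :
    (Aᵀ * W * A * K).trace = (W * (A * K * Aᵀ)).trace := by
  rw [Matrix.mul_assoc, Matrix.mul_assoc, trace_mul_comm, Matrix.mul_assoc]

theorem trace_mul_vecMulVec_self (W : Matrix m m ℝ) (v : m → ℝ) :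
    (W * vecMulVec v v).trace = v ⬝ᵥ (W *ᵥ v) := by
  rw [mul_vecMulVec, trace_vecMulVec, dotProduct_comm]

end Conjugacy

/-! ### Marginals of product densities -/

section Marginals

/-- A product of probability densities is the density of the product measure, whose coordinate
projections preserve measure. This is what discards all columns of (A - M) L except the one along x.
-/
theorem lintegral_prod_mul_comp_eval {ι E : Type} [Fintype ι] [MeasureSpace E]
    [SigmaFinite (volume : Measure E)] {g : E → ℝ} (hg : Measurable g) (hg0 : ∀ x, 0 ≤ g x)
    (h1 : ∫⁻ x, ENNReal.ofReal (g x) = 1) (i : ι) {H : E → ℝ≥0∞} (hH : Measurable H) :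
    ∫⁻ b : ι → E, (∏ j, ENNReal.ofReal (g (b j))) * H (b i) =
      ∫⁻ x, ENNReal.ofReal (g x) * H x := by
  have hgm : Measurable fun x => ENNReal.ofReal (g x) := hg.ennreal_ofReal
  have hgint : Integrable g := by
    refine ⟨hg.aestronglyMeasurable, ?_⟩
    rw [hasFiniteIntegral_iff_ofReal (Filter.Eventually.of_forall hg0), h1]
    exact ENNReal.one_lt_top
  have hprob : IsProbabilityMeasure ((volume : Measure E).withDensity fun x => ENNReal.ofReal (g x)) :=
    ⟨by rw [withDensity_apply _ MeasurableSet.univ, Measure.restrict_univ, h1]⟩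
  have hpm : Measurable fun b : ι → E => ∏ j, ENNReal.ofReal (g (b j)) :=
    Finset.measurable_prod _ fun j _ => hgm.comp (measurable_pi_apply j)
  have hpi : Measure.pi (fun _ : ι => (volume : Measure E).withDensity fun x => ENNReal.ofReal (g x)) =
      (volume : Measure (ι → E)).withDensity fun b => ∏ j, ENNReal.ofReal (g (b j)) := by
    refine Measure.pi_eq fun s hs => ?_
    rw [withDensity_apply _ (MeasurableSet.univ_pi hs), ← lintegral_indicator (MeasurableSet.univ_pi hs)]
    have hind : ∀ j, Integrable ((s j).indicator g) := fun j => hgint.indicator (hs j)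
    have hind0 : ∀ j x, 0 ≤ (s j).indicator g x := fun j x => Set.indicator_nonneg (fun _ _ => hg0 _) x
    have e1 : ∀ b : ι → E, (Set.univ.pi s).indicator (fun b => ∏ j, ENNReal.ofReal (g (b j))) b =
        ENNReal.ofReal (∏ j, (s j).indicator g (b j)) := by
      intro b
      rw [ENNReal.ofReal_prod_of_nonneg fun j _ => hind0 j _]
      by_cases hb : b ∈ Set.univ.pi s
      · rw [Set.indicator_of_mem hb]
        exact Finset.prod_congr rfl fun j _ => by rw [Set.indicator_of_mem (hb j (Set.mem_univ j))]
      · rw [Set.indicator_of_notMem hb]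
        simp only [Set.mem_pi, Set.mem_univ, true_implies, not_forall] at hb
        obtain ⟨j, hj⟩ := hb
        exact (Finset.prod_eq_zero (Finset.mem_univ j) (by simp [Set.indicator_of_notMem hj])).symm
    simp_rw [e1]
    rw [volume_pi, ← ofReal_integral_eq_lintegral_ofReal
      (Integrable.fintype_prod_dep fun j => hind j)
      (Filter.Eventually.of_forall fun b => Finset.prod_nonneg fun j _ => hind0 j _),
      integral_fintype_prod_eq_prod, ENNReal.ofReal_prod_of_nonneg fun j _ => integral_nonneg (hind0 j)]
    refine Finset.prod_congr rfl fun j _ => ?_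
    rw [ofReal_integral_eq_lintegral_ofReal (hind j) (Filter.Eventually.of_forall (hind0 j)),
      withDensity_apply _ (hs j), ← lintegral_indicator (hs j)]
    refine lintegral_congr fun x => ?_
    by_cases hx : x ∈ s j <;> simp [hx]
  have hmp := measurePreserving_eval
    (fun _ : ι => (volume : Measure E).withDensity fun x => ENNReal.ofReal (g x)) i
  have e2 := hmp.lintegral_comp hH
  rw [hpi, lintegral_withDensity_eq_lintegral_mul _ hpm (g := fun b => H (Function.eval i b))
    (hH.comp (measurable_pi_apply i)),
    lintegral_withDensity_eq_lintegral_mul _ hgm hH] at e2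
  exact e2

end Marginals

/-! ### The posterior law -/

section Posterior

variable {d : ℕ} {ι : Type} [Fintype ι] [DecidableEq ι]

theorem wishartConst_pos {n : ℝ} (hn : (d : ℝ) - 1 < n) : 0 < wishartConst n d := by
  have := Real.pi_pos
  refine mul_pos (by positivity) (Finset.prod_pos fun i hi => Real.Gamma_pos_of_pos ?_)
  have : (i : ℝ) ≤ d := by exact_mod_cast (Finset.mem_Icc.1 hi).2
  linarith

theorem prod_normalDensity {σ : Type*} (S : Finset σ) (μ y : σ → Fin d → ℝ)
    {V : Matrix (Fin d) (Fin d) ℝ} (hV : V.PosDef) :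
    ∏ s ∈ S, normalDensity (μ s) V (y s) =
      ((2 * Real.pi) ^ d * V.det) ^ (-((S.card : ℝ) / 2)) *
        Real.exp (-(1 / 2) * (V⁻¹ * ∑ s ∈ S, vecMulVec (y s - μ s) (y s - μ s)).trace) := by
  have hD := det_two_pi_smul_pos hV
  rw [det_two_pi_smul] at hD
  have htr : (V⁻¹ * ∑ s ∈ S, vecMulVec (y s - μ s) (y s - μ s)).trace =
      ∑ s ∈ S, (y s - μ s) ⬝ᵥ (V⁻¹ *ᵥ (y s - μ s)) := by
    rw [Matrix.mul_sum, trace_sum]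
    exact Finset.sum_congr rfl fun s _ => trace_mul_vecMulVec_self _ _
  unfold normalDensity
  rw [Finset.prod_mul_distrib, Finset.prod_const, ← Real.exp_sum, ← Finset.mul_sum, det_two_pi_smul,
    ← Real.rpow_natCast, ← Real.rpow_mul hD.le, htr]
  congr 2
  ring

/-- After completing the square the exponent is tr(V⁻¹ ((A - M) L Lᵀ (A - M)ᵀ + Q)), and the first
part is the sum of the quadratic forms of the columns of (A - M) L. The order of quantifiers
matters: M, Q, a and C are fixed before L, which may later be adapted to the regressor of each
control. -/
theorem prior_mul_likelihood_eq {M₀ : Matrix (Fin d) ι ℝ} {K₀ : Matrix ι ι ℝ} (hK : K₀.PosDef)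
    {Q₀ : Matrix (Fin d) (Fin d) ℝ} (hQ : Q₀.PosDef) {n₀ : ℝ} (hn : (d : ℝ) - 1 < n₀)
    {σ : Type*} (S : Finset σ) (x : σ → ι → ℝ) (y : σ → Fin d → ℝ) :
    ∃ (M : Matrix (Fin d) ι ℝ) (Q : Matrix (Fin d) (Fin d) ℝ) (a C : ℝ),
      Q.PosDef ∧ (d : ℝ) < a ∧ 0 < C ∧
      ∀ L : Matrix ι ι ℝ, K₀ + ∑ s ∈ S, vecMulVec (x s) (x s) = L * Lᵀ →
      ∀ (A : Matrix (Fin d) ι ℝ) (V : Matrix (Fin d) (Fin d) ℝ),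
        ENNReal.ofReal (matrixNormalDensity M₀ V K₀ A * invWishartDensity Q₀ n₀ V) *
          ENNReal.ofReal (∏ s ∈ S, normalDensity (A *ᵥ x s) V (y s)) =
        ENNReal.ofReal C * (∏ j, gauss V (((A - M) * L).col j)) * invWishartWeight a Q V := by
  obtain ⟨M, Q, hQ', hsq⟩ := exists_complete_square_sum (M₀ := M₀) hK hQ S x y
  have hpi := Real.pi_pos
  have hW := wishartConst_pos hn
  have hK0 := hK.det_pos
  have hQ0 := hQ.det_pos
  set p : ℝ := (2 * Real.pi) ^ d with hp
  have hp0 : 0 < p := by positivity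
  -- The factor |V|^{-m/2} of the matrix normal density is used up by the m column densities; the
  -- other powers of |V| add up to a. The assumption n₀ > d - 1 is exactly what makes the first two
  -- terms exceed d.
  refine ⟨M, Q, ((d : ℝ) + 1) / 2 + n₀ / 2 + (S.card : ℝ) / 2,
    K₀.det ^ ((d : ℝ) / 2) * (1 / wishartConst n₀ d) * ((1 / 2) ^ d * Q₀.det) ^ (n₀ / 2) *
      p ^ (-((S.card : ℝ) / 2)), hQ', ?_, by positivity, fun L hL A V => ?_⟩
  · have : (0 : ℝ) ≤ S.card := Nat.cast_nonneg _
    linarith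
  by_cases hV : V.PosDef
  swap
  · rw [invWishartWeight_of_not_posDef _ _ hV, invWishartDensity, if_neg hV]
    simp
  have hD := hV.det_pos
  have hprod := prod_normalDensity Finset.univ (fun _ => 0) (fun j => ((A - M) * L).col j) hV
  have hcols : ∑ j, vecMulVec (((A - M) * L).col j - 0) (((A - M) * L).col j - 0) =
      (A - M) * (K₀ + ∑ s ∈ S, vecMulVec (x s) (x s)) * (A - M)ᵀ := by
    rw [hL]
    have : (A - M) * (L * Lᵀ) * (A - M)ᵀ = ((A - M) * L) * ((A - M) * L)ᵀ := by
      rw [transpose_mul]; simp only [Matrix.mul_assoc]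
    rw [this]
    generalize (A - M) * L = B
    ext i k
    simp [mul_apply, Matrix.sum_apply, vecMulVec_apply]
  rw [hcols, Finset.card_univ] at hprod
  have hgauss : ∏ j, gauss V (((A - M) * L).col j) =
      ENNReal.ofReal (∏ j, normalDensity 0 V (((A - M) * L).col j)) :=
    (ENNReal.ofReal_prod_of_nonneg fun j _ => (normalDensity_pos hV _).le).symm
  have hg0 : 0 ≤ ∏ j, normalDensity 0 V (((A - M) * L).col j) :=
    Finset.prod_nonneg fun j _ => (normalDensity_pos hV _).le
  have hl0 : 0 ≤ ∏ s ∈ S, normalDensity (A *ᵥ x s) V (y s) :=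
    Finset.prod_nonneg fun s _ => (normalDensity_pos hV _).le
  rw [hgauss, invWishartWeight_of_posDef _ _ hV, ← ENNReal.ofReal_mul' hg0,
    ← ENNReal.ofReal_mul' hl0, ← ENNReal.ofReal_mul' (by positivity), hprod,
    prod_normalDensity S _ _ hV, invWishartDensity, if_pos hV, matrixNormalDensity]
  congr 1
  have hdet : ((1 / 2 : ℝ) • (V⁻¹ * Q₀)).det = (1 / 2) ^ d * Q₀.det * V.det⁻¹ := by
    rw [det_smul, det_mul, det_nonsing_inv, Ring.inverse_eq_inv', Fintype.card_fin]; ring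
  have hexp : Real.exp (-(1 / 2) * ((A - M₀)ᵀ * V⁻¹ * (A - M₀) * K₀).trace) *
      Real.exp (-(1 / 2) * (V⁻¹ * Q₀).trace) *
      Real.exp (-(1 / 2) * (V⁻¹ * ∑ s ∈ S, vecMulVec (y s - A *ᵥ x s) (y s - A *ᵥ x s)).trace) =
      Real.exp (-(1 / 2) * (V⁻¹ * ((A - M) * (K₀ + ∑ s ∈ S, vecMulVec (x s) (x s)) *
        (A - M)ᵀ)).trace) * Real.exp (-(1 / 2) * (V⁻¹ * Q).trace) := by
    rw [← Real.exp_add, ← Real.exp_add, ← Real.exp_add, trace_transpose_mul_mul_mul, ← mul_add,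
      ← mul_add, ← mul_add, ← trace_add, ← trace_add, ← trace_add, ← Matrix.mul_add,
      ← Matrix.mul_add, ← Matrix.mul_add, hsq A]
  rw [det_two_pi_smul, ← hp, hdet, Real.mul_rpow (by positivity) (by positivity : 0 ≤ V.det⁻¹),
    Real.inv_rpow hD.le, Real.mul_rpow hp0.le hD.le, Real.mul_rpow hp0.le hD.le,
    Real.mul_rpow hp0.le hD.le, neg_add, neg_add, Real.rpow_add hD, Real.rpow_add hD,
    ← Real.rpow_neg hD.le, one_div (V.det ^ _), ← Real.rpow_neg hD.le, div_eq_mul_inv, mul_inv,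
    ← Real.rpow_neg hD.le, ← Real.rpow_neg hp0.le]
  linear_combination (K₀.det ^ ((d : ℝ) / 2) * (1 / wishartConst n₀ d) *
    ((1 / 2) ^ d * Q₀.det) ^ (n₀ / 2) * p ^ (-((S.card : ℝ) / 2)) *
    p ^ (-((Fintype.card ι : ℝ) / 2)) * V.det ^ (-((Fintype.card ι : ℝ) / 2)) *
    V.det ^ (-(((d : ℝ) + 1) / 2)) * V.det ^ (-(n₀ / 2)) * V.det ^ (-((S.card : ℝ) / 2))) * hexp

theorem measurable_sub_mul_col {α β : Type} [Fintype β] (M : Matrix α β ℝ) (L : Matrix β β ℝ) :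
    Measurable fun (A : Matrix α β ℝ) (j : β) => ((A - M) * L).col j := by
  refine measurable_pi_iff.2 fun j => measurable_pi_iff.2 fun i => ?_
  simp only [col_apply, mul_apply, Matrix.sub_apply]
  exact Finset.measurable_sum _ fun k _ =>
    ((measurable_matrix_apply i k).sub_const _).mul_const _

/-- Lebesgue measure on matrices in the columns of `(A - M) L`. -/
theorem exists_map_matrixLebesgue_col (M : Matrix (Fin d) ι ℝ) {L : Matrix ι ι ℝ}
    (hL : IsUnit L.det) :
    ∃ c : ℝ≥0∞, c ≠ 0 ∧ c ≠ ∞ ∧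
      (matrixLebesgue (Fin d) ι).map (fun A j => ((A - M) * L).col j) =
        c • (volume : Measure (ι → Fin d → ℝ)) := by
  let Λ₀ : (Fin d → ι → ℝ) →ₗ[ℝ] (ι → Fin d → ℝ) :=
    { toFun := fun a j => (of a * L).col j
      map_add' := fun a b => by
        ext j i; simp [mul_apply, add_mul, Finset.sum_add_distrib]
      map_smul' := fun r a => by
        ext j i; simp [mul_apply, Finset.mul_sum, mul_assoc] }
  have hinj : Function.Injective Λ₀ := by
    intro a b hab
    have h1 : of a * L = of b * L := by
      ext i j; exact congrFun (congrFun hab j) i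
    have h2 := congrArg (· * L⁻¹) h1
    simp only [Matrix.mul_assoc, mul_nonsing_inv _ hL, Matrix.mul_one] at h2
    exact of.injective h2
  have hfr : Module.finrank ℝ (Fin d → ι → ℝ) = Module.finrank ℝ (ι → Fin d → ℝ) := by
    simp [Module.finrank_pi_fintype, mul_comm]
  let Λ := (LinearEquiv.ofInjectiveOfFinrankEq Λ₀ hinj hfr).toContinuousLinearEquiv
  have hΛ : ∀ a, Λ a = fun j => (of a * L).col j := fun a => rfl
  have hvol (α β : Type) [Fintype α] [Fintype β] :
      (volume : Measure (α → β → ℝ)).IsAddHaarMeasure :=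
    Measure.pi.isAddHaarMeasure fun _ => (volume : Measure (β → ℝ))
  have := hvol (Fin d) ι
  have := hvol ι (Fin d)
  have hHaar : ((volume : Measure (Fin d → ι → ℝ)).map Λ).IsAddHaarMeasure :=
    Λ.isAddHaarMeasure_map volume
  -- Uniqueness of Haar measure provides the Jacobian as an unspecified constant, which later
  -- cancels in the normalization of the posterior.
  obtain ⟨c, hc⟩ : ∃ c : NNReal,
      (volume : Measure (Fin d → ι → ℝ)).map Λ = c • (volume : Measure (ι → Fin d → ℝ)) :=
    ⟨_, Measure.isAddLeftInvariant_eq_smul _ volume⟩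
  refine ⟨c, ?_, ENNReal.coe_ne_top, ?_⟩
  · intro h0
    have h0' : c = 0 := by exact_mod_cast h0
    have h1 : ((volume : Measure (Fin d → ι → ℝ)).map Λ) Set.univ = 0 := by
      rw [hc, h0', zero_smul]; rfl
    exact (isOpen_univ.measure_pos _ Set.univ_nonempty).ne' h1
  · have hof : Measurable fun a : Fin d → ι → ℝ => (of a : Matrix (Fin d) ι ℝ) := measurable_id
    rw [matrixLebesgue, Measure.map_map (measurable_sub_mul_col M L) hof]
    have hcomp : (fun (A : Matrix (Fin d) ι ℝ) (j : ι) => ((A - M) * L).col j) ∘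
        (fun a : Fin d → ι → ℝ => (of a : Matrix (Fin d) ι ℝ)) =
        Λ ∘ fun a => a - of.symm M := by
      ext a; rfl
    have hsub : Measurable fun a : Fin d → ι → ℝ => a - of.symm M := by fun_prop
    rw [hcomp, ← Measure.map_map Λ.continuous.measurable hsub,
      (measurePreserving_sub_right volume (of.symm M)).map_eq, hc]
    rfl

end Posterior

/-! ### Measurability and integration against the posterior density -/

section PosteriorLaw

variable {d : ℕ} {ι : Type} [Fintype ι]

instance instSFiniteMatrixLebesgue (α β : Type) [Fintype α] [Fintype β] :
    SFinite (matrixLebesgue α β) := by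
  unfold matrixLebesgue; infer_instance

theorem measurable_matrixNormalDensity [DecidableEq ι] (M : Matrix (Fin d) ι ℝ)
    (K : Matrix ι ι ℝ) :
    Measurable fun θ : Matrix (Fin d) ι ℝ × Matrix (Fin d) (Fin d) ℝ =>
      matrixNormalDensity M θ.2 K θ.1 := by
  have hA (i : Fin d) (k : ι) : Measurable fun θ : Matrix (Fin d) ι ℝ × Matrix (Fin d) (Fin d) ℝ =>
      θ.1 i k - M i k := ((measurable_matrix_apply i k).comp measurable_fst).sub_const _
  have hW (i j : Fin d) : Measurable fun θ : Matrix (Fin d) ι ℝ × Matrix (Fin d) (Fin d) ℝ =>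
      θ.2⁻¹ i j := (measurable_matrix_apply i j).comp (measurable_matrix_inv.comp measurable_snd)
  unfold matrixNormalDensity
  simp only [det_smul]
  refine Measurable.mul
    ((((measurable_matrix_det.comp measurable_snd).const_mul _).pow_const _).const_div _)
    (Measurable.exp (Measurable.const_mul ?_ _))
  simp only [trace, diag_apply, mul_apply, transpose_apply, Matrix.sub_apply]
  exact Finset.measurable_sum _ fun k _ => Finset.measurable_sum _ fun k' _ =>
    (Finset.measurable_sum _ fun i _ =>
      (Finset.measurable_sum _ fun j _ => (hA _ _).mul (hW _ _)).mul (hA _ _)).mul_const _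

theorem measurable_invWishartDensity (Q : Matrix (Fin d) (Fin d) ℝ) (n : ℝ) :
    Measurable (invWishartDensity Q n) := by
  unfold invWishartDensity
  refine Measurable.ite measurableSet_posDef ?_ measurable_const
  refine ((((measurable_matrix_det.pow_const _).const_div _).const_mul _).mul ?_).mul
    ((measurable_trace_inv_mul Q).const_mul _).exp
  simp only [det_smul, det_mul]
  exact (((measurable_matrix_det.comp measurable_matrix_inv).mul_const _).const_mul _).pow_const _

theorem measurable_normalDensity_mulVec (x : ι → ℝ) (y : Fin d → ℝ) :
    Measurable fun θ : Matrix (Fin d) ι ℝ × Matrix (Fin d) (Fin d) ℝ =>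
      normalDensity (θ.1 *ᵥ x) θ.2 y := by
  have h : (fun θ : Matrix (Fin d) ι ℝ × Matrix (Fin d) (Fin d) ℝ =>
      normalDensity (θ.1 *ᵥ x) θ.2 y) = fun θ => normalDensity 0 θ.2 (y - θ.1 *ᵥ x) := by
    simp only [normalDensity, sub_zero]
  rw [h]
  have hm : Measurable fun θ : Matrix (Fin d) ι ℝ × Matrix (Fin d) (Fin d) ℝ => θ.1 *ᵥ x :=
    measurable_mulVec.comp (measurable_fst.prodMk measurable_const)
  exact measurable_normalDensity.comp (measurable_snd.prodMk (hm.const_sub y))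

/-- Integrating out all columns of `(A - M) L` but one. -/
theorem exists_lintegral_prod_gauss_col [DecidableEq ι] (M : Matrix (Fin d) ι ℝ) {L : Matrix ι ι ℝ}
    (hL : IsUnit L.det) (i : ι) (a : ℝ) (Q : Matrix (Fin d) (Fin d) ℝ) :
    ∃ c : ℝ≥0∞, c ≠ 0 ∧ c ≠ ∞ ∧
      ∀ h : Matrix (Fin d) (Fin d) ℝ × (Fin d → ℝ) → ℝ≥0∞, Measurable h →
        ∫⁻ θ, (∏ j, gauss θ.2 (((θ.1 - M) * L).col j)) * invWishartWeight a Q θ.2 *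
            h (θ.2, ((θ.1 - M) * L).col i) ∂((matrixLebesgue (Fin d) ι).prod (symLebesgue d)) =
          c * ∫⁻ V, invWishartWeight a Q V * (∫⁻ e, gauss V e * h (V, e)) ∂(symLebesgue d) := by
  obtain ⟨c, hc0, hct, hc⟩ := exists_map_matrixLebesgue_col M hL
  refine ⟨c, hc0, hct, fun h hh => ?_⟩
  have hcol := measurable_sub_mul_col M L
  have hw := measurable_invWishartWeight a Q
  have hcolj (j : ι) : Measurable fun θ : Matrix (Fin d) ι ℝ × Matrix (Fin d) (Fin d) ℝ =>
      ((θ.1 - M) * L).col j := (measurable_pi_apply j).comp (hcol.comp measurable_fst)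
  have hint : Measurable fun V => ∫⁻ e, gauss V e * h (V, e) :=
    Measurable.lintegral_prod_right' (f := fun p => gauss p.1 p.2 * h p) (measurable_gauss.mul hh)
  have hwi : Measurable fun V => invWishartWeight a Q V * ∫⁻ e, gauss V e * h (V, e) :=
    hw.mul hint
  rw [lintegral_prod_symm _ (Measurable.aemeasurable ?_), ← lintegral_const_mul _ hwi]
  swap
  · exact ((Finset.measurable_prod _ fun j _ => measurable_gauss_comp measurable_snd (hcolj j)).mul
      (hw.comp measurable_snd)).mul (hh.comp (measurable_snd.prodMk (hcolj i)))
  refine lintegral_congr fun V => ?_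
  by_cases hV : V.PosDef
  swap
  · simp [invWishartWeight_of_not_posDef a Q hV]
  have hH : Measurable fun e : Fin d → ℝ => h (V, e) := hh.comp measurable_prodMk_left
  have hg : Measurable fun e : Fin d → ℝ => normalDensity 0 V e :=
    measurable_normalDensity.comp measurable_prodMk_left
  have key := lintegral_prod_mul_comp_eval hg (fun e => (normalDensity_pos hV e).le)
    (lintegral_gauss hV) i hH
  have hF : Measurable fun b : ι → Fin d → ℝ => (∏ j, gauss V (b j)) * h (V, b i) :=
    (Finset.measurable_prod _ fun j _ =>
      (measurable_gauss_left V).comp (measurable_pi_apply j)).mul (hH.comp (measurable_pi_apply i))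
  have hFc : Measurable fun A : Matrix (Fin d) ι ℝ => (fun b : ι → Fin d → ℝ =>
      (∏ j, gauss V (b j)) * h (V, b i)) fun j => ((A - M) * L).col j := hF.comp hcol
  calc ∫⁻ A, (∏ j, gauss V (((A - M) * L).col j)) * invWishartWeight a Q V *
        h (V, ((A - M) * L).col i) ∂(matrixLebesgue (Fin d) ι)
      = ∫⁻ A, invWishartWeight a Q V * ((fun b : ι → Fin d → ℝ => (∏ j, gauss V (b j)) *
          h (V, b i)) fun j => ((A - M) * L).col j) ∂(matrixLebesgue (Fin d) ι) := by
        refine lintegral_congr fun A => ?_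
        ring
    _ = c * (invWishartWeight a Q V * ∫⁻ e, gauss V e * h (V, e)) := by
        rw [lintegral_const_mul _ hFc, ← lintegral_map hF hcol, hc,
          lintegral_smul_measure, smul_eq_mul, mul_left_comm]
        congr 2

theorem lintegral_invWishartLaw_gauss (a : ℝ) (Q : Matrix (Fin d) (Fin d) ℝ)
    (h : Matrix (Fin d) (Fin d) ℝ × (Fin d → ℝ) → ℝ≥0∞) (hh : Measurable h) :
    ∫⁻ p, h p ∂(((invWishartLaw a Q).prod volume).withDensity fun p => gauss p.1 p.2) =
      (∫⁻ V, invWishartWeight a Q V ∂(symLebesgue d))⁻¹ *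
        ∫⁻ V, invWishartWeight a Q V * (∫⁻ e, gauss V e * h (V, e)) ∂(symLebesgue d) := by
  have hint : Measurable fun V => ∫⁻ e, gauss V e * h (V, e) :=
    Measurable.lintegral_prod_right' (f := fun p => gauss p.1 p.2 * h p) (measurable_gauss.mul hh)
  rw [lintegral_withDensity_eq_lintegral_mul _ measurable_gauss hh,
    lintegral_prod _ (measurable_gauss.mul hh).aemeasurable, invWishartLaw, lintegral_smul_measure,
    smul_eq_mul]
  congr 1
  exact lintegral_withDensity_eq_lintegral_mul _ (measurable_invWishartWeight a Q) hint

end PosteriorLaw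

/-! ### The posterior of A x for a fixed regressor -/

section Network

variable {d c I J : ℕ}

/-- Under the posterior law, `A x` is an affine image of a normal vector with covariance `V`. -/
theorem exists_posteriorLaw_structure (hd : 0 < d) (g : (Fin d → ℝ) ≃ (Fin d → ℝ))
    (M₀ : Matrix (Fin d) (RegIdx d c I J) ℝ)
    {K₀ : Matrix (RegIdx d c I J) (RegIdx d c I J) ℝ} (hK : K₀.PosDef)
    {Q₀ : Matrix (Fin d) (Fin d) ℝ} (hQ : Q₀.PosDef) {n₀ : ℝ} (hn : (d : ℝ) - 1 < n₀)
    (r : ℤ → Fin d → ℝ) (u : ℤ → Fin c → ℝ) (t : ℕ) :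
    ∃ (M : Matrix (Fin d) (RegIdx d c I J) ℝ) (π : Measure (Matrix (Fin d) (Fin d) ℝ)),
      IsCovarianceLaw π ∧ ∀ x : RegIdx d c I J → ℝ,
        IsProbabilityMeasure (posteriorLaw g M₀ K₀ Q₀ n₀ r u t) ∧
        ∃ f : Param d c I J → Fin d → ℝ, Measurable f ∧
          (∀ θ, θ.1 *ᵥ x = M *ᵥ x + √(x ⬝ᵥ ((precision K₀ r u t)⁻¹ *ᵥ x)) • f θ) ∧
          (posteriorLaw g M₀ K₀ Q₀ n₀ r u t).map (fun θ => (θ.2, f θ)) =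
            (π.prod volume).withDensity fun p => gauss p.1 p.2 := by
  obtain ⟨M, Q, a, C, hQ', ha, hC, hdens⟩ := prior_mul_likelihood_eq (M₀ := M₀) hK hQ hn
    (Finset.Icc (1 : ℤ) t) (regressor I J r u) (fun s => g.symm (r s))
  have hπ := isCovarianceLaw_invWishartLaw ha hQ'
  refine ⟨M, invWishartLaw a Q, hπ, fun x => ?_⟩
  -- Any index would do; d > 0 ensures that there is one.
  let i₀ : RegIdx d c I J := Sum.inl (0, ⟨0, hd⟩)
  have hKt : (precision K₀ r u t).PosDef := posDef_add_sum_vecMulVec hK _ _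
  -- L and f depend on x, while M and the covariance law were chosen before x.
  obtain ⟨L, hL, hLL, hx⟩ := exists_sqrt_adapted hKt x i₀
  obtain ⟨b, hb0, hbt, hb⟩ := exists_lintegral_prod_gauss_col M hL i₀ a Q
  obtain ⟨l, -, -, hZt⟩ := exists_integrable_of_detTraceWeight_bound ha hQ'
  have hZ0 := lintegral_invWishartWeight_ne_zero a Q
  set Z := ∫⁻ V, invWishartWeight a Q V ∂(symLebesgue d) with hZ
  set f : Param d c I J → Fin d → ℝ := fun θ => ((θ.1 - M) * L).col i₀ with hf
  have hfm : Measurable f :=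
    (measurable_pi_apply i₀).comp ((measurable_sub_mul_col M L).comp measurable_fst)
  have hTm : Measurable fun θ : Param d c I J => (θ.2, f θ) := measurable_snd.prodMk hfm
  have hcolm (j : RegIdx d c I J) : Measurable fun θ : Param d c I J => ((θ.1 - M) * L).col j :=
    (measurable_pi_apply j).comp ((measurable_sub_mul_col M L).comp measurable_fst)
  have hUP : unnormalizedPosterior g M₀ K₀ Q₀ n₀ r u t =
      ((matrixLebesgue (Fin d) (RegIdx d c I J)).prod (symLebesgue d)).withDensity fun θ =>
        ENNReal.ofReal C * (∏ j, gauss θ.2 (((θ.1 - M) * L).col j)) * invWishartWeight a Q θ.2 := by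
    rw [unnormalizedPosterior, priorLaw, ← withDensity_mul]
    · congr 1
      funext θ
      exact hdens L hLL θ.1 θ.2
    · exact ((measurable_matrixNormalDensity M₀ K₀).mul
        ((measurable_invWishartDensity Q₀ n₀).comp measurable_snd)).ennreal_ofReal
    · exact (Finset.measurable_prod _ fun s _ =>
        measurable_normalDensity_mulVec _ _).ennreal_ofReal
  have hdm : Measurable fun θ : Param d c I J =>
      ENNReal.ofReal C * (∏ j, gauss θ.2 (((θ.1 - M) * L).col j)) * invWishartWeight a Q θ.2 :=
    ((Finset.measurable_prod _ fun j _ =>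
      measurable_gauss_comp measurable_snd (hcolm j)).const_mul _).mul
      ((measurable_invWishartWeight a Q).comp measurable_snd)
  set k := ENNReal.ofReal C * b * Z with hk
  have hk0 : k ≠ 0 := mul_ne_zero (mul_ne_zero (by simpa using hC) hb0) hZ0
  have hkt : k ≠ ∞ := ENNReal.mul_ne_top (ENNReal.mul_ne_top ENNReal.ofReal_ne_top hbt) hZt.ne
  have hmap : (unnormalizedPosterior g M₀ K₀ Q₀ n₀ r u t).map (fun θ => (θ.2, f θ)) =
      k • ((invWishartLaw a Q).prod volume).withDensity fun p => gauss p.1 p.2 := by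
    refine Measure.ext_of_lintegral _ fun h hh => ?_
    have hhT : Measurable fun θ : Param d c I J => h (θ.2, f θ) := hh.comp hTm
    rw [lintegral_map hh hTm, hUP, lintegral_withDensity_eq_lintegral_mul _ hdm hhT,
      lintegral_smul_measure, lintegral_invWishartLaw_gauss a Q h hh, smul_eq_mul, ← hZ, hk,
      mul_assoc, ← mul_assoc Z, ENNReal.mul_inv_cancel hZ0 hZt.ne, one_mul, mul_assoc, ← hb h hh,
      ← lintegral_const_mul]
    · refine lintegral_congr fun θ => ?_
      simp only [Pi.mul_apply, hf, mul_assoc]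
    · exact ((Finset.measurable_prod _ fun j _ =>
        measurable_gauss_comp measurable_snd (hcolm j)).mul
        ((measurable_invWishartWeight a Q).comp measurable_snd)).mul (hh.comp hTm)
  -- The joint law of (V, f) is itself a noisy law with parameter V, hence of mass one. Comparing
  -- total masses then identifies the normalizing constant of the posterior as k.
  have hone : (((invWishartLaw a Q).prod volume).withDensity fun p : Matrix (Fin d) (Fin d) ℝ ×
      (Fin d → ℝ) => gauss p.1 p.2) Set.univ = 1 := by
    have := hπ.prob
    exact (isProbabilityMeasure_noisyLaw (ρ := invWishartLaw a Q) measurable_id hπ.posDef).measure_univ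
  have huniv : unnormalizedPosterior g M₀ K₀ Q₀ n₀ r u t Set.univ = k := by
    have h1 := congrArg (fun μ => μ Set.univ) hmap
    simp only [Measure.map_apply hTm MeasurableSet.univ, Set.preimage_univ, Measure.smul_apply,
      hone, smul_eq_mul, mul_one] at h1
    exact h1
  refine ⟨⟨?_⟩, f, hfm, fun θ => ?_, ?_⟩
  · rw [posteriorLaw, Measure.smul_apply, huniv, smul_eq_mul, ENNReal.inv_mul_cancel hk0 hkt]
  · have h1 : f θ = (θ.1 - M) *ᵥ (L *ᵥ Pi.single i₀ 1) := by
      rw [mulVec_mulVec, mulVec_single_one]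
    rw [h1, ← mulVec_smul, ← hx, sub_mulVec]
    abel
  · rw [posteriorLaw, Measure.map_smul, hmap, huniv, smul_smul, ENNReal.inv_mul_cancel hk0 hkt,
      one_smul]

end Network

/-! ### Information as a function of the control -/

section Information

variable {d c I J : ℕ}

theorem cost_nonneg {K₀ : Matrix (RegIdx d c I J) (RegIdx d c I J) ℝ} (hK : K₀.PosDef)
    (r : ℤ → Fin d → ℝ) (u : ℤ → Fin c → ℝ) (t : ℕ) (v : Fin c → ℝ) : 0 ≤ cost K₀ r u t v :=
  quadForm_inv_nonneg (posDef_add_sum_vecMulVec hK _ _) _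

/-- Both mutual informations are functions of the cost, up to additive constants. -/
theorem exists_info_eq (hd : 0 < d) (g : (Fin d → ℝ) ≃ (Fin d → ℝ))
    (M₀ : Matrix (Fin d) (RegIdx d c I J) ℝ)
    {K₀ : Matrix (RegIdx d c I J) (RegIdx d c I J) ℝ} (hK : K₀.PosDef)
    {Q₀ : Matrix (Fin d) (Fin d) ℝ} (hQ : Q₀.PosDef) {n₀ : ℝ} (hn : (d : ℝ) - 1 < n₀)
    (r : ℤ → Fin d → ℝ) (u : ℤ → Fin c → ℝ) (t : ℕ) :
    ∃ α β : ℝ, ∀ v : Fin c → ℝ,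
      (paramInfo g M₀ K₀ Q₀ n₀ r u t v =
          ENNReal.ofReal (d * Real.log √(1 + cost K₀ r u t v) + α) ∧
        0 ≤ d * Real.log √(1 + cost K₀ r u t v) + α) ∧
      (cost K₀ r u t v = 0 → noiseInfo g M₀ K₀ Q₀ n₀ r u t v = ∞) ∧
      (0 < cost K₀ r u t v →
        noiseInfo g M₀ K₀ Q₀ n₀ r u t v =
          ENNReal.ofReal (d * Real.log (√(1 + cost K₀ r u t v) / √(cost K₀ r u t v)) + β) ∧
        0 ≤ d * Real.log (√(1 + cost K₀ r u t v) / √(cost K₀ r u t v)) + β) := by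
  obtain ⟨M, π, hπ, hpost⟩ := exists_posteriorLaw_structure hd g M₀ hK hQ hn r u t
  refine ⟨meanLogNormal π - meanLogMix π, meanLogMixPair π - 2 * meanLogMix π, fun v => ?_⟩
  have hκ := cost_nonneg hK r u t v
  set κ := cost K₀ r u t v with hκdef
  obtain ⟨hprob, f, hf, hdec, hlaw⟩ := hpost (nextRegressor I J r u t v)
  set ρ := posteriorLaw g M₀ K₀ Q₀ n₀ r u t with hρ
  have hV : Measurable fun θ : Param d c I J => θ.2 := measurable_snd
  have := isProbabilityMeasure_noisyLaw hV (ae_posDef_of_law hπ hV hf hlaw)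
  have hpred : predictiveLaw g M₀ K₀ Q₀ n₀ r u t = noisyLaw ρ fun θ => θ.2 := rfl
  have hs0 : √(1 + κ) ≠ 0 := (Real.sqrt_pos.2 (by positivity)).ne'
  -- The output is the normalized output followed by scaling with √(1+κ) and translation by M x, a
  -- measurable equivalence that mutual information does not see.
  have hout : nextOutput (I := I) (J := J) r u t v = fun ω =>
      ((MeasurableEquiv.smul₀ √(1 + κ) hs0).trans
        (MeasurableEquiv.addRight (M *ᵥ nextRegressor I J r u t v)))
        ((√(1 + κ))⁻¹ • ω.2 + ((√(1 + κ))⁻¹ * √κ) • f ω.1) := by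
    funext ω
    have h1 : nextOutput r u t v ω = M *ᵥ nextRegressor I J r u t v + √κ • f ω.1 + ω.2 :=
      congrArg (· + ω.2) (hdec ω.1)
    have h2 : √(1 + κ) • ((√(1 + κ))⁻¹ • ω.2 + ((√(1 + κ))⁻¹ * √κ) • f ω.1) =
        ω.2 + √κ • f ω.1 := by
      rw [smul_add, smul_smul, smul_smul, ← mul_assoc, mul_inv_cancel₀ hs0, one_smul, one_mul]
    rw [h1]
    change _ = √(1 + κ) • ((√(1 + κ))⁻¹ • ω.2 + ((√(1 + κ))⁻¹ * √κ) • f ω.1) +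
      M *ᵥ nextRegressor I J r u t v
    rw [h2]
    abel
  have hZ : Measurable fun ω : Param d c I J × (Fin d → ℝ) =>
      (√(1 + κ))⁻¹ • ω.2 + ((√(1 + κ))⁻¹ * √κ) • f ω.1 := by fun_prop
  refine ⟨?_, fun h0 => ?_, fun hpos => ?_⟩
  · rw [paramInfo, hpred, hout, mutualInfo_comp_measurableEquiv _ measurable_fst hZ]
    exact mutualInfo_param_eq hπ hV hf hlaw hκ
  · rw [noiseInfo, hpred, hout, mutualInfo_comp_measurableEquiv _ measurable_snd hZ, h0]
    simpa using mutualInfo_noise_self_eq_top hd hπ hV hf hlaw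
  · rw [noiseInfo, hpred, hout, mutualInfo_comp_measurableEquiv _ measurable_snd hZ]
    exact mutualInfo_noise_eq hπ hV hf hlaw hpos

theorem log_sqrt_one_add_lt_iff {a b : ℝ} (ha : 0 ≤ a) (hb : 0 ≤ b) :
    Real.log √(1 + a) < Real.log √(1 + b) ↔ a < b := by
  rw [Real.log_lt_log_iff (Real.sqrt_pos.2 (by positivity)) (Real.sqrt_pos.2 (by positivity)),
    Real.sqrt_lt_sqrt_iff (by positivity), add_lt_add_iff_left]

theorem log_sqrt_div_sqrt_lt_iff {a b : ℝ} (ha : 0 < a) (hb : 0 < b) :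
    Real.log (√(1 + a) / √a) < Real.log (√(1 + b) / √b) ↔ b < a := by
  rw [← Real.sqrt_div (by positivity), ← Real.sqrt_div (by positivity),
    Real.log_lt_log_iff (Real.sqrt_pos.2 (by positivity)) (Real.sqrt_pos.2 (by positivity)),
    Real.sqrt_lt_sqrt_iff (by positivity), div_lt_div_iff₀ ha hb]
  constructor <;> intro h <;> nlinarith

/-- Parameter information increases strictly with the cost, noise information decreases. -/
theorem info_lt_iff (hd : 0 < d) (g : (Fin d → ℝ) ≃ (Fin d → ℝ))
    (M₀ : Matrix (Fin d) (RegIdx d c I J) ℝ)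
    {K₀ : Matrix (RegIdx d c I J) (RegIdx d c I J) ℝ} (hK : K₀.PosDef)
    {Q₀ : Matrix (Fin d) (Fin d) ℝ} (hQ : Q₀.PosDef) {n₀ : ℝ} (hn : (d : ℝ) - 1 < n₀)
    (r : ℤ → Fin d → ℝ) (u : ℤ → Fin c → ℝ) (t : ℕ) (v w : Fin c → ℝ) :
    (paramInfo g M₀ K₀ Q₀ n₀ r u t v < paramInfo g M₀ K₀ Q₀ n₀ r u t w ↔
        cost K₀ r u t v < cost K₀ r u t w) ∧
      (noiseInfo g M₀ K₀ Q₀ n₀ r u t v < noiseInfo g M₀ K₀ Q₀ n₀ r u t w ↔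
        cost K₀ r u t w < cost K₀ r u t v) := by
  obtain ⟨α, β, h⟩ := exists_info_eq hd g M₀ hK hQ hn r u t
  obtain ⟨⟨hp, hp0⟩, hn0, hn1⟩ := h v
  obtain ⟨⟨hp', hp0'⟩, hn0', hn1'⟩ := h w
  have hv := cost_nonneg hK r u t v
  have hw := cost_nonneg hK r u t w
  have hd' : (0 : ℝ) < d := by exact_mod_cast hd
  constructor
  · rw [hp, hp', ENNReal.ofReal_lt_ofReal_iff_of_nonneg hp0, add_lt_add_iff_right,
      mul_lt_mul_iff_right₀ hd', log_sqrt_one_add_lt_iff hv hw]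
  -- Zero cost has infinite noise information and has to be compared separately with the finite
  -- values at positive cost.
  · rcases hv.eq_or_lt with h0 | hpos
    · rw [hn0 h0.symm, ← h0]
      simp [hw]
    · rcases hw.eq_or_lt with h0 | hpos'
      · rw [hn0' h0.symm, (hn1 hpos).1, ← h0]
        simp [hpos]
      · rw [(hn1 hpos).1, (hn1' hpos').1, ENNReal.ofReal_lt_ofReal_iff_of_nonneg (hn1 hpos).2,
          add_lt_add_iff_right, mul_lt_mul_iff_right₀ hd', log_sqrt_div_sqrt_lt_iff hpos hpos']

end Information

end NoiseDesign

theorem mainTheorem2 {d c I J : ℕ} (hd : 0 < d)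
    (g : (Fin d → ℝ) ≃ (Fin d → ℝ))
    (M₀ : Matrix (Fin d) (NoiseDesign.RegIdx d c I J) ℝ)
    (K₀ : Matrix (NoiseDesign.RegIdx d c I J) (NoiseDesign.RegIdx d c I J) ℝ) (hK : K₀.PosDef)
    (Q₀ : Matrix (Fin d) (Fin d) ℝ) (hQ : Q₀.PosDef)
    (n₀ : ℝ) (hn : (d : ℝ) - 1 < n₀)
    (r : ℤ → Fin d → ℝ) (u : ℤ → Fin c → ℝ) (t : ℕ) (U : Set (Fin c → ℝ)) :
    {v ∈ U | IsMaxOn (NoiseDesign.noiseInfo g M₀ K₀ Q₀ n₀ r u t) U v} =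
        {v ∈ U | IsMinOn (NoiseDesign.cost K₀ r u t) U v} ∧
      {v ∈ U | IsMaxOn (NoiseDesign.paramInfo g M₀ K₀ Q₀ n₀ r u t) U v} =
        {v ∈ U | IsMaxOn (NoiseDesign.cost K₀ r u t) U v} ∧
      (∀ v w : Fin c → ℝ,
        NoiseDesign.noiseInfo g M₀ K₀ Q₀ n₀ r u t v < NoiseDesign.noiseInfo g M₀ K₀ Q₀ n₀ r u t w ↔
          NoiseDesign.paramInfo g M₀ K₀ Q₀ n₀ r u t w <
            NoiseDesign.paramInfo g M₀ K₀ Q₀ n₀ r u t v) ∧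
      (∀ v ∈ U, IsMaxOn (NoiseDesign.noiseInfo g M₀ K₀ Q₀ n₀ r u t) U v →
        IsMaxOn (NoiseDesign.paramInfo g M₀ K₀ Q₀ n₀ r u t) U v →
          ∀ w ∈ U, NoiseDesign.cost K₀ r u t w = NoiseDesign.cost K₀ r u t v) := by
  have hlt := fun v w => NoiseDesign.info_lt_iff hd g M₀ hK hQ hn r u t v w
  -- Strict comparisons for all pairs determine the weak ones by negation, the orders being linear;
  -- extremal points only need the weak form.
  have hnoise : ∀ v w, NoiseDesign.noiseInfo g M₀ K₀ Q₀ n₀ r u t v ≤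
      NoiseDesign.noiseInfo g M₀ K₀ Q₀ n₀ r u t w ↔
        NoiseDesign.cost K₀ r u t w ≤ NoiseDesign.cost K₀ r u t v := fun v w => by
    rw [← not_lt, (hlt w v).2, not_lt]
  have hparam : ∀ v w, NoiseDesign.paramInfo g M₀ K₀ Q₀ n₀ r u t v ≤
      NoiseDesign.paramInfo g M₀ K₀ Q₀ n₀ r u t w ↔
        NoiseDesign.cost K₀ r u t v ≤ NoiseDesign.cost K₀ r u t w := fun v w => by
    rw [← not_lt, (hlt w v).1, not_lt]
  refine ⟨?_, ?_, fun v w => (hlt v w).2.trans (hlt w v).1.symm, fun v _ h1 h2 w hw => ?_⟩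
  · ext v
    simp only [Set.mem_ofPred_eq, isMaxOn_iff, isMinOn_iff, hnoise]
  · ext v
    simp only [Set.mem_ofPred_eq, isMaxOn_iff, hparam]
  · exact le_antisymm ((hparam _ _).1 (isMaxOn_iff.1 h2 w hw))
      ((hnoise _ _).1 (isMaxOn_iff.1 h1 w hw))
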